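/- Let $0<T<\infty$. Consider real functions $\eta,u$ on $[0,1]\times[0,T]$ that solve classically one of the initial-boundary-value problems $$\text{(CB)}\quad \eta_t+u_x+(\eta u)_x=0,\qquad u_t+\eta_x+uu_x-\tfrac13u_{xxt}=0,$$ $$\text{(SCB)}\quad \eta_t+u_x+\tfrac12(\eta u)_x=0,\qquad u_t+\eta_x+\tfrac32uu_x+\tfrac12\eta\eta_x-\tfrac13u_{xxt}=0$$ on $[0,1]\times[0,T]$, with $\eta(\cdot,0)=\eta_0$, $u(\cdot,0)=u_0$ on $[0,1]$ and $u(0,t)=u(1,t)=0$ for $t\in[0,T]$. Suppose that $\eta\in C(0,T;W^4_\infty)$ and $u\in C(0,T;W^4_\infty\cap H^1_0)$, where $W^4_\infty=W^4_\infty(0,1)$, $H^1_0=H^1_0(0,1)$ and $C(0,T;X)$ is the set of functions $f$ with $f(t)\in X$ for $t\in[0,T]$ and $t\mapsto\|f(t)\|_X$ continuous on $[0,T]$; both spaces here carry the norm of $W^4_\infty$, i.e. $\|f\|_{4,\infty}=\max_{0\le j\le4}\|f^{(j)}\|_{L^\infty(0,1)}$. For a partition $0=x_1<x_2<\dots<x_{N+1}=1$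 put $h=\max_i(x_{i+1}-x_i)$, let $S_h$ be the space of $\phi\in C^2[0,1]$ that are polynomials of degree at most $3$ on each $[x_j,x_{j+1}]$, and let $S_{h,0}=\{\phi\in S_h:\phi(0)=\phi(1)=0\}$. Let $(\cdot,\cdot)$, $\|\cdot\|$ be the inner product and norm of $L^2(0,1)$, $a(\psi,\chi)=(\psi,\chi)+\tfrac13(\psi',\chi')$ and $\|v\|_1=(\|v\|^2+\tfrac13\|v'\|^2)^{1/2}$. Let $P$ be the $L^2$ projection onto $S_h$, and let $R_hw\in S_{h,0}$ be given by $a(R_hw,\chi)=a(w,\chi)$ for all $\chi\in S_{h,0}$. The semidiscretization of (CB) asks for differentiable $\eta_h:[0,T]\to S_h$, $u_h:[0,T]\to S_{h,0}$ with $\eta_h(0)=P\eta_0$, $u_h(0)=R_hu_0$ and, for all $t\in[0,T]$, $$(\eta_{ht},\phi)+(u_{hx},\phi)+((\eta_hu_h)_x,\phi)=0\quad\forall\phi\in S_h,$$ $$a(u_{ht},\chi)+(\eta_{hx},\chi)+(u_hu_{hx},\chi)=0\quad\forall\chi\in S_{h,0}.$$ The semidiscretization of (SCB) is the same with the equations $$(\eta_{ht},\phi)+(u_{hx},\phi)+\tfrac12((\eta_hu_h)_x,\phi)=0\quad\forall\phi\in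 S_h,$$ $$a(u_{ht},\chi)+(\eta_{hx},\chi)+\tfrac32(u_hu_{hx},\chi)+\tfrac12(\eta_h\eta_{hx},\chi)=0\quad\forall\chi\in S_{h,0}.$$ Then for each of the two problems and every $\kappa$ there are constants $h_0>0$ and $C>0$ such that, for every partition with $h\le h_0$ that is quasiuniform with constant $\kappa$, i.e. $x_{i+1}-x_i\le\kappa(x_{j+1}-x_j)$ for all $i,j$, the semidiscretization has a unique solution $(\eta_h,u_h)$ on $[0,T]$, and $$\max_{0\le t\le T}\|\eta(t)-\eta_h(t)\|\le Ch^3,\qquad \max_{0\le t\le T}\|u(t)-u_h(t)\|_1\le Ch^3 .$$ The constants may depend on $\kappa$, $T$ and $(\eta,u)$, but not otherwise on the partition. -/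

import Mathlib

namespace Boussinesq

noncomputable section

/-! ### Function spaces and norms on the interval `[0,1]`

A function on `[0,1]` is represented by `f : ℝ → ℝ`; only its values on `[0,1]` matter.
A function of `(x,t)` is written in the order `f t x`. -/

/-- Lebesgue measure on `(0,1)`. -/
abbrev μ01 : MeasureTheory.Measure ℝ := MeasureTheory.volume.restrict (Set.Ioo (0 : ℝ) 1)

/-- The classical spatial derivative on `[0,1]` (one-sided at the end points). -/
def dx (f : ℝ → ℝ) : ℝ → ℝ := derivWithin f (Set.Icc (0 : ℝ) 1)

/-- The `L²(0,1)` inner product. -/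
def ip (f g : ℝ → ℝ) : ℝ := ∫ x in (0 : ℝ)..1, f x * g x

/-- The `L²(0,1)` norm. -/
def normL2 (f : ℝ → ℝ) : ℝ := Real.sqrt (ip f f)

/-- The bilinear form `a(ψ,χ) = (ψ,χ) + (1/3)(ψ',χ')`. -/
def a (ψ χ : ℝ → ℝ) : ℝ := ip ψ χ + (1 / 3) * ip (dx ψ) (dx χ)

/-- The norm `‖v‖₁ = (‖v‖² + (1/3)‖v'‖²)^{1/2}` on `H¹(0,1)`, used for `C¹` functions. -/
def normH1 (v : ℝ → ℝ) : ℝ := Real.sqrt (normL2 v ^ 2 + (1 / 3) * normL2 (dx v) ^ 2)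

/-- `g` is a weak derivative of order `j` of `f` on `(0,1)`. -/
def IsWeakDeriv (j : ℕ) (f g : ℝ → ℝ) : Prop :=
  MeasureTheory.LocallyIntegrableOn f (Set.Ioo (0 : ℝ) 1) ∧
  MeasureTheory.LocallyIntegrableOn g (Set.Ioo (0 : ℝ) 1) ∧
  ∀ φ : ℝ → ℝ, ContDiff ℝ (⊤ : ℕ∞) φ → HasCompactSupport φ →
    tsupport φ ⊆ Set.Ioo (0 : ℝ) 1 →
    ∫ x, f x * iteratedDeriv j φ x ∂μ01 = (-1) ^ j * ∫ x, g x * φ x ∂μ01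

open Classical in
/-- The weak derivative of order `j` (unique up to null sets), when there is one. -/
def weakDeriv (j : ℕ) (f : ℝ → ℝ) : ℝ → ℝ :=
  if h : ∃ g, IsWeakDeriv j f g then h.choose else 0

/-- Membership in the Sobolev space `W^k_∞(0,1)`. -/
def MemWInfty (k : ℕ) (f : ℝ → ℝ) : Prop :=
  ∀ j ≤ k, ∃ g, IsWeakDeriv j f g ∧ MeasureTheory.MemLp g ⊤ μ01

/-- The norm of `W^k_∞(0,1)`: the largest of the `L^∞` norms of the weak derivatives of
order `0, …, k`. -/
def normWInfty (k : ℕ) (f : ℝ → ℝ) : ENNReal :=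
  (Finset.range (k + 1)).sup fun j => MeasureTheory.eLpNorm (weakDeriv j f) ⊤ μ01

/-- `f ∈ C(0,T; W^k_∞)`: each `f(t)` lies in `W^k_∞` and `t ↦ ‖f(t)‖_{k,∞}` is continuous on
`[0,T]`. (Continuity of `t ↦ f(t)` in the norm implies this.) -/
def MemCWInfty (T : ℝ) (k : ℕ) (f : ℝ → ℝ → ℝ) : Prop :=
  (∀ t ∈ Set.Icc 0 T, MemWInfty k (f t)) ∧
  ContinuousOn (fun t => normWInfty k (f t)) (Set.Icc 0 T)

/-! ### The initial-boundary-value problems -/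

/-- Classical solutions `(η,u)` on `[0,1] × [0,T]` of
`η_t + u_x + α (η u)_x = 0`,
`u_t + η_x + β u u_x + γ η η_x - (1/3) u_xxt = 0`,
with `η(·,0) = η₀`, `u(·,0) = u₀` and `u(0,t) = u(1,t) = 0`. -/
structure IsSolution (α β γ T : ℝ) (η₀ u₀ : ℝ → ℝ) (η u : ℝ → ℝ → ℝ) : Prop where
  contDiff_η : ∀ t ∈ Set.Icc 0 T, ContDiffOn ℝ 1 (η t) (Set.Icc 0 1)
  contDiff_u : ∀ t ∈ Set.Icc 0 T, ContDiffOn ℝ 2 (u t) (Set.Icc 0 1)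
  pde : ∀ t ∈ Set.Icc 0 T, ∀ x ∈ Set.Icc (0 : ℝ) 1, ∃ ηt ut uxxt : ℝ,
    HasDerivWithinAt (fun s => η s x) ηt (Set.Icc 0 T) t ∧
    HasDerivWithinAt (fun s => u s x) ut (Set.Icc 0 T) t ∧
    HasDerivWithinAt (fun s => dx (dx (u s)) x) uxxt (Set.Icc 0 T) t ∧
    ηt + dx (u t) x + α * dx (fun y => η t y * u t y) x = 0 ∧
    ut + dx (η t) x + β * (u t x * dx (u t) x) + γ * (η t x * dx (η t) x)
      - (1 / 3) * uxxt = 0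
  initial_η : ∀ x ∈ Set.Icc (0 : ℝ) 1, η 0 x = η₀ x
  initial_u : ∀ x ∈ Set.Icc (0 : ℝ) 1, u 0 x = u₀ x
  boundary : ∀ t ∈ Set.Icc 0 T, u t 0 = 0 ∧ u t 1 = 0

/-- Solutions of the classical Boussinesq problem (CB). -/
def IsSolutionCB (T : ℝ) (η₀ u₀ : ℝ → ℝ) (η u : ℝ → ℝ → ℝ) : Prop :=
  IsSolution 1 1 0 T η₀ u₀ η u

/-- Solutions of the symmetric problem (SCB). -/
def IsSolutionSCB (T : ℝ) (η₀ u₀ : ℝ → ℝ) (η u : ℝ → ℝ → ℝ) : Prop :=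
  IsSolution (1 / 2) (3 / 2) (1 / 2) T η₀ u₀ η u

/-! ### Meshes and cubic splines -/

/-- A partition `0 = x₀ < x₁ < ⋯ < x_N = 1` of `[0,1]`. -/
structure Mesh (N : ℕ) where
  node : Fin (N + 1) → ℝ
  strictMono : StrictMono node
  first : node 0 = 0
  last : node (Fin.last N) = 1

namespace Mesh

variable {N : ℕ} (m : Mesh N)

/-- The length of the `i`-th subinterval. -/
def width (i : Fin N) : ℝ := m.node i.succ - m.node i.castSucc

/-- The mesh size `h`, the largest of the lengths. -/
def h : ℝ := ⨆ i : Fin N, m.width i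

/-- Quasiuniformity with constant `κ`: the ratio of any two lengths is at most `κ`. -/
def Quasiuniform (κ : ℝ) : Prop := ∀ i j : Fin N, m.width i ≤ κ * m.width j

/-- The space `S_h` of `C²` cubic splines on `[0,1]` relative to the mesh. -/
def S : Set (ℝ → ℝ) :=
  {φ | ContDiffOn ℝ 2 φ (Set.Icc 0 1) ∧
    ∀ i : Fin N, ∃ p : Polynomial ℝ, p.natDegree ≤ 3 ∧
      ∀ x ∈ Set.Icc (m.node i.castSucc) (m.node i.succ), φ x = p.eval x}

/-- The space `S_{h,0}` of cubic splines vanishing at `0` and `1`. -/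
def S0 : Set (ℝ → ℝ) := {φ | φ ∈ m.S ∧ φ 0 = 0 ∧ φ 1 = 0}

/-- `p = P v`, the `L²` projection of `v` onto `S_h`. -/
def IsL2Proj (v p : ℝ → ℝ) : Prop := p ∈ m.S ∧ ∀ φ ∈ m.S, ip p φ = ip v φ

/-- `r = R_h w`, the elliptic projection of `w` onto `S_{h,0}`. -/
def IsEllipticProj (w r : ℝ → ℝ) : Prop := r ∈ m.S0 ∧ ∀ χ ∈ m.S0, a r χ = a w χ

end Mesh

/-! ### The semidiscretizations -/

/-- `(ηh, uh)` solves on `[0,T]` the standard Galerkin semidiscretization, on the cubic splines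
of the mesh `m`, of the problem in `IsSolution`, with initial data `P η₀` and `R_h u₀`.
Here `ηht t`, `uht t` are the time derivatives; the spline spaces being finite-dimensional,
pointwise time derivatives are derivatives in the space. -/
structure IsGalerkin {N : ℕ} (α β γ T : ℝ) (m : Mesh N) (η₀ u₀ : ℝ → ℝ)
    (ηh uh : ℝ → ℝ → ℝ) : Prop where
  mem_η : ∀ t ∈ Set.Icc 0 T, ηh t ∈ m.S
  mem_u : ∀ t ∈ Set.Icc 0 T, uh t ∈ m.S0
  ode : ∀ t ∈ Set.Icc 0 T, ∃ ηht ∈ m.S, ∃ uht ∈ m.S0,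
    (∀ x ∈ Set.Icc (0 : ℝ) 1, HasDerivWithinAt (fun s => ηh s x) (ηht x) (Set.Icc 0 T) t) ∧
    (∀ x ∈ Set.Icc (0 : ℝ) 1, HasDerivWithinAt (fun s => uh s x) (uht x) (Set.Icc 0 T) t) ∧
    (∀ φ ∈ m.S,
      ip ηht φ + ip (dx (uh t)) φ + α * ip (dx (fun x => ηh t x * uh t x)) φ = 0) ∧
    (∀ χ ∈ m.S0,
      a uht χ + ip (dx (ηh t)) χ + β * ip (fun x => uh t x * dx (uh t) x) χ
        + γ * ip (fun x => ηh t x * dx (ηh t) x) χ = 0)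
  initial_η : m.IsL2Proj η₀ (ηh 0)
  initial_u : m.IsEllipticProj u₀ (uh 0)

/-- The semidiscretization of (CB). -/
def IsGalerkinCB {N : ℕ} (T : ℝ) (m : Mesh N) (η₀ u₀ : ℝ → ℝ) (ηh uh : ℝ → ℝ → ℝ) : Prop :=
  IsGalerkin 1 1 0 T m η₀ u₀ ηh uh

/-- The semidiscretization of (SCB). -/
def IsGalerkinSCB {N : ℕ} (T : ℝ) (m : Mesh N) (η₀ u₀ : ℝ → ℝ) (ηh uh : ℝ → ℝ → ℝ) : Prop :=
  IsGalerkin (1 / 2) (3 / 2) (1 / 2) T m η₀ u₀ ηh uh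

end

end Boussinesq

/-!
The semidiscrete solution is compared with the pair of projections `(P η, R_h u)`, and both systems
are treated at once as members of the family with coefficients `α, β, γ` of `IsSolution`.

*Approximation.* Functions in `W^4_∞` are `C³` with Lipschitz third derivative
(`exists_isRegular`, which rests on the lemma of du Bois-Reymond). For such a `w` let `e` be the
error of the complete cubic spline interpolant. Then `e''` is orthogonal to second derivatives of
splines, so that `e` vanishes at the nodes and `‖e''‖² = (e'', w'') = -(e', w''')`, which is
`O(‖e‖)` as `w'''` is Lipschitz. With `‖e‖ ≤ h ‖e'‖ ≤ h² ‖e''‖` this gives errors of order four in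
`L²` and three in `H¹` (`exists_spline_approx`). Orthogonality and the inverse inequality
(`Mesh.inverse_le`) carry these over to the projections, with order three in `H¹`
(`Mesh.IsL2Proj.error_le`, `Mesh.IsEllipticProj.error_le`).

*Energy estimate.* Let `θ = P η - η_h` and `ξ = R_h u - u_h`. By the definition of the projections
and the equations, the time derivative of `(P η, φ) + a(R_h u, χ) = (η, φ) + a(u, χ)` is the weak
form of the spatial part at `(η, u)`; here `a(u, χ) = (u - u''/3, χ)` replaces the missing control
of `u_t`. Subtracting the discrete equations and testing with `(θ, ξ)`, the right hand side is
`O(h³ r + r²)`, where `r² = ‖θ‖² + a(ξ, ξ)`, as long as `r ≤ h` (`weakForm_sub_le`). The delicate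
term is `((ηu - η_h u_h)_x, θ)`. It is split as
`ηu - η_h u_h = (P η)(u - u_h) + (η - P η) u + θ u_h`, the derivatives of the first two products are
of order `h³ + r` in `L²`, and `((θ u_h)_x, θ) = (θ u_hx, θ) / 2` together with the inverse inequality
for `θ` handles the third.

*Existence.* The estimate holds for every perturbation of the projections of size at most `h`. After
the error has been replaced by its radial retraction to the ball of radius `h`, the discrete system
has a bounded Lipschitz vector field and a global solution, and Grönwall's inequality bounds the
error by `O(h³)`. For small `h` this is below `h`, so the retraction was never active
(`exists_ode_solution_near`). Uniqueness is that of the polynomial system of ordinary differential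
equations.
-/

namespace Boussinesq

open Set MeasureTheory
open scoped Topology

/-! ### Calculus on `[0,1]` -/

/-- Functions that are continuously differentiable on `[0,1]` (one-sided at the end points). -/
abbrev C1 (f : ℝ → ℝ) : Prop := ContDiffOn ℝ 1 f (Icc 0 1)

theorem C1.hasDerivWithinAt {f : ℝ → ℝ} (hf : C1 f) {x : ℝ} (hx : x ∈ Icc (0 : ℝ) 1) :
    HasDerivWithinAt f (dx f x) (Icc 0 1) x :=
  ((hf.differentiableOn one_ne_zero) x hx).hasDerivWithinAt

theorem C1.continuousOn_dx {f : ℝ → ℝ} (hf : C1 f) : ContinuousOn (dx f) (Icc 0 1) :=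
  hf.continuousOn_derivWithin (uniqueDiffOn_Icc zero_lt_one) le_rfl

theorem dx_eq {f : ℝ → ℝ} {c x : ℝ} (hx : x ∈ Icc (0 : ℝ) 1)
    (h : HasDerivWithinAt f c (Icc 0 1) x) : dx f x = c :=
  h.derivWithin (uniqueDiffOn_Icc zero_lt_one x hx)

theorem dx_congr {f g : ℝ → ℝ} (h : EqOn f g (Icc 0 1)) : EqOn (dx f) (dx g) (Icc 0 1) :=
  fun _ hx => derivWithin_congr h (h hx)

theorem c1_of_hasDerivWithinAt {f f' : ℝ → ℝ}
    (h : ∀ x ∈ Icc (0 : ℝ) 1, HasDerivWithinAt f (f' x) (Icc 0 1) x)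
    (hc : ContinuousOn f' (Icc 0 1)) : C1 f := by
  rw [C1, show (1 : WithTop ℕ∞) = 0 + 1 by rfl,
    contDiffOn_succ_iff_derivWithin (uniqueDiffOn_Icc zero_lt_one)]
  refine ⟨fun x hx => (h x hx).differentiableWithinAt, by simp, ?_⟩
  rw [contDiffOn_zero]
  exact hc.congr fun x hx => dx_eq hx (h x hx)

theorem C1.congr {f g : ℝ → ℝ} (hf : C1 f) (h : EqOn g f (Icc 0 1)) : C1 g :=
  ContDiffOn.congr hf h

theorem C1.dx_add {f g : ℝ → ℝ} (hf : C1 f) (hg : C1 g) :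
    EqOn (dx fun x => f x + g x) (fun x => dx f x + dx g x) (Icc 0 1) :=
  fun _ hx => dx_eq hx ((hf.hasDerivWithinAt hx).add (hg.hasDerivWithinAt hx))

theorem C1.dx_sub {f g : ℝ → ℝ} (hf : C1 f) (hg : C1 g) :
    EqOn (dx fun x => f x - g x) (fun x => dx f x - dx g x) (Icc 0 1) :=
  fun _ hx => dx_eq hx ((hf.hasDerivWithinAt hx).sub (hg.hasDerivWithinAt hx))

theorem C1.dx_const_mul {f : ℝ → ℝ} (hf : C1 f) (c : ℝ) :
    EqOn (dx fun x => c * f x) (fun x => c * dx f x) (Icc 0 1) :=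
  fun _ hx => dx_eq hx ((hf.hasDerivWithinAt hx).const_mul c)

theorem C1.dx_mul {f g : ℝ → ℝ} (hf : C1 f) (hg : C1 g) :
    EqOn (dx fun x => f x * g x) (fun x => dx f x * g x + f x * dx g x) (Icc 0 1) :=
  fun _ hx => dx_eq hx ((hf.hasDerivWithinAt hx).mul (hg.hasDerivWithinAt hx))

theorem C1.add {f g : ℝ → ℝ} (hf : C1 f) (hg : C1 g) : C1 fun x => f x + g x :=
  ContDiffOn.add hf hg

theorem C1.sub {f g : ℝ → ℝ} (hf : C1 f) (hg : C1 g) : C1 fun x => f x - g x :=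
  ContDiffOn.sub hf hg

theorem C1.mul {f g : ℝ → ℝ} (hf : C1 f) (hg : C1 g) : C1 fun x => f x * g x :=
  ContDiffOn.mul hf hg

theorem C1.const_mul {f : ℝ → ℝ} (hf : C1 f) (c : ℝ) : C1 fun x => c * f x :=
  contDiffOn_const.mul hf

theorem c1_dx_of_contDiffOn_two {f : ℝ → ℝ} (hf : ContDiffOn ℝ 2 f (Icc 0 1)) : C1 (dx f) :=
  ((contDiffOn_succ_iff_derivWithin (n := 1) (uniqueDiffOn_Icc zero_lt_one)).1 hf).2.2

theorem c1_of_contDiffOn_two {f : ℝ → ℝ} (hf : ContDiffOn ℝ 2 f (Icc 0 1)) : C1 f :=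
  hf.of_le (by norm_num)

theorem contDiffOn_two_of_c1_dx {f : ℝ → ℝ} (hf : C1 f) (hf' : C1 (dx f)) :
    ContDiffOn ℝ 2 f (Icc 0 1) :=
  (contDiffOn_succ_iff_derivWithin (n := 1) (uniqueDiffOn_Icc zero_lt_one)).2
    ⟨hf.differentiableOn one_ne_zero, by simp, hf'⟩

theorem _root_.ContinuousOn.intervalIntegrable_of_mem {f : ℝ → ℝ} {a b c d : ℝ}
    (hf : ContinuousOn f (Icc a b)) (hc : c ∈ Icc a b) (hd : d ∈ Icc a b) :
    IntervalIntegrable f volume c d :=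
  (hf.mono (uIcc_subset_Icc hc hd)).intervalIntegrable

/-- The fundamental theorem of calculus between two points of an interval on which the integrand
is a continuous one-sided derivative. -/
theorem integral_eq_sub_of_hasDerivWithinAt {f f' : ℝ → ℝ} {a b c d : ℝ}
    (hf : ∀ x ∈ Icc a b, HasDerivWithinAt f (f' x) (Icc a b) x) (hf' : ContinuousOn f' (Icc a b))
    (hc : c ∈ Icc a b) (hd : d ∈ Icc a b) : ∫ x in c..d, f' x = f d - f c := by
  have hsub := uIcc_subset_Icc hc hd
  refine intervalIntegral.integral_eq_sub_of_hasDeriv_right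
    (fun x hx => ((hf x (hsub hx)).continuousWithinAt).mono hsub) (fun x hx => ?_)
    (hf'.intervalIntegrable_of_mem hc hd)
  have h1 : x ∈ Ioo a b := ⟨(le_min hc.1 hd.1).trans_lt hx.1, hx.2.trans_le (max_le hc.2 hd.2)⟩
  exact ((hf x (Ioo_subset_Icc_self h1)).hasDerivAt (Icc_mem_nhds h1.1 h1.2)).hasDerivWithinAt

theorem C1.integral_dx {f : ℝ → ℝ} (hf : C1 f) {c d : ℝ} (hc : c ∈ Icc (0 : ℝ) 1)
    (hd : d ∈ Icc (0 : ℝ) 1) : ∫ x in c..d, dx f x = f d - f c :=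
  integral_eq_sub_of_hasDerivWithinAt (fun _ hx => hf.hasDerivWithinAt hx) hf.continuousOn_dx hc hd

/-- The Cauchy–Schwarz inequality for continuous functions on `[a,b]`. -/
theorem sq_integral_mul_le {f g : ℝ → ℝ} {a b : ℝ} (hab : a ≤ b) (hf : ContinuousOn f (Icc a b))
    (hg : ContinuousOn g (Icc a b)) :
    (∫ x in a..b, f x * g x) ^ 2 ≤ (∫ x in a..b, f x * f x) * ∫ x in a..b, g x * g x := by
  have ha : a ∈ Icc a b := left_mem_Icc.2 hab
  have hb : b ∈ Icc a b := right_mem_Icc.2 hab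
  have hff := (hf.fun_mul hf).intervalIntegrable_of_mem ha hb
  have hfg := (hf.fun_mul hg).intervalIntegrable_of_mem ha hb
  have hgg := (hg.fun_mul hg).intervalIntegrable_of_mem ha hb
  have key : ∀ t : ℝ, 0 ≤ (∫ x in a..b, g x * g x) * (t * t) + (2 * ∫ x in a..b, f x * g x) * t
      + ∫ x in a..b, f x * f x := by
    intro t
    have h0 : 0 ≤ ∫ x in a..b, (f x + t * g x) * (f x + t * g x) :=
      intervalIntegral.integral_nonneg hab fun x _ => mul_self_nonneg _
    have h1 : ∫ x in a..b, (f x + t * g x) * (f x + t * g x) =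
        ∫ x in a..b, ((t * t) * (g x * g x) + (2 * t) * (f x * g x)) + f x * f x := by
      congr 1; ext x; ring
    rw [h1, intervalIntegral.integral_add ((hgg.const_mul _).add (hfg.const_mul _)) hff,
      intervalIntegral.integral_add (hgg.const_mul _) (hfg.const_mul _),
      intervalIntegral.integral_const_mul, intervalIntegral.integral_const_mul] at h0
    linarith
  have := discrim_le_zero key
  rw [discrim] at this
  nlinarith

/-- The increment of a function is bounded by the `L²` norm of its derivative. -/
theorem sq_sub_le_of_hasDerivWithinAt {f f' : ℝ → ℝ} {a b c x : ℝ} (hc : c ∈ Icc a b)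
    (hx : x ∈ Icc a b) (hf : ∀ x ∈ Icc a b, HasDerivWithinAt f (f' x) (Icc a b) x)
    (hf' : ContinuousOn f' (Icc a b)) :
    (f x - f c) ^ 2 ≤ (b - a) * ∫ x in a..b, f' x * f' x := by
  have hab : a ≤ b := hc.1.trans hc.2
  have ha : a ∈ Icc a b := left_mem_Icc.2 hab
  have hb : b ∈ Icc a b := right_mem_Icc.2 hab
  rw [← integral_eq_sub_of_hasDerivWithinAt hf hf' hc hx]
  have h2 : |∫ y in c..x, f' y| ≤ ∫ y in a..b, |f' y| := by
    have h3 := intervalIntegral.norm_integral_le_integral_norm_uIoc (f := f') (a := c) (b := x)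
      (μ := volume)
    simp only [Real.norm_eq_abs] at h3
    refine h3.trans ?_
    rw [intervalIntegral.integral_of_le hab]
    refine setIntegral_mono_set ?_ (Filter.Eventually.of_forall fun _ => abs_nonneg _) ?_
    · exact ((hf'.abs.intervalIntegrable_of_mem ha hb).1)
    · exact (Ioc_subset_Ioc (le_min hc.1 hx.1) (max_le hc.2 hx.2)).eventuallyLE
  have h4 := sq_integral_mul_le hab (f := fun _ => 1) continuousOn_const hf'.abs
  simp only [one_mul, abs_mul_abs_self] at h4
  rw [intervalIntegral.integral_const] at h4
  simp only [smul_eq_mul, mul_one] at h4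
  calc _ = |∫ y in c..x, f' y| ^ 2 := by rw [sq_abs]
    _ ≤ (∫ y in a..b, |f' y|) ^ 2 := by gcongr
    _ ≤ _ := h4

/-- If `f` vanishes somewhere in `[a,b]`, then `‖f‖ ≤ (b - a) ‖f'‖` in `L²(a,b)`. -/
theorem integral_sq_le_of_zero {f f' : ℝ → ℝ} {a b c : ℝ} (hc : c ∈ Icc a b) (hfc : f c = 0)
    (hf : ∀ x ∈ Icc a b, HasDerivWithinAt f (f' x) (Icc a b) x) (hf' : ContinuousOn f' (Icc a b)) :
    ∫ x in a..b, f x * f x ≤ (b - a) ^ 2 * ∫ x in a..b, f' x * f' x := by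
  have hab : a ≤ b := hc.1.trans hc.2
  have ha : a ∈ Icc a b := left_mem_Icc.2 hab
  have hb : b ∈ Icc a b := right_mem_Icc.2 hab
  have hfc' : ContinuousOn f (Icc a b) := fun x hx => (hf x hx).continuousWithinAt
  have hpt : ∀ x ∈ Icc a b, f x * f x ≤ (b - a) * ∫ x in a..b, f' x * f' x := by
    intro x hx
    have h := sq_sub_le_of_hasDerivWithinAt hc hx hf hf'
    rwa [hfc, sub_zero, sq] at h
  calc ∫ x in a..b, f x * f x ≤ ∫ x in a..b, (b - a) * ∫ x in a..b, f' x * f' x :=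
        intervalIntegral.integral_mono_on hab ((hfc'.mul hfc').intervalIntegrable_of_mem ha hb)
          intervalIntegrable_const hpt
    _ = _ := by rw [intervalIntegral.integral_const, smul_eq_mul]; ring

/-! ### The `L²` inner product -/

theorem zero_mem01 : (0 : ℝ) ∈ Icc (0 : ℝ) 1 := left_mem_Icc.2 zero_le_one

theorem one_mem01 : (1 : ℝ) ∈ Icc (0 : ℝ) 1 := right_mem_Icc.2 zero_le_one

theorem ip_comm (f g : ℝ → ℝ) : ip f g = ip g f := by
  simp only [ip, mul_comm]

theorem ip_congr {f f' g g' : ℝ → ℝ} (hf : EqOn f f' (Icc 0 1)) (hg : EqOn g g' (Icc 0 1)) :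
    ip f g = ip f' g' := by
  refine intervalIntegral.integral_congr fun x hx => ?_
  rw [uIcc_of_le zero_le_one] at hx
  simp only [hf hx, hg hx]

theorem intervalIntegrable_mul {f g : ℝ → ℝ} (hf : ContinuousOn f (Icc 0 1))
    (hg : ContinuousOn g (Icc 0 1)) : IntervalIntegrable (fun x => f x * g x) volume 0 1 :=
  (hf.mul hg).intervalIntegrable_of_mem zero_mem01 one_mem01

theorem ip_add_left {f g k : ℝ → ℝ} (hf : ContinuousOn f (Icc 0 1))
    (hg : ContinuousOn g (Icc 0 1)) (hk : ContinuousOn k (Icc 0 1)) :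
    ip (fun x => f x + g x) k = ip f k + ip g k := by
  simp only [ip, add_mul]
  exact intervalIntegral.integral_add (intervalIntegrable_mul hf hk) (intervalIntegrable_mul hg hk)

theorem ip_sub_left {f g k : ℝ → ℝ} (hf : ContinuousOn f (Icc 0 1))
    (hg : ContinuousOn g (Icc 0 1)) (hk : ContinuousOn k (Icc 0 1)) :
    ip (fun x => f x - g x) k = ip f k - ip g k := by
  simp only [ip, sub_mul]
  exact intervalIntegral.integral_sub (intervalIntegrable_mul hf hk) (intervalIntegrable_mul hg hk)

theorem ip_const_mul_left (c : ℝ) (f k : ℝ → ℝ) : ip (fun x => c * f x) k = c * ip f k := by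
  simp only [ip, mul_assoc]
  exact intervalIntegral.integral_const_mul _ _

theorem ip_add_right {f g k : ℝ → ℝ} (hf : ContinuousOn f (Icc 0 1))
    (hg : ContinuousOn g (Icc 0 1)) (hk : ContinuousOn k (Icc 0 1)) :
    ip k (fun x => f x + g x) = ip k f + ip k g := by
  rw [ip_comm, ip_add_left hf hg hk, ip_comm f, ip_comm g]

theorem ip_sub_right {f g k : ℝ → ℝ} (hf : ContinuousOn f (Icc 0 1))
    (hg : ContinuousOn g (Icc 0 1)) (hk : ContinuousOn k (Icc 0 1)) :
    ip k (fun x => f x - g x) = ip k f - ip k g := by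
  rw [ip_comm, ip_sub_left hf hg hk, ip_comm f, ip_comm g]

theorem ip_const_mul_right (c : ℝ) (f k : ℝ → ℝ) : ip k (fun x => c * f x) = c * ip k f := by
  rw [ip_comm, ip_const_mul_left, ip_comm]

theorem ip_self_nonneg (f : ℝ → ℝ) : 0 ≤ ip f f :=
  intervalIntegral.integral_nonneg zero_le_one fun _ _ => mul_self_nonneg _

theorem normL2_nonneg (f : ℝ → ℝ) : 0 ≤ normL2 f := Real.sqrt_nonneg _

theorem normL2_sq (f : ℝ → ℝ) : normL2 f ^ 2 = ip f f := Real.sq_sqrt (ip_self_nonneg f)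

theorem normL2_congr {f g : ℝ → ℝ} (h : EqOn f g (Icc 0 1)) : normL2 f = normL2 g := by
  rw [normL2, normL2, ip_congr h h]

theorem abs_ip_le {f g : ℝ → ℝ} (hf : ContinuousOn f (Icc 0 1))
    (hg : ContinuousOn g (Icc 0 1)) : |ip f g| ≤ normL2 f * normL2 g := by
  refine abs_le_of_sq_le_sq ?_ (mul_nonneg (normL2_nonneg f) (normL2_nonneg g))
  rw [mul_pow, normL2_sq, normL2_sq]
  exact sq_integral_mul_le zero_le_one hf hg

theorem normL2_add_le {f g : ℝ → ℝ} (hf : ContinuousOn f (Icc 0 1))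
    (hg : ContinuousOn g (Icc 0 1)) : normL2 (fun x => f x + g x) ≤ normL2 f + normL2 g := by
  refine abs_le_of_sq_le_sq' ?_ (add_nonneg (normL2_nonneg f) (normL2_nonneg g)) |>.2
  rw [normL2_sq, ip_add_left hf hg (hf.fun_add hg), ip_add_right hf hg hf, ip_add_right hf hg hg,
    ← normL2_sq f, ← normL2_sq g, ip_comm g f, add_sq]
  have := (le_abs_self _).trans (abs_ip_le hf hg)
  linarith

theorem normL2_neg (f : ℝ → ℝ) : normL2 (fun x => - f x) = normL2 f := by
  simp [normL2, ip]

theorem normL2_sub_le {f g : ℝ → ℝ} (hf : ContinuousOn f (Icc 0 1))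
    (hg : ContinuousOn g (Icc 0 1)) : normL2 (fun x => f x - g x) ≤ normL2 f + normL2 g := by
  simp only [sub_eq_add_neg]
  have h := normL2_add_le hf hg.fun_neg
  rwa [normL2_neg] at h

theorem normL2_le_mul {f g : ℝ → ℝ} {B : ℝ} (hB : 0 ≤ B) (hf : ContinuousOn f (Icc 0 1))
    (hg : ContinuousOn g (Icc 0 1)) (h : ∀ x ∈ Icc (0 : ℝ) 1, |f x| ≤ B * |g x|) :
    normL2 f ≤ B * normL2 g := by
  refine abs_le_of_sq_le_sq' ?_ (mul_nonneg hB (normL2_nonneg g)) |>.2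
  rw [mul_pow, normL2_sq, normL2_sq, ip, ip, ← intervalIntegral.integral_const_mul]
  refine intervalIntegral.integral_mono_on zero_le_one (intervalIntegrable_mul hf hf)
    ((intervalIntegrable_mul hg hg).const_mul _) fun x hx => ?_
  have := mul_self_le_mul_self (abs_nonneg _) (h x hx)
  rw [abs_mul_abs_self] at this
  calc _ ≤ _ := this
    _ = _ := by rw [mul_mul_mul_comm, abs_mul_abs_self, sq]

theorem normL2_le_of_bound {f : ℝ → ℝ} {B : ℝ} (hf : ContinuousOn f (Icc 0 1))
    (h : ∀ x ∈ Icc (0 : ℝ) 1, |f x| ≤ B) : normL2 f ≤ B := by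
  have hB : 0 ≤ B := (abs_nonneg _).trans (h 0 zero_mem01)
  have := normL2_le_mul hB hf (g := fun _ => 1) continuousOn_const (by simpa using h)
  simpa [normL2, ip] using this

theorem eqOn_zero_of_ip_self {f : ℝ → ℝ} (hf : ContinuousOn f (Icc 0 1)) (h : ip f f = 0) :
    EqOn f 0 (Icc 0 1) := by
  by_contra hne
  simp only [EqOn, not_forall] at hne
  obtain ⟨x, hx, hfx⟩ := hne
  have : 0 < ∫ y in (0 : ℝ)..1, f y * f y :=
    intervalIntegral.integral_pos zero_lt_one (hf.mul hf) (fun _ _ => mul_self_nonneg _)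
      ⟨x, hx, mul_self_pos.2 hfx⟩
  exact this.ne' h

/-- Integration by parts on `[0,1]`. -/
theorem ip_dx_left {f g : ℝ → ℝ} (hf : C1 f) (hg : C1 g) :
    ip (dx f) g = f 1 * g 1 - f 0 * g 0 - ip f (dx g) := by
  have h1 := (hf.mul hg).integral_dx zero_mem01 one_mem01
  have h2 : ∫ x in (0 : ℝ)..1, dx (fun x => f x * g x) x =
      ∫ x in (0 : ℝ)..1, (dx f x * g x + f x * dx g x) := by
    refine intervalIntegral.integral_congr fun x hx => ?_
    rw [uIcc_of_le zero_le_one] at hx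
    exact hf.dx_mul hg hx
  rw [h2, intervalIntegral.integral_add (intervalIntegrable_mul hf.continuousOn_dx hg.continuousOn)
    (intervalIntegrable_mul hf.continuousOn hg.continuousOn_dx)] at h1
  simp only [ip]
  linarith

/-- The full `H¹` norm `‖v‖ + ‖v'‖` of a `C¹` function, an algebra norm up to a factor `2`. -/
noncomputable def n1 (v : ℝ → ℝ) : ℝ := normL2 v + normL2 (dx v)

theorem n1_nonneg (v : ℝ → ℝ) : 0 ≤ n1 v := add_nonneg (normL2_nonneg _) (normL2_nonneg _)

theorem normL2_le_n1 (v : ℝ → ℝ) : normL2 v ≤ n1 v := le_add_of_nonneg_right (normL2_nonneg _)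

theorem normL2_dx_le_n1 (v : ℝ → ℝ) : normL2 (dx v) ≤ n1 v :=
  le_add_of_nonneg_left (normL2_nonneg _)

/-- The one-dimensional Sobolev inequality. -/
theorem abs_le_n1 {v : ℝ → ℝ} (hv : C1 v) {x : ℝ} (hx : x ∈ Icc (0 : ℝ) 1) : |v x| ≤ n1 v := by
  obtain ⟨y, hy, hvy⟩ : ∃ y ∈ Icc (0 : ℝ) 1, |v y| ≤ normL2 v := by
    by_contra! hcon
    have : ∫ _ in (0 : ℝ)..1, normL2 v ^ 2 < ∫ y in (0 : ℝ)..1, v y * v y := by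
      refine intervalIntegral.integral_lt_integral_of_continuousOn_of_le_of_exists_lt zero_lt_one
        continuousOn_const (hv.continuousOn.mul hv.continuousOn) (fun y hy => ?_) ⟨0, zero_mem01, ?_⟩
      · rw [← abs_mul_abs_self, ← sq]
        exact pow_le_pow_left₀ (normL2_nonneg v) (hcon y (Ioc_subset_Icc_self hy)).le 2
      · rw [← abs_mul_abs_self, ← sq]
        exact pow_lt_pow_left₀ (hcon 0 zero_mem01) (normL2_nonneg v) two_ne_zero
    rw [normL2_sq] at this
    simp [ip] at this
  have h1 : |v x - v y| ≤ normL2 (dx v) := by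
    refine abs_le_of_sq_le_sq ?_ (normL2_nonneg _)
    have h := sq_sub_le_of_hasDerivWithinAt hy hx (fun z hz => hv.hasDerivWithinAt hz)
      hv.continuousOn_dx
    rw [sub_zero, one_mul] at h
    rwa [normL2_sq]
  have h2 : |v x| ≤ |v y| + |v x - v y| := by
    have := abs_add_le (v y) (v x - v y)
    rwa [add_sub_cancel] at this
  rw [n1]
  linarith

/-! ### Regularity of functions in `W^4_∞` -/

/-- Smooth functions with compact support in `(0,1)`. -/
structure IsTest (φ : ℝ → ℝ) : Prop where
  contDiff : ContDiff ℝ (⊤ : ℕ∞) φ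
  hasCompactSupport : HasCompactSupport φ
  tsupport_subset : tsupport φ ⊆ Ioo (0 : ℝ) 1

theorem IsTest.exists_Icc {φ : ℝ → ℝ} (h : IsTest φ) :
    ∃ a b : ℝ, 0 < a ∧ a ≤ b ∧ b < 1 ∧ ∀ x ∉ Icc a b, φ x = 0 := by
  by_cases hne : (tsupport φ).Nonempty
  · obtain ⟨a, ha, ha'⟩ := IsCompact.exists_isLeast h.hasCompactSupport hne
    obtain ⟨b, hb, hb'⟩ := IsCompact.exists_isGreatest h.hasCompactSupport hne
    refine ⟨a, b, (h.tsupport_subset ha).1, ha' hb, (h.tsupport_subset hb).2, fun x hx => ?_⟩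
    by_contra hx0
    have hxs : x ∈ tsupport φ := subset_tsupport φ hx0
    exact hx ⟨ha' hxs, hb' hxs⟩
  · refine ⟨1 / 2, 1 / 2, by norm_num, le_rfl, by norm_num, fun x _ => ?_⟩
    by_contra hx0
    exact hne ⟨x, subset_tsupport φ hx0⟩

theorem isTest_of_Icc {φ : ℝ → ℝ} {a b : ℝ} (hφ : ContDiff ℝ (⊤ : ℕ∞) φ) (ha : 0 < a) (hb : b < 1)
    (h : ∀ x ∉ Icc a b, φ x = 0) : IsTest φ := by
  have hsub : tsupport φ ⊆ Icc a b :=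
    closure_minimal (fun x hx => by_contra fun hx' => hx (h x hx')) isClosed_Icc
  exact ⟨hφ, HasCompactSupport.intro isCompact_Icc h, hsub.trans (Icc_subset_Ioo ha hb)⟩

theorem IsTest.deriv {φ : ℝ → ℝ} (h : IsTest φ) : IsTest (deriv φ) :=
  ⟨(contDiff_infty_iff_deriv.1 h.contDiff).2, h.hasCompactSupport.deriv,
    (closure_minimal support_deriv_subset (isClosed_tsupport φ)).trans h.tsupport_subset⟩

theorem integral_μ01 (f : ℝ → ℝ) : ∫ x, f x ∂μ01 = ∫ x in (0 : ℝ)..1, f x := by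
  rw [intervalIntegral.integral_of_le zero_le_one, integral_Ioc_eq_integral_Ioo]

theorem exists_isTest_integral_eq_one : ∃ ρ, IsTest ρ ∧ ∫ x, ρ x = 1 := by
  let f : ContDiffBump (1 / 2 : ℝ) :=
    { rIn := 1 / 8, rOut := 1 / 4, rIn_pos := by norm_num, rIn_lt_rOut := by norm_num }
  refine ⟨f.normed volume, ⟨f.contDiff_normed, f.hasCompactSupport_normed, ?_⟩, f.integral_normed⟩
  rw [f.tsupport_normed_eq]
  intro x hx
  rw [Metric.mem_closedBall, Real.dist_eq, abs_le] at hx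
  have : f.rOut = 1 / 4 := rfl
  constructor <;> linarith [hx.1, hx.2]

/-- A test function of mean zero is the derivative of a test function. -/
theorem exists_isTest_deriv {ψ : ℝ → ℝ} (h : IsTest ψ) (h0 : ∫ x, ψ x = 0) :
    ∃ φ, IsTest φ ∧ deriv φ = ψ := by
  obtain ⟨a, b, ha, hab, hb, hψ⟩ := h.exists_Icc
  have hcont : Continuous ψ := h.contDiff.continuous
  have hint : ∀ c d, IntervalIntegrable ψ volume c d := fun c d => hcont.intervalIntegrable c d
  have hd : ∀ x, HasDerivAt (fun x => ∫ y in (0 : ℝ)..x, ψ y) (ψ x) x := fun x =>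
    intervalIntegral.integral_hasDerivAt_right (hint _ _) (hcont.stronglyMeasurableAtFilter _ _)
      hcont.continuousAt
  have hdiff : deriv (fun x => ∫ y in (0 : ℝ)..x, ψ y) = ψ := funext fun x => (hd x).deriv
  refine ⟨fun x => ∫ y in (0 : ℝ)..x, ψ y, isTest_of_Icc ?_ ha hb fun x hx => ?_, hdiff⟩
  · rw [contDiff_infty_iff_deriv, hdiff]
    exact ⟨fun x => (hd x).differentiableAt, h.contDiff⟩
  · have hzero : ∀ c d, (∀ y ∈ uIcc c d, y ∉ Icc a b) → ∫ y in c..d, ψ y = 0 := fun c d hcd => by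
      rw [intervalIntegral.integral_congr (g := fun _ => 0) fun y hy => hψ y (hcd y hy)]
      simp
    rw [mem_Icc, not_and_or, not_le, not_le] at hx
    rcases hx with hx | hx
    · refine hzero 0 x fun y hy hy' => ?_
      have := (mem_uIcc.1 hy)
      rcases this with h1 | h1 <;> linarith [h1.1, h1.2, hy'.1]
    · have h1 : ∫ y in (0 : ℝ)..(max x 1), ψ y = 0 := by
        rw [intervalIntegral.integral_of_le (by positivity)]
        refine Eq.trans ?_ h0
        refine setIntegral_eq_integral_of_forall_compl_eq_zero fun y hy => hψ y fun hy' => hy ?_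
        exact ⟨ha.trans_le hy'.1, hy'.2.trans (hb.le.trans (le_max_right _ _))⟩
      have h2 : ∫ y in x..(max x 1), ψ y = 0 := by
        refine hzero _ _ fun y hy hy' => ?_
        rw [uIcc_of_le (le_max_left _ _)] at hy
        linarith [hy.1, hy'.2]
      rw [← intervalIntegral.integral_add_adjacent_intervals (hint 0 x) (hint x _), h2] at h1
      linarith

/-- The lemma of du Bois-Reymond: if `g` is a weak derivative of `f`, then `f` is almost everywhere
an antiderivative of `g`. -/
theorem exists_ae_eq_integral {f g : ℝ → ℝ} (hf : Integrable f μ01)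
    (hg : IntervalIntegrable g volume 0 1)
    (h : ∀ φ, IsTest φ → ∫ x, f x * deriv φ x ∂μ01 = -∫ x, g x * φ x ∂μ01) :
    ∃ c, f =ᵐ[μ01] fun x => c + ∫ y in (0 : ℝ)..x, g y := by
  set G : ℝ → ℝ := fun x => ∫ y in (0 : ℝ)..x, g y with hG
  have hGac : AbsolutelyContinuousOnInterval G 0 1 :=
    hg.absolutelyContinuousOnInterval_intervalIntegral (by simp)
  have hGint : Integrable G μ01 := by
    have := hGac.continuousOn
    rw [uIcc_of_le zero_le_one] at this
    exact (this.integrableOn_compact isCompact_Icc).mono_set Ioo_subset_Icc_self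
  have hmul : ∀ {k φ : ℝ → ℝ}, Integrable k μ01 → IsTest φ →
      Integrable (fun x => k x * φ x) μ01 := by
    intro k φ hk hφ
    obtain ⟨C, hC⟩ := hφ.contDiff.continuous.bounded_above_of_compact_support hφ.hasCompactSupport
    exact hk.mul_bdd hφ.contDiff.continuous.aestronglyMeasurable
      (Filter.Eventually.of_forall hC)
  have hGparts : ∀ φ, IsTest φ → ∫ x, G x * deriv φ x ∂μ01 = -∫ x, g x * φ x ∂μ01 := by
    intro φ hφ
    obtain ⟨a, b, ha, -, hb, hz⟩ := hφ.exists_Icc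
    have hφac : AbsolutelyContinuousOnInterval φ 0 1 :=
      (hφ.contDiff.of_le (by norm_cast)).contDiffOn.absolutelyContinuousOnInterval
    have h0 : φ 0 = 0 := hz 0 fun h => by linarith [h.1]
    have h1 : φ 1 = 0 := hz 1 fun h => by linarith [h.2]
    rw [integral_μ01, integral_μ01, hGac.integral_mul_deriv_eq_deriv_mul hφac, h0, h1]
    simp only [mul_zero, sub_self, zero_sub, neg_inj]
    refine intervalIntegral.integral_congr_ae ?_
    filter_upwards [hg.ae_hasDerivAt_integral] with x hx hx'
    rw [(hx (uIoc_subset_uIcc hx') 0 (by simp)).deriv]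
  -- `f - G` has weak derivative zero, hence annihilates all test functions of mean zero, and equals
  -- its mean against a test function `ρ` of integral one
  set k : ℝ → ℝ := fun x => f x - G x with hk
  have hkint : Integrable k μ01 := hf.sub hGint
  have hk0 : ∀ φ, IsTest φ → ∫ x, k x * deriv φ x ∂μ01 = 0 := by
    intro φ hφ
    simp only [hk, sub_mul]
    rw [integral_sub (hmul hf hφ.deriv) (hmul hGint hφ.deriv), h φ hφ, hGparts φ hφ, sub_self]
  obtain ⟨ρ, hρ, hρ1⟩ := exists_isTest_integral_eq_one
  have hfull : ∀ ψ, IsTest ψ → ∫ x, ψ x ∂μ01 = ∫ x, ψ x := fun ψ hψ =>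
    setIntegral_eq_integral_of_forall_compl_eq_zero fun x hx => by
      by_contra hne
      exact hx (hψ.tsupport_subset (subset_tsupport ψ hne))
  have hintg : ∀ ψ, IsTest ψ → Integrable ψ := fun ψ hψ =>
    hψ.contDiff.continuous.integrable_of_hasCompactSupport hψ.hasCompactSupport
  set c := ∫ x, k x * ρ x ∂μ01 with hc
  have hkc : ∀ ψ, IsTest ψ → ∫ x, (k x - c) * ψ x ∂μ01 = 0 := by
    intro ψ hψ
    set I := ∫ x, ψ x with hI
    obtain ⟨a, b, ha, -, hb, hz⟩ := hψ.exists_Icc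
    obtain ⟨a', b', ha', -, hb', hz'⟩ := hρ.exists_Icc
    have htest : IsTest (fun x => ψ x - I * ρ x) := by
      refine isTest_of_Icc (a := min a a') (b := max b b') (hψ.contDiff.sub
        (contDiff_const.mul hρ.contDiff)) (lt_min ha ha') (max_lt hb hb') fun x hx => ?_
      rw [hz x fun h => hx ⟨(min_le_left _ _).trans h.1, h.2.trans (le_max_left _ _)⟩,
        hz' x fun h => hx ⟨(min_le_right _ _).trans h.1, h.2.trans (le_max_right _ _)⟩]
      simp
    obtain ⟨φ, hφ, hφ'⟩ := exists_isTest_deriv htest (by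
      rw [integral_sub (hintg ψ hψ) ((hintg ρ hρ).const_mul I), integral_const_mul, hρ1, ← hI]
      ring)
    have h1 := hk0 φ hφ
    rw [hφ'] at h1
    have h2 : ∀ x, k x * (ψ x - I * ρ x) = k x * ψ x - I * (k x * ρ x) := fun x => by ring
    simp only [h2] at h1
    rw [integral_sub (hmul hkint hψ) ((hmul hkint hρ).const_mul I), integral_const_mul,
      ← hc] at h1
    simp only [sub_mul]
    rw [integral_sub (hmul hkint hψ) ((hintg ψ hψ).restrict.const_mul c), integral_const_mul,
      hfull ψ hψ, ← hI]
    linarith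
  refine ⟨c, ?_⟩
  have := isOpen_Ioo.ae_eq_zero_of_integral_contDiff_smul_eq_zero (U := Ioo (0 : ℝ) 1)
    (f := fun x => k x - c) (μ := volume)
    (IntegrableOn.locallyIntegrableOn (hkint.sub (integrable_const c))) (by
      intro ψ h1 h2 h3
      have h4 := hkc ψ ⟨h1, h2, h3⟩
      rw [setIntegral_eq_integral_of_forall_compl_eq_zero] at h4
      · simpa only [smul_eq_mul, mul_comm] using h4
      · intro x hx
        have : ψ x = 0 := by
          by_contra hne
          exact hx (h3 (subset_tsupport ψ hne))
        rw [this, mul_zero])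
  rw [Filter.EventuallyEq, ae_restrict_iff' measurableSet_Ioo]
  filter_upwards [this] with x hx hx'
  have := hx hx'
  simp only [hk] at this
  linarith

theorem isWeakDeriv_weakDeriv {j : ℕ} {f : ℝ → ℝ} (h : ∃ g, IsWeakDeriv j f g) :
    IsWeakDeriv j f (weakDeriv j f) := by
  rw [weakDeriv, dif_pos h]
  exact h.choose_spec

theorem IsWeakDeriv.integral_deriv {j : ℕ} {f g g' : ℝ → ℝ} (h : IsWeakDeriv j f g)
    (h' : IsWeakDeriv (j + 1) f g') {φ : ℝ → ℝ} (hφ : IsTest φ) :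
    ∫ x, g x * deriv φ x ∂μ01 = -∫ x, g' x * φ x ∂μ01 := by
  have h1 := h.2.2 _ hφ.deriv.contDiff hφ.deriv.hasCompactSupport hφ.deriv.tsupport_subset
  have h2 := h'.2.2 _ hφ.contDiff hφ.hasCompactSupport hφ.tsupport_subset
  rw [iteratedDeriv_succ', h1, pow_succ, mul_assoc, neg_one_mul] at h2
  exact mul_left_cancel₀ (pow_ne_zero j (by norm_num)) h2

/-- Weak derivatives of a given order agree almost everywhere. -/
theorem IsWeakDeriv.ae_eq {j : ℕ} {f g g' : ℝ → ℝ} (h : IsWeakDeriv j f g)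
    (h' : IsWeakDeriv j f g') : g =ᵐ[μ01] g' := by
  have := isOpen_Ioo.ae_eq_zero_of_integral_contDiff_smul_eq_zero (U := Ioo (0 : ℝ) 1)
    (f := fun x => g x - g' x) (μ := volume) (h.2.1.sub h'.2.1) (by
      intro ψ h1 h2 h3
      have e := (h.2.2 ψ h1 h2 h3).symm.trans (h'.2.2 ψ h1 h2 h3)
      have e' := mul_left_cancel₀ (pow_ne_zero j (by norm_num)) e
      have hint : ∀ k : ℝ → ℝ, LocallyIntegrableOn k (Ioo 0 1) →
          Integrable (fun x => k x * ψ x) μ01 := by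
        intro k hk
        have h5 : IntegrableOn (fun x => k x * ψ x) (tsupport ψ) volume := by
          obtain ⟨C, hC⟩ := h1.continuous.bounded_above_of_compact_support h2
          exact (hk.integrableOn_compact_subset h3 h2).mul_bdd
            h1.continuous.aestronglyMeasurable (Filter.Eventually.of_forall hC)
        refine (h5.integrable_of_forall_notMem_eq_zero fun x hx => ?_).restrict
        rw [image_eq_zero_of_notMem_tsupport hx, mul_zero]
      have e2 : ∫ x, (g x - g' x) * ψ x ∂μ01 = 0 := by
        simp only [sub_mul]
        rw [integral_sub (hint g h.2.1) (hint g' h'.2.1), e', sub_self]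
      rw [setIntegral_eq_integral_of_forall_compl_eq_zero] at e2
      · simpa only [smul_eq_mul, mul_comm] using e2
      · intro x hx
        have : ψ x = 0 := by
          by_contra hne
          exact hx (h3 (subset_tsupport ψ hne))
        rw [this, mul_zero])
  rw [Filter.EventuallyEq, ae_restrict_iff' measurableSet_Ioo]
  filter_upwards [this] with x hx hx'
  linarith [hx hx']

theorem normWInfty_lt_top {k : ℕ} {f : ℝ → ℝ} (h : MemWInfty k f) : normWInfty k f < ⊤ := by
  rw [normWInfty, Finset.sup_lt_iff (by simp)]
  intro j hj
  obtain ⟨g, hg, hg'⟩ := h j (Nat.lt_succ_iff.1 (Finset.mem_range.1 hj))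
  rw [eLpNorm_congr_ae ((isWeakDeriv_weakDeriv ⟨g, hg⟩).ae_eq hg)]
  exact hg'.eLpNorm_lt_top

theorem abs_le_of_ae_abs_le {w g : ℝ → ℝ} {M : ℝ} (hw : ContinuousOn w (Icc 0 1))
    (hwg : g =ᵐ[μ01] w) (hg : ∀ᵐ x ∂μ01, |g x| ≤ M) : ∀ x ∈ Icc (0 : ℝ) 1, |w x| ≤ M := by
  have h : (fun x => max |w x| M) =ᵐ[volume.restrict (Icc 0 1)] fun _ => M := by
    rw [← restrict_Ioo_eq_restrict_Icc]
    filter_upwards [hwg, hg] with x h1 h2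
    rw [← h1]
    exact max_eq_right h2
  have := Measure.eqOn_Icc_of_ae_eq volume zero_ne_one h (hw.abs.sup continuousOn_const)
    continuousOn_const
  intro x hx
  exact max_eq_right_iff.1 (this hx)

/-- Smoothness of a continuous function in `W^4_∞` with norm at most `M`: on `[0,1]` it coincides
with a `C³` function `w` on the line whose third derivative is `M`-Lipschitz, and `w`, `w'` are
bounded by `M` on `[0,1]`. -/
structure IsRegular (M : ℝ) (w w₁ w₂ w₃ : ℝ → ℝ) : Prop where
  deriv0 : ∀ x, HasDerivAt w (w₁ x) x
  deriv1 : ∀ x, HasDerivAt w₁ (w₂ x) x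
  deriv2 : ∀ x, HasDerivAt w₂ (w₃ x) x
  lipschitz : LipschitzWith M.toNNReal w₃
  bound0 : ∀ x ∈ Icc (0 : ℝ) 1, |w x| ≤ M
  bound1 : ∀ x ∈ Icc (0 : ℝ) 1, |w₁ x| ≤ M

/-- Taking antiderivatives four times, from a bounded representative of the fourth weak derivative
down to the function itself, turns membership in `W^4_∞` into classical smoothness. -/
theorem exists_isRegular {f : ℝ → ℝ} {M : ℝ} (hM : 0 ≤ M) (hf : ContinuousOn f (Icc 0 1))
    (h : MemWInfty 4 f) (hfM : normWInfty 4 f ≤ ENNReal.ofReal M) :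
    ∃ w w₁ w₂ w₃, EqOn f w (Icc 0 1) ∧ IsRegular M w w₁ w₂ w₃ := by
  have hwd : ∀ j ≤ 4, IsWeakDeriv j f (weakDeriv j f) := fun j hj => by
    obtain ⟨g, hg, -⟩ := h j hj
    exact isWeakDeriv_weakDeriv ⟨g, hg⟩
  have hbd : ∀ j ≤ 4, ∀ᵐ x ∂μ01, |weakDeriv j f x| ≤ M := fun j hj => by
    have h1 : eLpNorm (weakDeriv j f) ⊤ μ01 ≤ ENNReal.ofReal M :=
      (Finset.le_sup (f := fun j => eLpNorm (weakDeriv j f) ⊤ μ01)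
        (Finset.mem_range.2 (Nat.lt_succ_of_le hj))).trans hfM
    rw [eLpNorm_exponent_top] at h1
    filter_upwards [ae_le_eLpNormEssSup (f := weakDeriv j f) (μ := μ01)] with x hx
    have h2 := hx.trans h1
    rwa [← ofReal_norm, ENNReal.ofReal_le_ofReal_iff hM] at h2
  have hint : ∀ j ≤ 4, Integrable (weakDeriv j f) μ01 := fun j hj =>
    ⟨(hwd j hj).2.1.aestronglyMeasurable, HasFiniteIntegral.of_bounded (hbd j hj)⟩
  have step : ∀ j ≤ 3, ∀ g : ℝ → ℝ, weakDeriv (j + 1) f =ᵐ[μ01] g →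
      IntervalIntegrable g volume 0 1 →
      ∃ c, weakDeriv j f =ᵐ[μ01] fun x => c + ∫ y in (0 : ℝ)..x, g y := by
    intro j hj g hg hgi
    refine exists_ae_eq_integral (hint j (by lia)) hgi fun φ hφ => ?_
    rw [(hwd j (by lia)).integral_deriv (hwd (j + 1) (by lia)) hφ]
    congr 1
    refine integral_congr_ae ?_
    filter_upwards [hg] with x hx
    rw [hx]
  -- a representative of the fourth derivative that is bounded by `M` everywhere
  set w₄ : ℝ → ℝ := fun x => max (-M) (min M ((hint 4 le_rfl).1.mk _ x)) with hw₄
  have hw₄M : ∀ x, |w₄ x| ≤ M := fun x =>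
    abs_le.2 ⟨le_max_left _ _, max_le (by linarith) (min_le_left _ _)⟩
  have hw₄m : Measurable w₄ :=
    measurable_const.max (measurable_const.min (hint 4 le_rfl).1.stronglyMeasurable_mk.measurable)
  have hw₄i : ∀ a b, IntervalIntegrable w₄ volume a b := fun a b =>
    intervalIntegrable_const (c := M) |>.mono_fun hw₄m.aestronglyMeasurable
      (Filter.Eventually.of_forall fun x => by
        simpa [abs_of_nonneg hM] using hw₄M x)
  have hw₄e : weakDeriv 4 f =ᵐ[μ01] w₄ := by
    filter_upwards [(hint 4 le_rfl).1.ae_eq_mk, hbd 4 le_rfl] with x h1 h2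
    rw [abs_le] at h2
    rw [hw₄]
    simp only
    rw [← h1, min_eq_right h2.2, max_eq_right h2.1]
  have hD : ∀ (c : ℝ) (g : ℝ → ℝ), Continuous g → ∀ x,
      HasDerivAt (fun x => c + ∫ y in (0 : ℝ)..x, g y) (g x) x := fun c g hg x =>
    (intervalIntegral.integral_hasDerivAt_right (hg.intervalIntegrable _ _)
      (hg.stronglyMeasurableAtFilter _ _) hg.continuousAt).const_add c
  have hC : ∀ {g g' : ℝ → ℝ}, (∀ x, HasDerivAt g (g' x) x) → Continuous g := fun hg =>
    continuous_iff_continuousAt.2 fun x => (hg x).continuousAt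
  obtain ⟨c₃, h₃⟩ := step 3 le_rfl w₄ hw₄e (hw₄i 0 1)
  set w₃ : ℝ → ℝ := fun x => c₃ + ∫ y in (0 : ℝ)..x, w₄ y with hw₃
  have hlip : LipschitzWith M.toNNReal w₃ := by
    refine LipschitzWith.of_dist_le_mul fun x y => ?_
    rw [Real.coe_toNNReal _ hM, hw₃, dist_add_left, Real.dist_eq,
      intervalIntegral.integral_interval_sub_left (hw₄i _ _) (hw₄i _ _), Real.dist_eq]
    exact intervalIntegral.norm_integral_le_of_norm_le_const (f := w₄) fun x _ => hw₄M x
  obtain ⟨c₂, h₂⟩ := step 2 (by norm_num) w₃ h₃ (hlip.continuous.intervalIntegrable _ _)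
  have hd₂ := hD c₂ w₃ hlip.continuous
  obtain ⟨c₁, h₁⟩ := step 1 (by norm_num) _ h₂ ((hC hd₂).intervalIntegrable _ _)
  have hd₁ := hD c₁ _ (hC hd₂)
  obtain ⟨c₀, h₀⟩ := step 0 (by norm_num) _ h₁ ((hC hd₁).intervalIntegrable _ _)
  have hd₀ := hD c₀ _ (hC hd₁)
  have hf0 : weakDeriv 0 f =ᵐ[μ01] f := by
    refine (hwd 0 (by norm_num)).ae_eq ⟨(hwd 0 (by norm_num)).1, (hwd 0 (by norm_num)).1, ?_⟩
    intro φ _ _ _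
    simp
  refine ⟨_, _, _, w₃, ?_, hd₀, hd₁, hd₂, hlip, ?_, ?_⟩
  · have := hf0.symm.trans h₀
    rw [μ01, restrict_Ioo_eq_restrict_Icc] at this
    exact Measure.eqOn_Icc_of_ae_eq volume zero_ne_one this hf (hC hd₀).continuousOn
  · exact abs_le_of_ae_abs_le (hC hd₀).continuousOn h₀ (hbd 0 (by norm_num))
  · exact abs_le_of_ae_abs_le (hC hd₁).continuousOn h₁ (hbd 1 (by norm_num))

/-! ### Meshes and spline spaces -/

namespace Mesh

variable {N : ℕ} (m : Mesh N)

theorem ne_zero (m : Mesh N) : N ≠ 0 := by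
  rintro rfl
  have h1 := m.first
  have h2 := m.last
  have : Fin.last 0 = 0 := rfl
  rw [this, h1] at h2
  exact zero_ne_one h2

theorem node_mem (i : Fin (N + 1)) : m.node i ∈ Icc (0 : ℝ) 1 := by
  rw [← m.first, ← m.last]
  exact ⟨m.strictMono.monotone (Fin.zero_le i), m.strictMono.monotone (Fin.le_last i)⟩

theorem node_lt (i : Fin N) : m.node i.castSucc < m.node i.succ :=
  m.strictMono Fin.castSucc_lt_succ

theorem cell_subset (i : Fin N) : Icc (m.node i.castSucc) (m.node i.succ) ⊆ Icc (0 : ℝ) 1 :=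
  Icc_subset_Icc (m.node_mem _).1 (m.node_mem _).2

theorem width_pos (i : Fin N) : 0 < m.width i := sub_pos.2 (m.node_lt i)

theorem width_le_h (i : Fin N) : m.width i ≤ m.h :=
  le_ciSup (f := m.width) (finite_range _).bddAbove i

theorem h_pos : 0 < m.h :=
  (m.width_pos ⟨0, Nat.pos_of_ne_zero m.ne_zero⟩).trans_le (m.width_le_h _)

theorem h_le_mul_width {κ : ℝ} (hκ : m.Quasiuniform κ) (i : Fin N) : m.h ≤ κ * m.width i := by
  have : Nonempty (Fin N) := ⟨i⟩
  exact ciSup_le fun j => hκ j i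

theorem exists_cell {x : ℝ} (hx : x ∈ Icc (0 : ℝ) 1) :
    ∃ i : Fin N, x ∈ Icc (m.node i.castSucc) (m.node i.succ) := by
  have key : ∀ k : Fin (N + 1), x ≤ m.node k →
      ∃ i : Fin N, x ∈ Icc (m.node i.castSucc) (m.node i.succ) := by
    intro k
    induction k using Fin.induction with
    | zero =>
      intro h
      refine ⟨⟨0, Nat.pos_of_ne_zero m.ne_zero⟩, ?_, h.trans (m.strictMono.monotone (Fin.zero_le _))⟩
      have : m.node (Fin.castSucc ⟨0, Nat.pos_of_ne_zero m.ne_zero⟩) = 0 := m.first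
      rw [this]
      exact hx.1
    | succ i ih =>
      intro h
      rcases le_total x (m.node i.castSucc) with h' | h'
      · exact ih h'
      · exact ⟨i, h', h⟩
  exact key (Fin.last N) (by rw [m.last]; exact hx.2)

/-- An inequality between integrals may be checked cell by cell. -/
theorem integral_le_of_cells {f g : ℝ → ℝ} {K : ℝ} (hf : ContinuousOn f (Icc 0 1))
    (hg : ContinuousOn g (Icc 0 1))
    (h : ∀ i : Fin N, ∫ x in (m.node i.castSucc)..(m.node i.succ), f x ≤
      K * ∫ x in (m.node i.castSucc)..(m.node i.succ), g x) :
    ∫ x in (0 : ℝ)..1, f x ≤ K * ∫ x in (0 : ℝ)..1, g x := by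
  have key : ∀ k : Fin (N + 1), ∫ x in (0 : ℝ)..(m.node k), f x ≤
      K * ∫ x in (0 : ℝ)..(m.node k), g x := by
    intro k
    induction k using Fin.induction with
    | zero => simp [m.first]
    | succ i ih =>
      rw [← intervalIntegral.integral_add_adjacent_intervals
          (hf.intervalIntegrable_of_mem zero_mem01 (m.node_mem i.castSucc))
          (hf.intervalIntegrable_of_mem (m.node_mem _) (m.node_mem _)),
        ← intervalIntegral.integral_add_adjacent_intervals
          (hg.intervalIntegrable_of_mem zero_mem01 (m.node_mem i.castSucc))
          (hg.intervalIntegrable_of_mem (m.node_mem _) (m.node_mem _)), mul_add]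
      exact add_le_add ih (h i)
  simpa [m.last] using key (Fin.last N)

variable {m}

theorem c1_of_mem {φ : ℝ → ℝ} (h : φ ∈ m.S) : C1 φ := c1_of_contDiffOn_two h.1

theorem c1_dx_of_mem {φ : ℝ → ℝ} (h : φ ∈ m.S) : C1 (dx φ) := c1_dx_of_contDiffOn_two h.1

theorem mem_S_congr {φ ψ : ℝ → ℝ} (h : φ ∈ m.S) (he : EqOn ψ φ (Icc 0 1)) : ψ ∈ m.S := by
  refine ⟨h.1.congr he, fun i => ?_⟩
  obtain ⟨p, hp, hpe⟩ := h.2 i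
  exact ⟨p, hp, fun x hx => (he (m.cell_subset i hx)).trans (hpe x hx)⟩

theorem add_mem_S {φ ψ : ℝ → ℝ} (h : φ ∈ m.S) (h' : ψ ∈ m.S) : φ + ψ ∈ m.S := by
  refine ⟨h.1.add h'.1, fun i => ?_⟩
  obtain ⟨p, hp, hpe⟩ := h.2 i
  obtain ⟨q, hq, hqe⟩ := h'.2 i
  refine ⟨p + q, (Polynomial.natDegree_add_le _ _).trans (max_le hp hq), fun x hx => ?_⟩
  rw [Pi.add_apply, hpe x hx, hqe x hx, Polynomial.eval_add]

theorem smul_mem_S {φ : ℝ → ℝ} (c : ℝ) (h : φ ∈ m.S) : c • φ ∈ m.S := by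
  refine ⟨contDiffOn_const.smul h.1, fun i => ?_⟩
  obtain ⟨p, hp, hpe⟩ := h.2 i
  refine ⟨Polynomial.C c * p, (Polynomial.natDegree_C_mul_le _ _).trans hp, fun x hx => ?_⟩
  rw [Pi.smul_apply, hpe x hx, Polynomial.eval_mul, Polynomial.eval_C, smul_eq_mul]

theorem polynomial_mem_S (p : Polynomial ℝ) (hp : p.natDegree ≤ 3) :
    (fun x => p.eval x) ∈ m.S :=
  ⟨p.contDiff_aeval (𝕜 := ℝ) 2 |>.contDiffOn, fun _ => ⟨p, hp, fun _ _ => rfl⟩⟩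

variable (m)

/-- The spline space `S_h` as a vector space. Its elements are made unique by letting them vanish
off `[0,1]`. -/
def splines : Submodule ℝ (ℝ → ℝ) where
  carrier := {φ | φ ∈ m.S ∧ ∀ x ∉ Icc (0 : ℝ) 1, φ x = 0}
  add_mem' h h' := ⟨add_mem_S h.1 h'.1, fun x hx => by
    rw [Pi.add_apply, h.2 x hx, h'.2 x hx, add_zero]⟩
  zero_mem' := ⟨mem_S_congr (polynomial_mem_S 0 (by simp)) fun x _ => by simp, fun _ _ => rfl⟩
  smul_mem' c _ h := ⟨smul_mem_S c h.1, fun x hx => by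
    rw [Pi.smul_apply, h.2 x hx, smul_zero]⟩

/-- The spline space `S_{h,0}` as a vector space. -/
def splines0 : Submodule ℝ (ℝ → ℝ) where
  carrier := {φ | φ ∈ m.splines ∧ φ 0 = 0 ∧ φ 1 = 0}
  add_mem' h h' := ⟨add_mem h.1 h'.1, by simp [h.2.1, h'.2.1], by simp [h.2.2, h'.2.2]⟩
  zero_mem' := ⟨zero_mem _, rfl, rfl⟩
  smul_mem' c _ h := ⟨Submodule.smul_mem _ c h.1, by simp [h.2.1], by simp [h.2.2]⟩

variable {m}

theorem indicator_eqOn (φ : ℝ → ℝ) : EqOn ((Icc (0 : ℝ) 1).indicator φ) φ (Icc 0 1) :=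
  fun _ hx => indicator_of_mem hx φ

theorem indicator_mem_splines {φ : ℝ → ℝ} (h : φ ∈ m.S) :
    (Icc (0 : ℝ) 1).indicator φ ∈ m.splines :=
  ⟨mem_S_congr h (indicator_eqOn φ), fun _ hx => indicator_of_notMem hx φ⟩

theorem indicator_mem_splines0 {φ : ℝ → ℝ} (h : φ ∈ m.S0) :
    (Icc (0 : ℝ) 1).indicator φ ∈ m.splines0 :=
  ⟨indicator_mem_splines h.1, (indicator_eqOn φ zero_mem01).trans h.2.1,
    (indicator_eqOn φ one_mem01).trans h.2.2⟩

theorem mem_S0_of_splines0 (φ : m.splines0) : (φ : ℝ → ℝ) ∈ m.S0 := ⟨φ.2.1.1, φ.2.2⟩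

theorem splines_ext {φ ψ : m.splines} (h : EqOn (φ : ℝ → ℝ) ψ (Icc 0 1)) : φ = ψ := by
  ext x
  by_cases hx : x ∈ Icc (0 : ℝ) 1
  · exact h hx
  · rw [φ.2.2 x hx, ψ.2.2 x hx]

/-- Four points in each cell, as many as determine a cubic. -/
noncomputable def samplePoint (m : Mesh N) (q : Fin N × Fin 4) : ℝ :=
  m.node q.1.castSucc + (q.2 : ℕ) / 3 * m.width q.1

theorem samplePoint_mem_cell (q : Fin N × Fin 4) :
    m.samplePoint q ∈ Icc (m.node q.1.castSucc) (m.node q.1.succ) := by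
  have hw := m.width_pos q.1
  have h1 : ((q.2 : ℕ) : ℝ) ≤ 3 := by
    have := q.2.2
    exact_mod_cast Nat.lt_succ_iff.1 this
  have h2 : (0 : ℝ) ≤ ((q.2 : ℕ) : ℝ) := Nat.cast_nonneg _
  have h3 : m.node q.1.succ = m.node q.1.castSucc + m.width q.1 := by rw [width]; ring
  rw [samplePoint, h3]
  constructor
  · have : 0 ≤ ((q.2 : ℕ) : ℝ) / 3 * m.width q.1 := by positivity
    linarith
  · have : ((q.2 : ℕ) : ℝ) / 3 * m.width q.1 ≤ 1 * m.width q.1 :=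
      mul_le_mul_of_nonneg_right (by linarith) hw.le
    linarith

theorem samplePoint_mem (q : Fin N × Fin 4) : m.samplePoint q ∈ Icc (0 : ℝ) 1 :=
  m.cell_subset _ (samplePoint_mem_cell q)

variable (m) in
/-- Evaluation at the sample points, which determines a spline. -/
noncomputable def sample : m.splines →ₗ[ℝ] (Fin N × Fin 4 → ℝ) where
  toFun φ q := (φ : ℝ → ℝ) (m.samplePoint q)
  map_add' _ _ := rfl
  map_smul' _ _ := rfl

theorem sample_injective : Function.Injective m.sample := by
  rw [injective_iff_map_eq_zero]
  intro φ hφ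
  refine splines_ext fun x hx => ?_
  obtain ⟨i, hi⟩ := m.exists_cell hx
  obtain ⟨p, hp, hpe⟩ := φ.2.1.2 i
  have hp0 : p = 0 := by
    refine Polynomial.eq_zero_of_natDegree_lt_card_of_eval_eq_zero p
      (f := fun j : Fin 4 => m.samplePoint (i, j)) ?_ (fun j => ?_) ?_
    · intro j k hjk
      simp only [samplePoint, add_right_inj] at hjk
      have h1 := mul_right_cancel₀ (m.width_pos i).ne' hjk
      have h2 : ((j : ℕ) : ℝ) = (k : ℕ) := by linarith
      exact Fin.ext (by exact_mod_cast h2)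
    · rw [← hpe _ (samplePoint_mem_cell (i, j))]
      exact congrFun hφ (i, j)
    · simpa using Nat.lt_succ_of_le hp
  rw [hpe x hi, hp0]
  simp

instance : FiniteDimensional ℝ m.splines :=
  Module.Finite.of_injective m.sample sample_injective

theorem splines0_le : m.splines0 ≤ m.splines := fun _ h => h.1

instance : FiniteDimensional ℝ m.splines0 :=
  Module.Finite.of_injective (Submodule.inclusion splines0_le) (Submodule.inclusion_injective _)

end Mesh

/-- The Riesz representation with respect to a definite form on a finite-dimensional space. -/
theorem exists_riesz {V : Type*} [AddCommGroup V] [Module ℝ V] [FiniteDimensional ℝ V]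
    (B : V →ₗ[ℝ] V →ₗ[ℝ] ℝ) (hB : ∀ v, B v v = 0 → v = 0) (l : V →ₗ[ℝ] ℝ) :
    ∃ v, ∀ w, B v w = l w := by
  have hinj : Function.Injective B := by
    rw [injective_iff_map_eq_zero]
    intro v hv
    exact hB v (by rw [hv]; rfl)
  have hsurj := (LinearMap.injective_iff_surjective_of_finrank_eq_finrank
    (f := B) (Subspace.dual_finrank_eq (K := ℝ) (V := V)).symm).1 hinj
  obtain ⟨v, hv⟩ := hsurj l
  exact ⟨v, fun w => by rw [hv]⟩

/-! ### The complete cubic spline interpolant -/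

theorem dx_of_hasDerivAt {f f' : ℝ → ℝ} (h : ∀ x, HasDerivAt f (f' x) x) :
    EqOn (dx f) f' (Icc 0 1) := fun x hx => dx_eq hx (h x).hasDerivWithinAt

theorem hasDerivAt_max_pow (n : ℕ) (y : ℝ) :
    HasDerivAt (fun y : ℝ => max y 0 ^ (n + 2)) ((n + 2) * max y 0 ^ (n + 1)) y := by
  have hp : ∀ y : ℝ, HasDerivAt (fun y : ℝ => y ^ (n + 2)) ((n + 2) * y ^ (n + 1)) y := fun y => by
    have := hasDerivAt_pow (n + 2) y
    simpa using this
  rcases lt_trichotomy y 0 with hy | rfl | hy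
  · rw [max_eq_right hy.le, zero_pow (by simp), mul_zero]
    refine (hasDerivAt_const y (0 : ℝ)).congr_of_eventuallyEq ?_
    filter_upwards [Iio_mem_nhds hy] with z hz
    rw [max_eq_right (le_of_lt hz), zero_pow (by simp)]
  · have h1 : HasDerivWithinAt (fun y : ℝ => max y 0 ^ (n + 2)) ((n + 2) * max 0 0 ^ (n + 1))
        (Iic 0) 0 := by
      rw [max_self, zero_pow (by simp), mul_zero]
      refine (hasDerivWithinAt_const (0 : ℝ) (Iic 0) (0 : ℝ)).congr (fun z hz => ?_) ?_
      · rw [max_eq_right hz, zero_pow (by simp)]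
      · simp
    have h2 : HasDerivWithinAt (fun y : ℝ => max y 0 ^ (n + 2)) ((n + 2) * max 0 0 ^ (n + 1))
        (Ici 0) 0 := by
      rw [max_self]
      refine (hp 0).hasDerivWithinAt.congr (fun z hz => ?_) ?_
      · rw [max_eq_left hz]
      · simp
    have := h1.union h2
    rwa [Iic_union_Ici, hasDerivWithinAt_univ] at this
  · rw [max_eq_left hy.le]
    refine (hp y).congr_of_eventuallyEq ?_
    filter_upwards [Ioi_mem_nhds hy] with z hz
    rw [max_eq_left (le_of_lt hz)]

theorem hasDerivAt_truncatedPower (c : ℝ) (n : ℕ) (x : ℝ) :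
    HasDerivAt (fun x : ℝ => max (c - x) 0 ^ (n + 2)) (-(n + 2) * max (c - x) 0 ^ (n + 1)) x := by
  have h := (hasDerivAt_max_pow n (c - x)).comp x ((hasDerivAt_id x).const_sub c)
  refine h.congr_deriv ?_
  ring

theorem hasDerivAt_truncatedCube (c x : ℝ) :
    HasDerivAt (fun x : ℝ => max (c - x) 0 ^ 3) (-3 * max (c - x) 0 ^ 2) x := by
  refine (hasDerivAt_truncatedPower c 1 x).congr_deriv ?_
  norm_num

theorem hasDerivAt_truncatedSquare (c x : ℝ) :
    HasDerivAt (fun x : ℝ => -3 * max (c - x) 0 ^ 2) (6 * max (c - x) 0) x := by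
  refine ((hasDerivAt_truncatedPower c 0 x).const_mul (-3)).congr_deriv ?_
  norm_num
  ring

theorem contDiffOn_two_of_hasDerivAt {f f' f'' : ℝ → ℝ} (h : ∀ x, HasDerivAt f (f' x) x)
    (h' : ∀ x, HasDerivAt f' (f'' x) x) (hc : Continuous f'') : ContDiffOn ℝ 2 f (Icc 0 1) := by
  have h1 : C1 f' := c1_of_hasDerivWithinAt (fun x _ => (h' x).hasDerivWithinAt) hc.continuousOn
  exact contDiffOn_two_of_c1_dx
    (c1_of_hasDerivWithinAt (fun x _ => (h x).hasDerivWithinAt) h1.continuousOn)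
    (h1.congr (dx_of_hasDerivAt h))

theorem dx_dx_of_hasDerivAt {f f' f'' : ℝ → ℝ} (h : ∀ x, HasDerivAt f (f' x) x)
    (h' : ∀ x, HasDerivAt f' (f'' x) x) : EqOn (dx (dx f)) f'' (Icc 0 1) :=
  (dx_congr (dx_of_hasDerivAt h)).trans (dx_of_hasDerivAt h')

theorem Mesh.truncatedCube_mem_S {N : ℕ} (m : Mesh N) (k : Fin (N + 1)) :
    (fun x => max (m.node k - x) 0 ^ 3) ∈ m.S := by
  refine ⟨contDiffOn_two_of_hasDerivAt (hasDerivAt_truncatedCube _) (hasDerivAt_truncatedSquare _)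
    (by fun_prop), fun i => ?_⟩
  rcases le_or_gt k i.castSucc with h | h
  · refine ⟨0, by simp, fun x hx => ?_⟩
    have : m.node k ≤ x := (m.strictMono.monotone h).trans hx.1
    simp only
    rw [max_eq_right (by linarith)]
    simp
  · refine ⟨(Polynomial.C (m.node k) - Polynomial.X) ^ 3, ?_, fun x hx => ?_⟩
    · refine Polynomial.natDegree_pow_le_of_le 3 (m := 1) ?_
      exact (Polynomial.natDegree_sub_le _ _).trans (by simp)
    · have : x ≤ m.node k := hx.2.trans (m.strictMono.monotone (Fin.castSucc_lt_iff_succ_le.1 h))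
      simp only
      rw [max_eq_left (by linarith)]
      simp

/-- The form whose Riesz representatives are complete cubic spline interpolants: orthogonality with
respect to it makes the second derivative of the error orthogonal to all second derivatives of
splines, and fixes value and slope at `0`. -/
noncomputable def bendingForm {N : ℕ} (m : Mesh N) : m.splines →ₗ[ℝ] m.splines →ₗ[ℝ] ℝ := by
  have hadd : ∀ φ ψ : m.splines, EqOn (dx (φ + ψ : m.splines)) (fun x => dx φ x + dx ψ x)
      (Icc 0 1) := fun φ ψ => (Mesh.c1_of_mem φ.2.1).dx_add (Mesh.c1_of_mem ψ.2.1)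
  have hsmul : ∀ (c : ℝ) (φ : m.splines), EqOn (dx (c • φ : m.splines)) (fun x => c * dx φ x)
      (Icc 0 1) := fun c φ => (Mesh.c1_of_mem φ.2.1).dx_const_mul c
  have hadd2 : ∀ φ ψ : m.splines, EqOn (dx (dx (φ + ψ : m.splines)))
      (fun x => dx (dx φ) x + dx (dx ψ) x) (Icc 0 1) := fun φ ψ =>
    (dx_congr (hadd φ ψ)).trans ((Mesh.c1_dx_of_mem φ.2.1).dx_add (Mesh.c1_dx_of_mem ψ.2.1))
  have hsmul2 : ∀ (c : ℝ) (φ : m.splines), EqOn (dx (dx (c • φ : m.splines)))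
      (fun x => c * dx (dx φ) x) (Icc 0 1) := fun c φ =>
    (dx_congr (hsmul c φ)).trans ((Mesh.c1_dx_of_mem φ.2.1).dx_const_mul c)
  have hc : ∀ φ : m.splines, ContinuousOn (dx (dx φ)) (Icc 0 1) := fun φ =>
    (Mesh.c1_dx_of_mem φ.2.1).continuousOn_dx
  refine LinearMap.mk₂ ℝ (fun φ ψ => ip (dx (dx φ)) (dx (dx ψ)) + (φ : ℝ → ℝ) 0 * (ψ : ℝ → ℝ) 0
    + dx φ 0 * dx ψ 0) ?_ ?_ ?_ ?_
  · intro φ φ' ψ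
    rw [ip_congr (hadd2 φ φ') (fun _ _ => rfl), ip_add_left (hc _) (hc _) (hc _),
      hadd φ φ' zero_mem01, Submodule.coe_add, Pi.add_apply]
    ring
  · intro c φ ψ
    rw [ip_congr (hsmul2 c φ) (fun _ _ => rfl), ip_const_mul_left, hsmul c φ zero_mem01,
      Submodule.coe_smul, Pi.smul_apply, smul_eq_mul, smul_eq_mul]
    ring
  · intro φ ψ ψ'
    rw [ip_congr (fun _ _ => rfl) (hadd2 ψ ψ'), ip_add_right (hc _) (hc _) (hc _),
      hadd ψ ψ' zero_mem01, Submodule.coe_add, Pi.add_apply]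
    ring
  · intro c φ ψ
    rw [ip_congr (fun _ _ => rfl) (hsmul2 c ψ), ip_const_mul_right, hsmul c ψ zero_mem01,
      Submodule.coe_smul, Pi.smul_apply, smul_eq_mul, smul_eq_mul]
    ring

theorem bendingForm_apply {N : ℕ} (m : Mesh N) (φ ψ : m.splines) :
    bendingForm m φ ψ = ip (dx (dx φ)) (dx (dx ψ)) + (φ : ℝ → ℝ) 0 * (ψ : ℝ → ℝ) 0
      + dx φ 0 * dx ψ 0 := rfl

theorem bendingForm_definite {N : ℕ} (m : Mesh N) (φ : m.splines) (h : bendingForm m φ φ = 0) :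
    φ = 0 := by
  rw [bendingForm_apply] at h
  have h1 := ip_self_nonneg (dx (dx φ))
  have h2 := mul_self_nonneg ((φ : ℝ → ℝ) 0)
  have h3 := mul_self_nonneg (dx φ 0)
  have e1 : ip (dx (dx φ)) (dx (dx φ)) = 0 := by linarith
  have e2 : (φ : ℝ → ℝ) 0 = 0 := mul_self_eq_zero.1 (by linarith)
  have e3 : dx φ 0 = 0 := mul_self_eq_zero.1 (by linarith)
  have hC := Mesh.c1_of_mem φ.2.1
  have hC' := Mesh.c1_dx_of_mem φ.2.1
  have hz : ∀ {f : ℝ → ℝ}, C1 f → f 0 = 0 → EqOn (dx f) 0 (Icc 0 1) → EqOn f 0 (Icc 0 1) := by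
    intro f hf hf0 hfd x hx
    have := hf.integral_dx zero_mem01 hx
    rw [intervalIntegral.integral_congr (g := fun _ => 0)
      fun y hy => hfd (uIcc_subset_Icc zero_mem01 hx hy), hf0] at this
    simpa using this.symm
  exact Mesh.splines_ext
    (hz hC e2 (hz hC' e3 (eqOn_zero_of_ip_self hC'.continuousOn_dx e1)))

/-- Integration by parts against a Lipschitz function. -/
theorem abs_ip_dx_le_of_lipschitz {e w : ℝ → ℝ} {M : ℝ} (hM : 0 ≤ M) (he : C1 e) (h0 : e 0 = 0)
    (h1 : e 1 = 0) (hw : LipschitzWith M.toNNReal w) : |ip (dx e) w| ≤ M * normL2 e := by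
  have heac : AbsolutelyContinuousOnInterval e 0 1 := by
    have he' : ContDiffOn ℝ 1 e (uIcc 0 1) := by rwa [uIcc_of_le zero_le_one]
    exact ContDiffOn.absolutelyContinuousOnInterval he'
  have hwac : AbsolutelyContinuousOnInterval w 0 1 :=
    hw.lipschitzOnWith.absolutelyContinuousOnInterval
  have hparts := heac.integral_mul_deriv_eq_deriv_mul hwac
  rw [h0, h1, zero_mul, zero_mul, sub_zero, zero_sub] at hparts
  have e1 : ip (dx e) w = ∫ x in (0 : ℝ)..1, deriv e x * w x := by
    rw [ip, intervalIntegral.integral_of_le zero_le_one, intervalIntegral.integral_of_le zero_le_one,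
      integral_Ioc_eq_integral_Ioo, integral_Ioc_eq_integral_Ioo]
    refine setIntegral_congr_fun measurableSet_Ioo fun x hx => ?_
    simp only [dx, derivWithin_of_mem_nhds (Icc_mem_nhds hx.1 hx.2)]
  have e2 : ip (dx e) w = - ∫ x in (0 : ℝ)..1, e x * deriv w x := by rw [e1, hparts, neg_neg]
  rw [e2, abs_neg]
  have e3 : |∫ x in (0 : ℝ)..1, e x * deriv w x| ≤ ∫ x in (0 : ℝ)..1, M * |e x| := by
    rw [← Real.norm_eq_abs]
    refine intervalIntegral.norm_integral_le_of_norm_le zero_le_one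
      (Filter.Eventually.of_forall fun x _ => ?_)
      ((he.continuousOn.abs.intervalIntegrable_of_mem zero_mem01 one_mem01).const_mul M)
    rw [Real.norm_eq_abs, abs_mul, mul_comm]
    have := norm_deriv_le_of_lipschitz hw (x₀ := x)
    rw [Real.norm_eq_abs, Real.coe_toNNReal _ hM] at this
    gcongr
  refine e3.trans ?_
  rw [intervalIntegral.integral_const_mul]
  have h4 := (le_abs_self _).trans
    (abs_ip_le (f := fun x => |e x|) (g := fun _ => 1) he.continuousOn.abs continuousOn_const)
  have h5 : normL2 (fun x => |e x|) = normL2 e := by simp [normL2, ip, abs_mul_abs_self]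
  rw [h5] at h4
  have h6 : normL2 (fun _ => 1) = 1 := by simp [normL2, ip]
  rw [h6, mul_one] at h4
  simp only [ip, mul_one] at h4
  gcongr

/-- Approximation by the complete cubic spline interpolant `s` of `w`: it agrees with `w` at the end
points, and the error is of order four in `L²` and of order three in `H¹`. The error `e` vanishes at
the nodes, because `e''` is orthogonal to the functions `(xᵢ - x)₊`, and
`‖e''‖² = (e'', w'') = -(e', w''')`. -/
theorem exists_spline_approx {N : ℕ} (m : Mesh N) {M : ℝ} (hM : 0 ≤ M) {w w₁ w₂ w₃ : ℝ → ℝ}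
    (hw : IsRegular M w w₁ w₂ w₃) :
    ∃ s ∈ m.S, s 0 = w 0 ∧ s 1 = w 1 ∧ normL2 (fun x => w x - s x) ≤ M * m.h ^ 4 ∧
      normL2 (dx fun x => w x - s x) ≤ M * m.h ^ 3 := by
  have hw₂c : Continuous w₂ := continuous_iff_continuousAt.2 fun x => (hw.deriv2 x).continuousAt
  have hwC : ContDiffOn ℝ 2 w (Icc 0 1) := contDiffOn_two_of_hasDerivAt hw.deriv0 hw.deriv1 hw₂c
  have hdw := dx_of_hasDerivAt hw.deriv0
  have hddw := dx_dx_of_hasDerivAt hw.deriv0 hw.deriv1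
  have hw₂C : C1 w₂ := c1_of_hasDerivWithinAt (fun x _ => (hw.deriv2 x).hasDerivWithinAt)
    hw.lipschitz.continuous.continuousOn
  -- `l ψ = (w'', ψ'') + w(0) ψ(0) + w'(0) ψ'(0)`
  let l : m.splines →ₗ[ℝ] ℝ :=
    { toFun := fun ψ => ip w₂ (dx (dx ψ)) + w 0 * (ψ : ℝ → ℝ) 0 + w₁ 0 * dx ψ 0
      map_add' := fun φ ψ => by
        have h1 := (Mesh.c1_of_mem φ.2.1).dx_add (Mesh.c1_of_mem ψ.2.1)
        have h2 := (dx_congr h1).trans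
          ((Mesh.c1_dx_of_mem φ.2.1).dx_add (Mesh.c1_dx_of_mem ψ.2.1))
        have h3 : ip w₂ (dx (dx (φ + ψ : m.splines))) = ip w₂ (dx (dx φ)) + ip w₂ (dx (dx ψ)) := by
          rw [← ip_add_right (Mesh.c1_dx_of_mem φ.2.1).continuousOn_dx
            (Mesh.c1_dx_of_mem ψ.2.1).continuousOn_dx hw₂c.continuousOn]
          exact ip_congr (fun _ _ => rfl) h2
        have h4 : dx (φ + ψ : m.splines) 0 = dx φ 0 + dx ψ 0 := h1 zero_mem01
        rw [h3, h4, Submodule.coe_add, Pi.add_apply]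
        ring
      map_smul' := fun c φ => by
        have h1 := (Mesh.c1_of_mem φ.2.1).dx_const_mul c
        have h2 := (dx_congr h1).trans ((Mesh.c1_dx_of_mem φ.2.1).dx_const_mul c)
        have h3 : ip w₂ (dx (dx (c • φ : m.splines))) = c * ip w₂ (dx (dx φ)) := by
          rw [← ip_const_mul_right]
          exact ip_congr (fun _ _ => rfl) h2
        have h4 : dx (c • φ : m.splines) 0 = c * dx φ 0 := h1 zero_mem01
        rw [h3, h4, Submodule.coe_smul, Pi.smul_apply]
        simp only [smul_eq_mul, RingHom.id_apply]
        ring }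
  obtain ⟨s, hs⟩ := exists_riesz (bendingForm m) (bendingForm_definite m) l
  have hsC := s.2.1.1
  set e : ℝ → ℝ := fun x => w x - (s : ℝ → ℝ) x with he
  have heC2 : ContDiffOn ℝ 2 e (Icc 0 1) := hwC.sub hsC
  have heC := c1_of_contDiffOn_two heC2
  have hdeC := c1_dx_of_contDiffOn_two heC2
  have hec := heC.continuousOn
  have hdec := hdeC.continuousOn
  have hddec := hdeC.continuousOn_dx
  have hde := (c1_of_contDiffOn_two hwC).dx_sub (c1_of_contDiffOn_two hsC)
  have hdde : EqOn (dx (dx e)) (fun x => w₂ x - dx (dx s) x) (Icc 0 1) := by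
    intro x hx
    have := ((dx_congr hde).trans
      ((c1_dx_of_contDiffOn_two hwC).dx_sub (c1_dx_of_contDiffOn_two hsC))) hx
    rw [this]
    simp only [hddw hx]
  have orth : ∀ ψ ∈ m.S, ip (dx (dx e)) (dx (dx ψ)) + e 0 * ψ 0 + dx e 0 * dx ψ 0 = 0 := by
    intro ψ hψ
    have h1 := hs ⟨_, Mesh.indicator_mem_splines hψ⟩
    rw [bendingForm_apply] at h1
    change _ = ip w₂ _ + w 0 * _ + w₁ 0 * _ at h1
    have hi := Mesh.indicator_eqOn ψ
    simp only at h1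
    rw [ip_congr (fun _ _ => rfl) (dx_congr (dx_congr hi)), hi zero_mem01, dx_congr hi zero_mem01,
      ip_congr (f := w₂) (fun _ _ => rfl) (dx_congr (dx_congr hi))] at h1
    have hψc := (Mesh.c1_dx_of_mem hψ).continuousOn_dx
    rw [ip_congr hdde (fun _ _ => rfl), ip_sub_left hw₂c.continuousOn
      (c1_dx_of_contDiffOn_two hsC).continuousOn_dx hψc, hde zero_mem01]
    simp only [hdw zero_mem01, he]
    linarith
  have hip0 : ∀ f : ℝ → ℝ, ip f (fun _ => 0) = 0 := fun f => by simp [ip]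
  have e0 : e 0 = 0 := by
    have h1 := orth _ (Mesh.polynomial_mem_S (m := m) 1 (by simp))
    simp only [Polynomial.eval_one] at h1
    have h2 := dx_of_hasDerivAt (f := fun _ => (1 : ℝ)) fun x => hasDerivAt_const x 1
    have h3 := dx_dx_of_hasDerivAt (f := fun _ => (1 : ℝ)) (fun x => hasDerivAt_const x 1)
      fun x => hasDerivAt_const x 0
    rw [ip_congr (fun _ _ => rfl) h3, h2 zero_mem01] at h1
    simpa [hip0] using h1
  have de0 : dx e 0 = 0 := by
    have h1 := orth _ (Mesh.polynomial_mem_S (m := m) Polynomial.X (by simp))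
    simp only [Polynomial.eval_X] at h1
    have h2 := dx_of_hasDerivAt (f := fun x : ℝ => x) fun x => hasDerivAt_id' x
    have h3 := dx_dx_of_hasDerivAt (f := fun x : ℝ => x) (fun x => hasDerivAt_id' x)
      fun x => hasDerivAt_const x 1
    rw [ip_congr (fun _ _ => rfl) h3, h2 zero_mem01] at h1
    simpa [hip0] using h1
  have de1 : dx e 1 = 0 := by
    have h1 := orth _ (Mesh.polynomial_mem_S (m := m) (Polynomial.X ^ 2) (by simp))
    simp only [Polynomial.eval_X, Polynomial.eval_pow] at h1
    have d1 : ∀ x : ℝ, HasDerivAt (fun x : ℝ => x ^ 2) (2 * x) x := fun x => by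
      simpa using hasDerivAt_pow 2 x
    have d2 : ∀ x : ℝ, HasDerivAt (fun x : ℝ => 2 * x) 2 x := fun x => by
      simpa using (hasDerivAt_id' x).const_mul 2
    rw [ip_congr (fun _ _ => rfl) (dx_dx_of_hasDerivAt d1 d2), e0, de0, zero_mul, zero_mul, add_zero,
      add_zero] at h1
    simp only [ip, intervalIntegral.integral_mul_const] at h1
    rw [hdeC.integral_dx zero_mem01 one_mem01, de0] at h1
    linarith
  have enode : ∀ k, e (m.node k) = 0 := by
    intro k
    have hk := m.node_mem k
    set c := m.node k with hc
    have h1 := orth _ (m.truncatedCube_mem_S k)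
    rw [ip_congr (fun _ _ => rfl) (dx_dx_of_hasDerivAt (hasDerivAt_truncatedCube _)
      (hasDerivAt_truncatedSquare _)), e0, de0, zero_mul, zero_mul, add_zero, add_zero,
      ip_const_mul_right, ← hc] at h1
    have h2 : ip (dx (dx e)) (fun x => max (c - x) 0) = 0 := by linarith
    have hg : ContinuousOn (fun x => dx (dx e) x * max (c - x) 0) (Icc 0 1) :=
      hddec.mul (by fun_prop)
    rw [ip, ← intervalIntegral.integral_add_adjacent_intervals
      (hg.intervalIntegrable_of_mem zero_mem01 hk) (hg.intervalIntegrable_of_mem hk one_mem01)] at h2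
    have h3 : ∫ x in c..1, dx (dx e) x * max (c - x) 0 = 0 := by
      rw [intervalIntegral.integral_congr (g := fun _ => 0)]
      · simp
      · intro x hx
        rw [uIcc_of_le hk.2] at hx
        simp only
        rw [max_eq_right (by linarith [hx.1]), mul_zero]
    have h4 : ∫ x in (0 : ℝ)..c, dx (dx e) x * max (c - x) 0 =
        ∫ x in (0 : ℝ)..c, (dx (dx e) x * (c - x) + dx e x * (-1) + dx e x) := by
      refine intervalIntegral.integral_congr fun x hx => ?_
      rw [uIcc_of_le hk.1] at hx
      rw [max_eq_left (by linarith [hx.2])]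
      ring
    have h5 : ∫ x in (0 : ℝ)..c, (dx (dx e) x * (c - x) + dx e x * (-1) + dx e x) =
        (dx e c * (c - c) + e c) - (dx e 0 * (c - 0) + e 0) := by
      refine integral_eq_sub_of_hasDerivWithinAt (a := 0) (b := 1)
        (f := fun x => dx e x * (c - x) + e x) (fun x hx => ?_) ?_ zero_mem01 hk
      · exact ((hdeC.hasDerivWithinAt hx).mul
          ((hasDerivWithinAt_id x _).const_sub c)).add (heC.hasDerivWithinAt hx)
      · exact ((hddec.mul (by fun_prop)).add (hdec.mul continuousOn_const)).add hdec
    rw [h4, h5, h3, e0, de0] at h2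
    linarith
  have e1 : e 1 = 0 := by rw [← m.last]; exact enode _
  -- the energy identity for the second derivative
  have energy : ip (dx (dx e)) (dx (dx e)) ≤ M * normL2 e := by
    have h1 := orth s s.2.1
    rw [e0, de0, zero_mul, zero_mul, add_zero, add_zero] at h1
    have h2 : ip (dx (dx e)) (dx (dx e)) = ip (dx (dx e)) w₂ := by
      rw [ip_congr (f := dx (dx e)) (fun _ _ => rfl) hdde, ip_sub_right hw₂c.continuousOn
        (c1_dx_of_contDiffOn_two hsC).continuousOn_dx hddec, h1, sub_zero]
    rw [h2, ip_dx_left hdeC hw₂C, de0, de1, zero_mul, zero_mul, sub_zero, zero_sub,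
      ip_congr (f := dx e) (fun _ _ => rfl) (dx_of_hasDerivAt hw.deriv2)]
    exact (neg_le_abs _).trans (abs_ip_dx_le_of_lipschitz hM heC e0 e1 hw.lipschitz)
  have hhpos := m.h_pos
  have cell : ∀ {f : ℝ → ℝ}, C1 f → (∀ i : Fin N, ∃ c ∈ Icc (m.node i.castSucc) (m.node i.succ),
      f c = 0) → normL2 f ≤ m.h * normL2 (dx f) := by
    intro f hf hz
    refine abs_le_of_sq_le_sq' ?_ (mul_nonneg hhpos.le (normL2_nonneg _)) |>.2
    rw [mul_pow, normL2_sq, normL2_sq]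
    refine m.integral_le_of_cells (hf.continuousOn.mul hf.continuousOn)
      (hf.continuousOn_dx.mul hf.continuousOn_dx) fun i => ?_
    obtain ⟨c, hc, hfc⟩ := hz i
    refine (integral_sq_le_of_zero hc hfc (fun x hx => (hf.hasDerivWithinAt
      (m.cell_subset i hx)).mono (m.cell_subset i))
      (hf.continuousOn_dx.mono (m.cell_subset i))).trans ?_
    refine mul_le_mul_of_nonneg_right (pow_le_pow_left₀ (m.width_pos i).le (m.width_le_h i) 2) ?_
    exact intervalIntegral.integral_nonneg (m.node_lt i).le fun _ _ => mul_self_nonneg _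
  have b0 : normL2 e ≤ m.h * normL2 (dx e) :=
    cell heC fun i => ⟨_, left_mem_Icc.2 (m.node_lt i).le, enode _⟩
  have b1 : normL2 (dx e) ≤ m.h * normL2 (dx (dx e)) := by
    refine cell hdeC fun i => ?_
    obtain ⟨c, hc, hc'⟩ := exists_hasDerivAt_eq_zero (f := e) (f' := dx e) (m.node_lt i)
      (hec.mono (m.cell_subset i)) ((enode _).trans (enode _).symm) fun x hx =>
        (heC.hasDerivWithinAt (m.cell_subset i (Ioo_subset_Icc_self hx))).hasDerivAt
          (Filter.mem_of_superset (Icc_mem_nhds hx.1 hx.2) (m.cell_subset i))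
    exact ⟨c, Ioo_subset_Icc_self hc, hc'⟩
  have b2 : normL2 (dx (dx e)) ≤ M * m.h ^ 2 := by
    rw [← normL2_sq] at energy
    have hn := normL2_nonneg (dx (dx e))
    have h1 : normL2 e ≤ m.h * (m.h * normL2 (dx (dx e))) :=
      b0.trans (mul_le_mul_of_nonneg_left b1 hhpos.le)
    have h2 : normL2 (dx (dx e)) ^ 2 ≤ M * (m.h * (m.h * normL2 (dx (dx e)))) :=
      energy.trans (mul_le_mul_of_nonneg_left h1 hM)
    by_contra! hcon
    have h3 : 0 < normL2 (dx (dx e)) := lt_of_le_of_lt (by positivity) hcon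
    have h4 := mul_lt_mul_of_pos_right hcon h3
    nlinarith
  have b3 : normL2 (dx e) ≤ M * m.h ^ 3 := by
    calc _ ≤ _ := b1
      _ ≤ m.h * (M * m.h ^ 2) := by gcongr
      _ = _ := by ring
  refine ⟨s, s.2.1, ?_, ?_, ?_, b3⟩
  · exact (sub_eq_zero.1 e0).symm
  · exact (sub_eq_zero.1 e1).symm
  · calc _ ≤ _ := b0
      _ ≤ m.h * (M * m.h ^ 3) := by gcongr
      _ = _ := by ring

/-! ### The inverse inequality and the projections onto splines -/

/-- The inverse inequality for cubic polynomials on an interval. -/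
theorem polynomial_inverse_le (p : Polynomial ℝ) (hp : p.natDegree ≤ 3) {a b : ℝ} (hab : a < b) :
    (b - a) ^ 2 * ∫ x in a..b, p.derivative.eval x * p.derivative.eval x ≤
      200 * ∫ x in a..b, p.eval x * p.eval x := by
  set c := (a + b) / 2 with hc
  set r := (b - a) / 2 with hr
  have hr0 : 0 < r := by rw [hr]; linarith
  set q := p.comp (Polynomial.X + Polynomial.C c) with hq
  have hqd : q.natDegree < 4 := by
    rw [hq, Polynomial.natDegree_comp, Polynomial.natDegree_X_add_C]
    lia
  obtain ⟨c0, c1, c2, c3, hqe⟩ : ∃ c0 c1 c2 c3 : ℝ, ∀ y,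
      q.eval y = c0 + c1 * y + c2 * y ^ 2 + c3 * y ^ 3 := by
    refine ⟨q.coeff 0, q.coeff 1, q.coeff 2, q.coeff 3, fun y => ?_⟩
    rw [Polynomial.eval_eq_sum_range' hqd]
    simp [Finset.sum_range_succ]
  have hpe : ∀ x, p.eval x = c0 + c1 * (x - c) + c2 * (x - c) ^ 2 + c3 * (x - c) ^ 3 := fun x => by
    rw [← hqe, hq, Polynomial.eval_comp]
    simp
  have hpe' : ∀ x, p.derivative.eval x = c1 + 2 * c2 * (x - c) + 3 * c3 * (x - c) ^ 2 := fun x => by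
    have h0 : HasDerivAt (fun x : ℝ => x - c) 1 x := (hasDerivAt_id' x).sub_const c
    have h1 := (((hasDerivAt_const x c0).add (h0.const_mul c1)).add
      ((h0.pow 2).const_mul c2)).add ((h0.pow 3).const_mul c3)
    refine (p.hasDerivAt x).unique (((h1.congr_of_eventuallyEq
      (Filter.Eventually.of_forall fun y => ?_))).congr_deriv ?_)
    · simp [hpe y]
    · norm_num
      ring
  have hshift : ∀ F : ℝ → ℝ, ∫ x in a..b, F (x - c) = ∫ y in (-r)..r, F y := fun F => by
    rw [intervalIntegral.integral_comp_sub_right]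
    congr 1 <;> (rw [hc, hr]; ring)
  have I1 : ∫ x in a..b, p.eval x * p.eval x = 2 * (c0 ^ 2 * r + (2 * c0 * c2 + c1 ^ 2) * r ^ 3 / 3
      + (c2 ^ 2 + 2 * c1 * c3) * r ^ 5 / 5 + c3 ^ 2 * r ^ 7 / 7) := by
    simp only [hpe]
    rw [hshift fun y => (c0 + c1 * y + c2 * y ^ 2 + c3 * y ^ 3) *
      (c0 + c1 * y + c2 * y ^ 2 + c3 * y ^ 3)]
    rw [intervalIntegral.integral_eq_sub_of_hasDerivAt
      (f := fun y => c0 ^ 2 * y + c0 * c1 * y ^ 2 + (2 * c0 * c2 + c1 ^ 2) / 3 * y ^ 3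
        + (c0 * c3 + c1 * c2) / 2 * y ^ 4 + (c2 ^ 2 + 2 * c1 * c3) / 5 * y ^ 5
        + c2 * c3 / 3 * y ^ 6 + c3 ^ 2 / 7 * y ^ 7) (fun y _ => ?_)
      (Continuous.intervalIntegrable (by fun_prop) _ _)]
    · ring
    · have h1 := ((((((((hasDerivAt_id' y).const_mul (c0 ^ 2)).add
        ((hasDerivAt_pow 2 y).const_mul (c0 * c1))).add
        ((hasDerivAt_pow 3 y).const_mul ((2 * c0 * c2 + c1 ^ 2) / 3))).add
        ((hasDerivAt_pow 4 y).const_mul ((c0 * c3 + c1 * c2) / 2))).add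
        ((hasDerivAt_pow 5 y).const_mul ((c2 ^ 2 + 2 * c1 * c3) / 5))).add
        ((hasDerivAt_pow 6 y).const_mul (c2 * c3 / 3))).add
        ((hasDerivAt_pow 7 y).const_mul (c3 ^ 2 / 7)))
      refine h1.congr_deriv ?_
      norm_num
      ring
  have I2 : ∫ x in a..b, p.derivative.eval x * p.derivative.eval x =
      2 * (c1 ^ 2 * r + (4 * c2 ^ 2 + 6 * c1 * c3) * r ^ 3 / 3 + 9 * c3 ^ 2 * r ^ 5 / 5) := by
    simp only [hpe']
    rw [hshift fun y => (c1 + 2 * c2 * y + 3 * c3 * y ^ 2) * (c1 + 2 * c2 * y + 3 * c3 * y ^ 2)]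
    rw [intervalIntegral.integral_eq_sub_of_hasDerivAt
      (f := fun y => c1 ^ 2 * y + 2 * c1 * c2 * y ^ 2 + (4 * c2 ^ 2 + 6 * c1 * c3) / 3 * y ^ 3
        + 3 * c2 * c3 * y ^ 4 + 9 * c3 ^ 2 / 5 * y ^ 5) (fun y _ => ?_)
      (Continuous.intervalIntegrable (by fun_prop) _ _)]
    · ring
    · have h1 := ((((((hasDerivAt_id' y).const_mul (c1 ^ 2)).add
        ((hasDerivAt_pow 2 y).const_mul (2 * c1 * c2))).add
        ((hasDerivAt_pow 3 y).const_mul ((4 * c2 ^ 2 + 6 * c1 * c3) / 3))).add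
        ((hasDerivAt_pow 4 y).const_mul (3 * c2 * c3))).add
        ((hasDerivAt_pow 5 y).const_mul (9 * c3 ^ 2 / 5)))
      refine h1.congr_deriv ?_
      norm_num
      ring
  rw [I1, I2, show b - a = 2 * r by rw [hr]; ring]
  -- after the scaling `dᵢ = cᵢ rⁱ`, both sides split into their even and odd parts
  set d1 := c1 * r with hd1
  set d2 := c2 * r ^ 2 with hd2
  set d3 := c3 * r ^ 3 with hd3
  have key : d1 ^ 2 + (4 * d2 ^ 2 + 6 * d1 * d3) / 3 + 9 * d3 ^ 2 / 5 ≤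
      50 * (c0 ^ 2 + (2 * c0 * d2 + d1 ^ 2) / 3 + (d2 ^ 2 + 2 * d1 * d3) / 5 + d3 ^ 2 / 7) := by
    nlinarith [sq_nonneg (c0 + d2 / 3), sq_nonneg d2, sq_nonneg (d1 + 3 / 5 * d3), sq_nonneg d3,
      sq_nonneg (d1 + 3 / 5 * d3 - 2 / 5 * d3)]
  have := mul_le_mul_of_nonneg_left key (show 0 ≤ 8 * r by positivity)
  rw [hd1, hd2, hd3] at this
  nlinarith [this]

theorem Mesh.nonneg_of_quasiuniform {N : ℕ} {m : Mesh N} {κ : ℝ} (hκ : m.Quasiuniform κ) :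
    0 ≤ κ := by
  have i : Fin N := ⟨0, Nat.pos_of_ne_zero m.ne_zero⟩
  have h1 := hκ i i
  have h2 := m.width_pos i
  by_contra! hcon
  nlinarith

/-- The inverse inequality for splines on a quasiuniform mesh; `15² ≥ 200`. -/
theorem Mesh.inverse_le {N : ℕ} {m : Mesh N} {κ : ℝ} (hκ : m.Quasiuniform κ) {φ : ℝ → ℝ}
    (hφ : φ ∈ m.S) : m.h * normL2 (dx φ) ≤ 15 * κ * normL2 φ := by
  have hC := Mesh.c1_of_mem hφ
  have hκ0 := Mesh.nonneg_of_quasiuniform hκ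
  have hh := m.h_pos
  have key : ip (dx φ) (dx φ) ≤ 200 * κ ^ 2 / m.h ^ 2 * ip φ φ := by
    refine m.integral_le_of_cells (hC.continuousOn_dx.mul hC.continuousOn_dx)
      (hC.continuousOn.mul hC.continuousOn) fun i => ?_
    obtain ⟨p, hp, hpe⟩ := hφ.2 i
    have hlt := m.node_lt i
    have hpe' : ∀ x ∈ Icc (m.node i.castSucc) (m.node i.succ), dx φ x = p.derivative.eval x := by
      intro x hx
      have h1 := (hC.hasDerivWithinAt (m.cell_subset i hx)).mono (m.cell_subset i)
      have h2 := ((p.hasDerivAt x).hasDerivWithinAt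
        (s := Icc (m.node i.castSucc) (m.node i.succ))).congr hpe (hpe x hx)
      exact (uniqueDiffOn_Icc hlt x hx).eq_deriv _ h1 h2
    have e1 : ∫ x in (m.node i.castSucc)..(m.node i.succ), dx φ x * dx φ x =
        ∫ x in (m.node i.castSucc)..(m.node i.succ), p.derivative.eval x * p.derivative.eval x :=
      intervalIntegral.integral_congr fun x hx => by
        rw [uIcc_of_le hlt.le] at hx
        simp only [hpe' x hx]
    have e2 : ∫ x in (m.node i.castSucc)..(m.node i.succ), φ x * φ x =
        ∫ x in (m.node i.castSucc)..(m.node i.succ), p.eval x * p.eval x :=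
      intervalIntegral.integral_congr fun x hx => by
        rw [uIcc_of_le hlt.le] at hx
        simp only [hpe x hx]
    have h1 := polynomial_inverse_le p hp hlt
    rw [← e1, ← e2] at h1
    have h2 := m.h_le_mul_width hκ i
    rw [Mesh.width] at h2
    set A := ∫ x in (m.node i.castSucc)..(m.node i.succ), dx φ x * dx φ x
    have hA : 0 ≤ A := intervalIntegral.integral_nonneg hlt.le fun _ _ => mul_self_nonneg _
    have h3 : m.h ^ 2 * A ≤ κ ^ 2 * ((m.node i.succ - m.node i.castSucc) ^ 2 * A) := by
      rw [← mul_assoc, ← mul_pow]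
      gcongr
    rw [div_mul_eq_mul_div, le_div_iff₀ (by positivity)]
    nlinarith [mul_le_mul_of_nonneg_left h1 (sq_nonneg κ)]
  refine abs_le_of_sq_le_sq' ?_ (mul_nonneg (by positivity) (normL2_nonneg _)) |>.2
  rw [mul_pow, mul_pow, normL2_sq, normL2_sq]
  rw [div_mul_eq_mul_div, le_div_iff₀ (by positivity)] at key
  nlinarith [ip_self_nonneg φ, mul_nonneg (sq_nonneg κ) (ip_self_nonneg φ)]

theorem Mesh.sub_mem_S {N : ℕ} {m : Mesh N} {φ ψ : ℝ → ℝ} (h : φ ∈ m.S) (h' : ψ ∈ m.S) :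
    (fun x => φ x - ψ x) ∈ m.S :=
  Mesh.mem_S_congr (Mesh.add_mem_S h (Mesh.smul_mem_S (-1) h')) fun x _ => by
    simp [sub_eq_add_neg]

theorem Mesh.sub_mem_S0 {N : ℕ} {m : Mesh N} {φ ψ : ℝ → ℝ} (h : φ ∈ m.S0) (h' : ψ ∈ m.S0) :
    (fun x => φ x - ψ x) ∈ m.S0 :=
  ⟨Mesh.sub_mem_S h.1 h'.1, by simp [h.2.1, h'.2.1], by simp [h.2.2, h'.2.2]⟩

theorem a_congr {f f' g g' : ℝ → ℝ} (hf : EqOn f f' (Icc 0 1)) (hg : EqOn g g' (Icc 0 1)) :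
    a f g = a f' g' := by
  rw [a, a, ip_congr hf hg, ip_congr (dx_congr hf) (dx_congr hg)]

theorem a_comm (f g : ℝ → ℝ) : a f g = a g f := by
  rw [a, a, ip_comm f, ip_comm (dx f)]

theorem a_add_left {f g k : ℝ → ℝ} (hf : C1 f) (hg : C1 g) (hk : C1 k) :
    a (fun x => f x + g x) k = a f k + a g k := by
  rw [a, a, a, ip_add_left hf.continuousOn hg.continuousOn hk.continuousOn,
    ip_congr (hf.dx_add hg) (fun _ _ => rfl),
    ip_add_left hf.continuousOn_dx hg.continuousOn_dx hk.continuousOn_dx]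
  ring

theorem a_sub_left {f g k : ℝ → ℝ} (hf : C1 f) (hg : C1 g) (hk : C1 k) :
    a (fun x => f x - g x) k = a f k - a g k := by
  rw [a, a, a, ip_sub_left hf.continuousOn hg.continuousOn hk.continuousOn,
    ip_congr (hf.dx_sub hg) (fun _ _ => rfl),
    ip_sub_left hf.continuousOn_dx hg.continuousOn_dx hk.continuousOn_dx]
  ring

theorem a_const_mul_left {f : ℝ → ℝ} (hf : C1 f) (c : ℝ) (k : ℝ → ℝ) :
    a (fun x => c * f x) k = c * a f k := by
  rw [a, a, ip_const_mul_left, ip_congr (hf.dx_const_mul c) (fun _ _ => rfl), ip_const_mul_left]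
  ring

theorem a_add_right {f g k : ℝ → ℝ} (hf : C1 f) (hg : C1 g) (hk : C1 k) :
    a k (fun x => f x + g x) = a k f + a k g := by
  rw [a_comm, a_add_left hf hg hk, a_comm f, a_comm g]

theorem a_const_mul_right {f : ℝ → ℝ} (hf : C1 f) (c : ℝ) (k : ℝ → ℝ) :
    a k (fun x => c * f x) = c * a k f := by
  rw [a_comm, a_const_mul_left hf, a_comm]

theorem a_self (f : ℝ → ℝ) : a f f = normL2 f ^ 2 + 1 / 3 * normL2 (dx f) ^ 2 := by
  rw [a, normL2_sq, normL2_sq]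

theorem a_self_nonneg (f : ℝ → ℝ) : 0 ≤ a f f := by
  rw [a_self]; positivity

/-- The error of the `L²` projection: stability gives the `L²` bound, and the inverse inequality,
applied to the difference from the interpolant, the `H¹` bound. -/
theorem Mesh.IsL2Proj.error_le {N : ℕ} {m : Mesh N} {κ M : ℝ} (hκ : m.Quasiuniform κ)
    (hM : 0 ≤ M) {v w w₁ w₂ w₃ p : ℝ → ℝ} (hv : C1 v) (hvw : EqOn v w (Icc 0 1))
    (hw : IsRegular M w w₁ w₂ w₃) (hp : m.IsL2Proj v p) :
    normL2 (fun x => v x - p x) ≤ M * m.h ^ 4 ∧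
      normL2 (dx fun x => v x - p x) ≤ (1 + 15 * κ) * M * m.h ^ 3 := by
  obtain ⟨s, hs, -, -, hs0, hs1⟩ := exists_spline_approx m hM hw
  have hvs : EqOn (fun x => v x - s x) (fun x => w x - s x) (Icc 0 1) := fun x hx => by
    simp only [hvw hx]
  rw [← normL2_congr hvs] at hs0
  rw [← normL2_congr (dx_congr hvs)] at hs1
  have hsC := Mesh.c1_of_mem hs
  have hpC := Mesh.c1_of_mem hp.1
  have hps := Mesh.sub_mem_S hp.1 hs
  have hpsC := Mesh.c1_of_mem hps
  have hvp := hv.sub hpC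
  have horth : ip (fun x => v x - p x) (fun x => p x - s x) = 0 := by
    rw [ip_sub_left hv.continuousOn hpC.continuousOn hpsC.continuousOn, hp.2 _ hps, sub_self]
  have hsplit : (fun x => v x - s x) = fun x => (v x - p x) + (p x - s x) := by
    ext x; ring
  have hpyth : normL2 (fun x => v x - s x) ^ 2 =
      normL2 (fun x => v x - p x) ^ 2 + normL2 (fun x => p x - s x) ^ 2 := by
    rw [normL2_sq, normL2_sq, normL2_sq, hsplit,
      ip_add_left hvp.continuousOn hpsC.continuousOn (hvp.add hpsC).continuousOn,
      ip_add_right hvp.continuousOn hpsC.continuousOn hvp.continuousOn,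
      ip_add_right hvp.continuousOn hpsC.continuousOn hpsC.continuousOn, horth,
      ip_comm (fun x => p x - s x) (fun x => v x - p x), horth]
    ring
  have hh := m.h_pos
  have h1 : normL2 (fun x => v x - p x) ≤ M * m.h ^ 4 :=
    (abs_le_of_sq_le_sq' (by nlinarith [sq_nonneg (normL2 fun x => p x - s x)])
      (normL2_nonneg _)).2.trans hs0
  have h2 : normL2 (fun x => p x - s x) ≤ M * m.h ^ 4 :=
    (abs_le_of_sq_le_sq' (by nlinarith [sq_nonneg (normL2 fun x => v x - p x)])
      (normL2_nonneg _)).2.trans hs0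
  refine ⟨h1, ?_⟩
  have h3 := Mesh.inverse_le hκ hps
  have hκ0 := Mesh.nonneg_of_quasiuniform hκ
  have h4 : normL2 (dx fun x => p x - s x) ≤ 15 * κ * M * m.h ^ 3 := by
    have : m.h * normL2 (dx fun x => p x - s x) ≤ m.h * (15 * κ * M * m.h ^ 3) := by
      calc _ ≤ _ := h3
        _ ≤ 15 * κ * (M * m.h ^ 4) := by gcongr
        _ = _ := by ring
    exact le_of_mul_le_mul_left this hh
  have h5 : EqOn (dx fun x => v x - p x)
      (fun x => dx (fun x => v x - s x) x - dx (fun x => p x - s x) x) (Icc 0 1) := by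
    have : (fun x => v x - p x) = fun x => (v x - s x) - (p x - s x) := by ext x; ring
    rw [this]
    exact (hv.sub hsC).dx_sub hpsC
  rw [normL2_congr h5]
  have h6 := normL2_sub_le (hv.sub hsC).continuousOn_dx hpsC.continuousOn_dx
  linarith

/-- The error of the elliptic projection, by Céa's lemma. -/
theorem Mesh.IsEllipticProj.error_le {N : ℕ} {m : Mesh N} {M : ℝ} (hM : 0 ≤ M) (hh1 : m.h ≤ 1)
    {v w w₁ w₂ w₃ r : ℝ → ℝ} (hv : C1 v) (hv0 : v 0 = 0) (hv1 : v 1 = 0)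
    (hvw : EqOn v w (Icc 0 1)) (hw : IsRegular M w w₁ w₂ w₃) (hr : m.IsEllipticProj v r) :
    normL2 (fun x => v x - r x) ≤ 2 * M * m.h ^ 3 ∧
      normL2 (dx fun x => v x - r x) ≤ 2 * M * m.h ^ 3 := by
  obtain ⟨s, hs, hs_0, hs_1, hs0, hs1⟩ := exists_spline_approx m hM hw
  have hvs : EqOn (fun x => v x - s x) (fun x => w x - s x) (Icc 0 1) := fun x hx => by
    simp only [hvw hx]
  rw [← normL2_congr hvs] at hs0
  rw [← normL2_congr (dx_congr hvs)] at hs1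
  have hsC := Mesh.c1_of_mem hs
  have hrC := Mesh.c1_of_mem hr.1.1
  have hsS0 : s ∈ m.S0 := ⟨hs, by rw [hs_0, ← hvw zero_mem01, hv0],
    by rw [hs_1, ← hvw one_mem01, hv1]⟩
  have hrs := Mesh.sub_mem_S0 hr.1 hsS0
  have hrsC := Mesh.c1_of_mem hrs.1
  have hvr := hv.sub hrC
  have horth : a (fun x => v x - r x) (fun x => r x - s x) = 0 := by
    rw [a_sub_left hv hrC hrsC, hr.2 _ hrs, sub_self]
  have hsplit : (fun x => v x - s x) = fun x => (v x - r x) + (r x - s x) := by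
    ext x; ring
  have hpyth : a (fun x => v x - s x) (fun x => v x - s x) =
      a (fun x => v x - r x) (fun x => v x - r x) +
        a (fun x => r x - s x) (fun x => r x - s x) := by
    rw [hsplit, a_add_left hvr hrsC (hvr.add hrsC), a_add_right hvr hrsC hvr,
      a_add_right hvr hrsC hrsC, horth, a_comm (fun x => r x - s x) (fun x => v x - r x), horth]
    ring
  have hh := m.h_pos
  have h0 : 0 ≤ M * m.h ^ 3 := by positivity
  have hs0' : normL2 (fun x => v x - s x) ≤ M * m.h ^ 3 := by
    refine hs0.trans (mul_le_mul_of_nonneg_left ?_ hM)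
    exact pow_le_pow_of_le_one hh.le hh1 (by norm_num)
  have h1 := a_self_nonneg (fun x => r x - s x)
  rw [a_self (fun x => v x - s x), a_self (fun x => v x - r x)] at hpyth
  have h2 := pow_le_pow_left₀ (normL2_nonneg _) hs0' 2
  have h3 := pow_le_pow_left₀ (normL2_nonneg _) hs1 2
  have h4 := sq_nonneg (normL2 fun x => v x - r x)
  have h5 := sq_nonneg (normL2 (dx fun x => v x - r x))
  constructor
  · exact (abs_le_of_sq_le_sq' (by nlinarith) (by linarith)).2
  · exact (abs_le_of_sq_le_sq' (by nlinarith) (by linarith)).2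

/-! ### Ordinary differential equations near an approximate solution -/

section NormedSpace

variable {E : Type*} [NormedAddCommGroup E] [NormedSpace ℝ E]

/-- The radial retraction onto the closed ball of radius `δ`. -/
noncomputable def radialRetract (δ : ℝ) (x : E) : E := (δ / max δ ‖x‖) • x

theorem norm_radialRetract_le {δ : ℝ} (hδ : 0 < δ) (x : E) : ‖radialRetract δ x‖ ≤ δ := by
  have hm : 0 < max δ ‖x‖ := lt_max_of_lt_left hδ
  rw [radialRetract, norm_smul, Real.norm_of_nonneg (by positivity), div_mul_eq_mul_div,
    div_le_iff₀ hm]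
  exact mul_le_mul_of_nonneg_left (le_max_right _ _) hδ.le

theorem radialRetract_of_le {δ : ℝ} (hδ : 0 < δ) {x : E} (hx : ‖x‖ ≤ δ) :
    radialRetract δ x = x := by
  rw [radialRetract, max_eq_left hx, div_self hδ.ne', one_smul]

theorem lipschitzWith_radialRetract {δ : ℝ} (hδ : 0 < δ) :
    LipschitzWith 2 (radialRetract δ : E → E) := by
  refine LipschitzWith.of_dist_le_mul fun x y => ?_
  rw [dist_eq_norm, dist_eq_norm]
  set p := max δ ‖x‖ with hp
  set q := max δ ‖y‖ with hq
  have hp0 : 0 < p := lt_max_of_lt_left hδ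
  have hq0 : 0 < q := lt_max_of_lt_left hδ
  have e1 : radialRetract δ x - radialRetract δ y = (δ / p) • (x - y) + (δ / p - δ / q) • y := by
    rw [radialRetract, radialRetract, ← hp, ← hq]
    module
  have h1 : ‖(δ / p) • (x - y)‖ ≤ ‖x - y‖ := by
    rw [norm_smul, Real.norm_of_nonneg (by positivity)]
    exact mul_le_of_le_one_left (norm_nonneg _) ((div_le_one hp0).2 (le_max_left _ _))
  have h2 : ‖(δ / p - δ / q) • y‖ ≤ ‖x - y‖ := by
    have e2 : δ / p - δ / q = (δ / p) * (q - p) / q := by field_simp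
    have h3 : |q - p| ≤ ‖x - y‖ := by
      refine (abs_max_sub_max_le_abs ‖y‖ ‖x‖ δ |>.trans_eq' ?_).trans ?_
      · rw [hq, hp, max_comm δ, max_comm δ]
      · rw [abs_sub_comm]
        exact abs_norm_sub_norm_le x y
    rw [norm_smul, e2, Real.norm_eq_abs, abs_div, abs_mul, abs_of_pos (div_pos hδ hp0),
      abs_of_pos hq0, div_mul_eq_mul_div, div_le_iff₀ hq0]
    calc δ / p * |q - p| * ‖y‖ ≤ 1 * ‖x - y‖ * q := by
          gcongr
          · exact (div_le_one hp0).2 (le_max_left _ _)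
          · exact le_max_right _ _
      _ = _ := by ring
  rw [e1]
  calc _ ≤ _ := norm_add_le _ _
    _ ≤ ‖x - y‖ + ‖x - y‖ := add_le_add h1 h2
    _ = _ := by rw [NNReal.coe_ofNat]; ring

end NormedSpace

/-- Uniqueness of solutions on `[0,T]` of an autonomous equation with a `C¹` vector field. -/
theorem ode_unique {E : Type*} [NormedAddCommGroup E] [NormedSpace ℝ E] [FiniteDimensional ℝ E]
    {F : E → E} (hF : ContDiff ℝ 1 F) {T : ℝ} {y z : ℝ → E}
    (hy : ∀ t ∈ Icc 0 T, HasDerivWithinAt y (F (y t)) (Icc 0 T) t)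
    (hz : ∀ t ∈ Icc 0 T, HasDerivWithinAt z (F (z t)) (Icc 0 T) t) (h0 : y 0 = z 0) :
    EqOn y z (Icc 0 T) := by
  have hyc : ContinuousOn y (Icc 0 T) := fun t ht => (hy t ht).continuousWithinAt
  have hzc : ContinuousOn z (Icc 0 T) := fun t ht => (hz t ht).continuousWithinAt
  obtain ⟨R, hR⟩ := isCompact_Icc.exists_bound_of_continuousOn hyc
  obtain ⟨R', hR'⟩ := isCompact_Icc.exists_bound_of_continuousOn hzc
  have : ProperSpace E := FiniteDimensional.proper ℝ E
  obtain ⟨K, hK⟩ := hF.contDiffOn.exists_lipschitzOnWith one_ne_zero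
    (convex_closedBall (0 : E) (max R R')) (isCompact_closedBall _ _)
  have hright : ∀ {f : ℝ → E} {t : ℝ} {v : E}, t ∈ Ico 0 T → HasDerivWithinAt f v (Icc 0 T) t →
      HasDerivWithinAt f v (Ici t) t := fun {f t v} ht hf =>
    hf.mono_of_mem_nhdsWithin (Filter.mem_of_superset (Icc_mem_nhdsGE ht.2)
      (Icc_subset_Icc_left ht.1))
  refine ODE_solution_unique_of_mem_Icc_right (v := fun _ => F)
    (s := fun _ => Metric.closedBall 0 (max R R')) (fun _ _ => hK) hyc
    (fun t ht => hright ht (hy t (Ico_subset_Icc_self ht))) (fun t ht => ?_) hzc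
    (fun t ht => hright ht (hz t (Ico_subset_Icc_self ht))) (fun t ht => ?_) h0
  · rw [mem_closedBall_zero_iff]
    exact (hR t (Ico_subset_Icc_self ht)).trans (le_max_left _ _)
  · rw [mem_closedBall_zero_iff]
    exact (hR' t (Ico_subset_Icc_self ht)).trans (le_max_right _ _)

section Euclidean

variable {E : Type*} [NormedAddCommGroup E] [InnerProductSpace ℝ E]

/-- Grönwall's inequality for the square of the norm. -/
theorem norm_le_of_inner_deriv_le {e e' : ℝ → E} {T C ε : ℝ} (hC : 0 ≤ C) (hε : 0 ≤ ε)
    (he : ∀ t ∈ Icc 0 T, HasDerivWithinAt e (e' t) (Icc 0 T) t) (he0 : e 0 = 0)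
    (h : ∀ t ∈ Icc 0 T, inner ℝ (e' t) (e t) ≤ C * (ε * ‖e t‖ + ‖e t‖ ^ 2)) :
    ∀ t ∈ Icc 0 T, ‖e t‖ ≤ ε * Real.exp (2 * C * T) := by
  intro t ht
  have hT : 0 ≤ T := ht.1.trans ht.2
  set g : ℝ → ℝ := fun s => (‖e s‖ ^ 2 + ε ^ 2) * Real.exp (-(4 * C) * s) with hg
  have hgd : ∀ s ∈ Icc 0 T, HasDerivWithinAt g
      (2 * inner ℝ (e s) (e' s) * Real.exp (-(4 * C) * s) +
        (‖e s‖ ^ 2 + ε ^ 2) * (Real.exp (-(4 * C) * s) * (-(4 * C)))) (Icc 0 T) s := by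
    intro s hs
    have h1 : HasDerivWithinAt (fun s => ‖e s‖ ^ 2) (2 * inner ℝ (e s) (e' s)) (Icc 0 T) s :=
      (he s hs).norm_sq
    have h2 : HasDerivAt (fun s => Real.exp (-(4 * C) * s))
        (Real.exp (-(4 * C) * s) * (-(4 * C))) s := by
      simpa using ((hasDerivAt_id' s).const_mul (-(4 * C))).exp
    exact (h1.add_const _).mul h2.hasDerivWithinAt
  have hanti : AntitoneOn g (Icc 0 T) := by
    refine antitoneOn_of_hasDerivWithinAt_nonpos (convex_Icc 0 T)
      (fun s hs => (hgd s hs).continuousWithinAt)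
      (fun s hs => (hgd s (interior_subset hs)).mono interior_subset) fun s hs => ?_
    have h1 := h s (interior_subset hs)
    rw [real_inner_comm] at h1
    have h2 := Real.exp_pos (-(4 * C) * s)
    have h3 : 2 * inner ℝ (e s) (e' s) ≤ (4 * C) * (‖e s‖ ^ 2 + ε ^ 2) := by
      have : ε * ‖e s‖ + ‖e s‖ ^ 2 ≤ 2 * (‖e s‖ ^ 2 + ε ^ 2) := by
        nlinarith [sq_nonneg (ε - ‖e s‖), sq_nonneg ε]
      nlinarith [mul_le_mul_of_nonneg_left this hC]
    nlinarith [mul_le_mul_of_nonneg_right h3 h2.le]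
  have h1 := hanti (left_mem_Icc.2 hT) ht ht.1
  simp only [hg, he0, norm_zero, mul_zero, Real.exp_zero, mul_one] at h1
  refine abs_le_of_sq_le_sq' ?_ (by positivity) |>.2
  have h2 : Real.exp (-(4 * C) * t) * Real.exp (4 * C * t) = 1 := by
    rw [← Real.exp_add]; simp
  have h3 := Real.exp_pos (4 * C * t)
  have h4 : ‖e t‖ ^ 2 + ε ^ 2 ≤ ε ^ 2 * Real.exp (4 * C * t) := by
    have := mul_le_mul_of_nonneg_right h1 h3.le
    rw [mul_assoc, h2] at this
    linarith
  have h5 : Real.exp (4 * C * t) ≤ Real.exp (2 * C * T) ^ 2 := by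
    rw [← Real.exp_nat_mul]
    refine Real.exp_le_exp.2 ?_
    push_cast
    nlinarith [mul_le_mul_of_nonneg_left ht.2 hC]
  rw [mul_pow]
  nlinarith [mul_le_mul_of_nonneg_left h5 (sq_nonneg ε), sq_nonneg ε]

/-- If the error estimate `⟪Y' - F(Y - z), z⟫ ≤ C (ε ‖z‖ + ‖z‖²)` holds for all perturbations `z` of
size at most `δ`, and Grönwall's bound is at most `δ`, then the equation `y' = F(y)` with
`y(0) = Y(0)` has a solution on the whole interval, and it obeys Grönwall's bound. Replacing the
error `Y - y` by its radial retraction makes the vector field bounded and Lipschitz and preserves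
the estimate, so no continuation argument is needed. -/
theorem exists_ode_solution_near [FiniteDimensional ℝ E] {F : E → E} (hF : ContDiff ℝ 1 F)
    {T δ C ε : ℝ} (hT : 0 ≤ T) (hδ : 0 < δ) (hC : 0 ≤ C) (hε : 0 ≤ ε) {Y Y' : ℝ → E}
    (hY : ∀ t ∈ Icc 0 T, HasDerivWithinAt Y (Y' t) (Icc 0 T) t)
    (h : ∀ t ∈ Icc 0 T, ∀ z, ‖z‖ ≤ δ →
      inner ℝ (Y' t - F (Y t - z)) z ≤ C * (ε * ‖z‖ + ‖z‖ ^ 2))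
    (hεδ : ε * Real.exp (2 * C * T) ≤ δ) :
    ∃ y : ℝ → E, y 0 = Y 0 ∧ (∀ t ∈ Icc 0 T, HasDerivWithinAt y (F (y t)) (Icc 0 T) t) ∧
      ∀ t ∈ Icc 0 T, ‖Y t - y t‖ ≤ ε * Real.exp (2 * C * T) := by
  have hYc : ContinuousOn Y (Icc 0 T) := fun t ht => (hY t ht).continuousWithinAt
  obtain ⟨R, hR⟩ := isCompact_Icc.exists_bound_of_continuousOn hYc
  have : ProperSpace E := FiniteDimensional.proper ℝ E
  have hcomp := isCompact_closedBall (0 : E) (R + δ)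
  obtain ⟨K, hK⟩ := hF.contDiffOn.exists_lipschitzOnWith one_ne_zero
    (convex_closedBall (0 : E) (R + δ)) hcomp
  obtain ⟨L, hL⟩ := hcomp.exists_bound_of_continuousOn hF.continuous.continuousOn
  have hmem : ∀ t ∈ Icc 0 T, ∀ x, Y t - radialRetract δ x ∈ Metric.closedBall (0 : E) (R + δ) := by
    intro t ht x
    rw [mem_closedBall_zero_iff]
    exact (norm_sub_le _ _).trans (add_le_add (hR t ht) (norm_radialRetract_le hδ x))
  set G : ℝ → E → E := fun t x => F (Y t - radialRetract δ (Y t - x)) with hG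
  have hret : Continuous (radialRetract δ : E → E) := (lipschitzWith_radialRetract hδ).continuous
  have hpl : IsPicardLindelof G (tmin := 0) (tmax := T) ⟨0, left_mem_Icc.2 hT⟩ (Y 0)
      (L.toNNReal * T.toNNReal) 0 L.toNNReal (K * 2) := by
    refine ⟨fun t ht => ?_, fun x _ => ?_, fun t ht x _ => ?_, ?_⟩
    · refine LipschitzOnWith.of_dist_le_mul fun x _ x' _ => ?_
      have h1 := hK.dist_le_mul _ (hmem t ht (Y t - x)) _ (hmem t ht (Y t - x'))
      have h2 := (lipschitzWith_radialRetract hδ).dist_le_mul (Y t - x) (Y t - x')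
      rw [dist_sub_left] at h1
      rw [dist_sub_left] at h2
      calc _ ≤ _ := h1
        _ ≤ K * (((2 : NNReal) : ℝ) * dist x x') := by gcongr
        _ = _ := by rw [NNReal.coe_mul]; ring
    · exact hF.continuous.comp_continuousOn
        (hYc.sub (hret.comp_continuousOn (hYc.sub continuousOn_const)))
    · exact (hL _ (hmem t ht _)).trans (Real.le_coe_toNNReal L)
    · simp [hT]
  obtain ⟨y, hy0, hy⟩ := hpl.exists_eq_forall_mem_Icc_hasDerivWithinAt₀
  have herr : ∀ t ∈ Icc 0 T, ‖Y t - y t‖ ≤ ε * Real.exp (2 * C * T) := by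
    refine norm_le_of_inner_deriv_le (e := fun t => Y t - y t) (e' := fun t => Y' t - G t (y t))
      hC hε (fun t ht => (hY t ht).sub (hy t ht)) (by rw [hy0, sub_self]) fun t ht => ?_
    simp only [hG]
    set e := Y t - y t with he
    rcases le_or_gt ‖e‖ δ with hle | hlt
    · rw [radialRetract_of_le hδ hle]
      exact h t ht e hle
    · have h1 := h t ht _ (norm_radialRetract_le hδ e)
      have hz : radialRetract δ e = (δ / ‖e‖) • e := by rw [radialRetract, max_eq_right hlt.le]
      have he0 : 0 < ‖e‖ := hδ.trans hlt
      have hn : ‖radialRetract δ e‖ = δ := by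
        rw [hz, norm_smul, Real.norm_of_nonneg (by positivity)]
        field_simp
      rw [hn] at h1
      set v := Y' t - F (Y t - radialRetract δ e)
      rw [hz, real_inner_smul_right] at h1
      have h2 : inner ℝ v e ≤ C * (ε * ‖e‖ + δ * ‖e‖) := by
        have h3 := mul_le_mul_of_nonneg_left h1 (show 0 ≤ ‖e‖ / δ by positivity)
        calc inner ℝ v e = ‖e‖ / δ * (δ / ‖e‖ * inner ℝ v e) := by field_simp
          _ ≤ _ := h3
          _ = _ := by field_simp
      refine h2.trans (mul_le_mul_of_nonneg_left ?_ hC)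
      nlinarith
  refine ⟨y, hy0, fun t ht => ?_, herr⟩
  have h1 := hy t ht
  simp only [hG] at h1
  rwa [radialRetract_of_le hδ ((herr t ht).trans hεδ), sub_sub_cancel] at h1

end Euclidean

/-- A curve in a finite-dimensional space is differentiable as soon as it is so under all linear
functionals. -/
theorem hasDerivWithinAt_iff_forall_linear {E : Type*} [NormedAddCommGroup E] [NormedSpace ℝ E]
    [FiniteDimensional ℝ E] {y : ℝ → E} {v : E} {s : Set ℝ} {t : ℝ} :
    HasDerivWithinAt y v s t ↔
      ∀ l : E →ₗ[ℝ] ℝ, HasDerivWithinAt (fun τ => l (y τ)) (l v) s t := by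
  constructor
  · intro h l
    exact (LinearMap.toContinuousLinearMap l).hasFDerivAt.comp_hasDerivWithinAt t h
  · intro h
    let b := Module.finBasis ℝ E
    have h1 : HasDerivWithinAt (fun τ => ∑ i, b.coord i (y τ) • b i) (∑ i, b.coord i v • b i) s t :=
      HasDerivWithinAt.fun_sum fun i _ => (h (b.coord i)).smul_const (b i)
    have h2 : ∀ w, ∑ i, b.coord i w • b i = w := fun w => b.sum_repr w
    simpa only [h2] using h1

/-- The result on `y' = F(y)` near an approximate solution, for an equation in weak form
`B(y', w) = L(y)(w) + Q(y,y)(w)` on a finite-dimensional space with inner product `B`, together with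
uniqueness. Here `D t w` is the derivative of `B(Y, w)`. The space carries no norm beforehand, so
differentiability of a curve is expressed through linear functionals; this lets the norm in the
estimates be the one of `B`. -/
theorem exists_weak_solution_near {V : Type*} [AddCommGroup V] [Module ℝ V]
    [FiniteDimensional ℝ V] (B : V →ₗ[ℝ] V →ₗ[ℝ] ℝ) (hBs : ∀ v w, B v w = B w v)
    (hBp : ∀ v, 0 ≤ B v v) (hBd : ∀ v, B v v = 0 → v = 0) (L : V →ₗ[ℝ] V →ₗ[ℝ] ℝ)
    (Q : V →ₗ[ℝ] V →ₗ[ℝ] V →ₗ[ℝ] ℝ) {T δ C ε : ℝ} (hT : 0 < T) (hδ : 0 < δ) (hC : 0 ≤ C)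
    (hε : 0 ≤ ε) {Y : ℝ → V} {D : ℝ → V → ℝ}
    (hY : ∀ t ∈ Icc 0 T, ∀ w, HasDerivWithinAt (fun s => B (Y s) w) (D t w) (Icc 0 T) t)
    (h : ∀ t ∈ Icc 0 T, ∀ z r, 0 ≤ r → r ^ 2 = B z z → r ≤ δ →
      D t z - (L (Y t - z) z + Q (Y t - z) (Y t - z) z) ≤ C * (ε * r + r ^ 2))
    (hεδ : ε * Real.exp (2 * C * T) ≤ δ) :
    (∃ y y' : ℝ → V, y 0 = Y 0 ∧
      (∀ t ∈ Icc 0 T, (∀ l : V →ₗ[ℝ] ℝ,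
          HasDerivWithinAt (fun s => l (y s)) (l (y' t)) (Icc 0 T) t) ∧
        ∀ w, B (y' t) w = L (y t) w + Q (y t) (y t) w) ∧
      ∀ t ∈ Icc 0 T, B (Y t - y t) (Y t - y t) ≤ (ε * Real.exp (2 * C * T)) ^ 2) ∧
    ∀ y z y' z' : ℝ → V, y 0 = z 0 →
      (∀ t ∈ Icc 0 T, (∀ l : V →ₗ[ℝ] ℝ,
          HasDerivWithinAt (fun s => l (y s)) (l (y' t)) (Icc 0 T) t) ∧
        ∀ w, B (y' t) w = L (y t) w + Q (y t) (y t) w) →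
      (∀ t ∈ Icc 0 T, (∀ l : V →ₗ[ℝ] ℝ,
          HasDerivWithinAt (fun s => l (z s)) (l (z' t)) (Icc 0 T) t) ∧
        ∀ w, B (z' t) w = L (z t) w + Q (z t) (z t) w) →
      EqOn y z (Icc 0 T) := by
  let core : InnerProductSpace.Core ℝ V :=
    { inner := fun v w => B v w
      conj_inner_symm := fun v w => hBs w v
      re_inner_nonneg := hBp
      add_left := fun u v w => by simp
      smul_left := fun v w r => by simp
      definite := hBd }
  let : NormedAddCommGroup V := core.toNormedAddCommGroup
  let : InnerProductSpace ℝ V := InnerProductSpace.ofCore core.toCore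
  have hinner : ∀ v w : V, inner ℝ v w = B v w := fun _ _ => rfl
  have hinj : Function.Injective B := by
    rw [injective_iff_map_eq_zero]
    intro v hv
    exact hBd v (by rw [hv]; rfl)
  have hsurj := (LinearMap.injective_iff_surjective_of_finrank_eq_finrank
    (f := B) (Subspace.dual_finrank_eq (K := ℝ) (V := V)).symm).1 hinj
  let R : Module.Dual ℝ V →ₗ[ℝ] V := (LinearEquiv.ofBijective B ⟨hinj, hsurj⟩).symm.toLinearMap
  have hR : ∀ l w, B (R l) w = l w := fun l w => by
    have : B (R l) = l := (LinearEquiv.ofBijective B ⟨hinj, hsurj⟩).apply_symm_apply l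
    rw [this]
  let F₁ : V →ₗ[ℝ] V := R ∘ₗ L
  let F₂ : V →ₗ[ℝ] V →ₗ[ℝ] V := Q.compr₂ R
  let F : V → V := fun y => F₁ y + F₂ y y
  have hFB : ∀ y w, B (F y) w = L y w + Q y y w := fun y w => by
    change B (R (L y) + R (Q y y)) w = _
    rw [map_add, LinearMap.add_apply, hR, hR]
  have hF : ContDiff ℝ 1 F := by
    have h1 : ContDiff ℝ 1 fun y => F₁ y := (LinearMap.toContinuousLinearMap F₁).contDiff
    have h2 : ContDiff ℝ 1 fun y => F₂.toContinuousBilinearMap y y :=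
      F₂.toContinuousBilinearMap.contDiff.clm_apply contDiff_id
    exact h1.add h2
  have hsol : ∀ {y y' : ℝ → V}, (∀ t ∈ Icc 0 T, (∀ l : V →ₗ[ℝ] ℝ,
          HasDerivWithinAt (fun s => l (y s)) (l (y' t)) (Icc 0 T) t) ∧
        ∀ w, B (y' t) w = L (y t) w + Q (y t) (y t) w) →
      ∀ t ∈ Icc 0 T, HasDerivWithinAt y (F (y t)) (Icc 0 T) t := by
    intro y y' hy t ht
    have h1 : F (y t) = y' t := hinj (LinearMap.ext fun w => by rw [hFB, (hy t ht).2])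
    rw [h1]
    exact hasDerivWithinAt_iff_forall_linear.2 (hy t ht).1
  refine ⟨?_, fun y z y' z' h0 hy hz => ode_unique hF (hsol hy) (hsol hz) h0⟩
  let b := stdOrthonormalBasis ℝ V
  let Y' : ℝ → V := fun t => ∑ i, D t (b i) • b i
  have hY' : ∀ t ∈ Icc 0 T, HasDerivWithinAt Y (Y' t) (Icc 0 T) t := by
    intro t ht
    have h1 : HasDerivWithinAt (fun s => ∑ i, B (Y s) (b i) • b i) (Y' t) (Icc 0 T) t :=
      HasDerivWithinAt.fun_sum fun i _ => (hY t ht (b i)).smul_const (b i)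
    have h2 : ∀ s, ∑ i, B (Y s) (b i) • b i = Y s := fun s => by
      have := b.sum_repr' (Y s)
      simp only [hinner] at this
      simpa only [hBs (Y s)] using this
    simpa only [h2] using h1
  have hYD : ∀ t ∈ Icc 0 T, ∀ w, B (Y' t) w = D t w := fun t ht w =>
    (uniqueDiffOn_Icc hT t ht).eq_deriv _
      (hasDerivWithinAt_iff_forall_linear.1 (hY' t ht) (B.flip w)) (hY t ht w)
  obtain ⟨y, hy0, hy, hyb⟩ := exists_ode_solution_near hF hT.le hδ hC hε hY' (fun t ht z hz => by
    rw [hinner, map_sub, LinearMap.sub_apply, hYD t ht, hFB]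
    exact h t ht z ‖z‖ (norm_nonneg z) (by rw [← hinner, real_inner_self_eq_norm_sq]) hz) hεδ
  refine ⟨y, fun t => F (y t), hy0, fun t ht =>
    ⟨hasDerivWithinAt_iff_forall_linear.1 (hy t ht), hFB _⟩, fun t ht => ?_⟩
  rw [← hinner, real_inner_self_eq_norm_sq]
  exact pow_le_pow_left₀ (norm_nonneg _) (hyb t ht) 2

/-! ### The energy estimate -/

theorem normL2_mul_le {f g : ℝ → ℝ} (hf : C1 f) (hg : ContinuousOn g (Icc 0 1)) :
    normL2 (fun x => f x * g x) ≤ n1 f * normL2 g :=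
  normL2_le_mul (n1_nonneg f) (hf.continuousOn.fun_mul hg) hg fun x hx => by
    rw [abs_mul]
    exact mul_le_mul_of_nonneg_right (abs_le_n1 hf hx) (abs_nonneg _)

theorem normL2_dx_mul_le {f g : ℝ → ℝ} (hf : C1 f) (hg : C1 g) :
    normL2 (dx fun x => f x * g x) ≤ 2 * n1 f * n1 g := by
  rw [normL2_congr (hf.dx_mul hg)]
  have h1 := normL2_add_le (hf.continuousOn_dx.fun_mul hg.continuousOn)
    (hf.continuousOn.fun_mul hg.continuousOn_dx)
  have h2 := normL2_mul_le hg hf.continuousOn_dx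
  simp only [mul_comm (g _)] at h2
  have h3 := normL2_mul_le hf hg.continuousOn_dx
  have h4 := mul_le_mul_of_nonneg_left (normL2_dx_le_n1 f) (n1_nonneg g)
  have h5 := mul_le_mul_of_nonneg_left (normL2_dx_le_n1 g) (n1_nonneg f)
  linarith

theorem n1_add_le {f g : ℝ → ℝ} (hf : C1 f) (hg : C1 g) :
    n1 (fun x => f x + g x) ≤ n1 f + n1 g := by
  have h1 := normL2_add_le hf.continuousOn hg.continuousOn
  have h2 := normL2_add_le hf.continuousOn_dx hg.continuousOn_dx
  rw [← normL2_congr (hf.dx_add hg)] at h2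
  rw [n1, n1, n1]
  linarith

theorem n1_sub_le {f g : ℝ → ℝ} (hf : C1 f) (hg : C1 g) :
    n1 (fun x => f x - g x) ≤ n1 f + n1 g := by
  have h1 := normL2_sub_le hf.continuousOn hg.continuousOn
  have h2 := normL2_sub_le hf.continuousOn_dx hg.continuousOn_dx
  rw [← normL2_congr (hf.dx_sub hg)] at h2
  rw [n1, n1, n1]
  linarith

theorem abs_ip_le_mul {f g : ℝ → ℝ} {A r : ℝ} (hf : ContinuousOn f (Icc 0 1))
    (hg : ContinuousOn g (Icc 0 1)) (hA : normL2 f ≤ A) (hr : normL2 g ≤ r) :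
    |ip f g| ≤ A * r :=
  (abs_ip_le hf hg).trans (mul_le_mul hA hr (normL2_nonneg _) ((normL2_nonneg _).trans hA))

/-- The spatial part of the weak form of the systems, tested with `(φ,χ)`:
`-(u_x + α (ηu)_x, φ) - (η_x + β u u_x + γ η η_x, χ)`. -/
noncomputable def weakForm (α β γ : ℝ) (η u φ χ : ℝ → ℝ) : ℝ :=
  -(ip (dx u) φ + α * ip (dx fun x => η x * u x) φ) -
    (ip (dx η) χ + β * ip (fun x => u x * dx u x) χ + γ * ip (fun x => η x * dx η x) χ)

/-- `((θ v)', θ) = (θ v', θ) / 2` when `v` vanishes at the end points. -/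
theorem ip_dx_mul_self {θ v : ℝ → ℝ} (hθ : C1 θ) (hv : C1 v) (h0 : v 0 = 0) (h1 : v 1 = 0) :
    ip (dx fun x => θ x * v x) θ = 1 / 2 * ip (fun x => θ x * dx v x) θ := by
  have e1 := ip_dx_left (hθ.mul hv) hθ
  have e2 : ip (dx fun x => θ x * v x) θ =
      ip (fun x => dx θ x * v x) θ + ip (fun x => θ x * dx v x) θ := by
    rw [ip_congr (hθ.dx_mul hv) (fun _ _ => rfl)]
    exact ip_add_left (hθ.continuousOn_dx.fun_mul hv.continuousOn)
      (hθ.continuousOn.fun_mul hv.continuousOn_dx) hθ.continuousOn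
  have e3 : ip (fun x => dx θ x * v x) θ = ip (fun x => θ x * v x) (dx θ) := by
    simp only [ip]
    congr 1; ext x; ring
  simp only [h0, h1, mul_zero, zero_mul, sub_zero, zero_sub] at e1
  linarith

/-- The part of the error in `(ηu)_x` that contains the product of `θ` with the full discrete
velocity, whose derivative is only controlled through the inverse inequality. -/
theorem abs_ip_dx_mul_self_le {θ u v : ℝ → ℝ} {A h r E : ℝ} (hθ : C1 θ) (hu : C1 u)
    (hv : C1 v) (h0 : v 0 = 0) (h1 : v 1 = 0) (hA : 0 ≤ A) (hh : 0 < h) (hθr : normL2 θ ≤ r)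
    (hinv : h * n1 θ ≤ A * normL2 θ) (hux : ∀ x ∈ Icc (0 : ℝ) 1, |dx u x| ≤ A)
    (he : n1 (fun x => u x - v x) ≤ E * h) :
    |ip (dx fun x => θ x * v x) θ| ≤ (A + A * E) * r ^ 2 := by
  have hr : 0 ≤ r := (normL2_nonneg _).trans hθr
  have hE : 0 ≤ E := by
    by_contra! hcon
    have := (n1_nonneg _).trans he
    nlinarith
  have hue := hu.sub hv
  have e1 : ip (fun x => θ x * dx v x) θ = ip (fun x => dx u x * θ x) θ -
      ip (fun x => θ x * dx (fun x => u x - v x) x) θ := by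
    rw [← ip_sub_left (hu.continuousOn_dx.fun_mul hθ.continuousOn)
      (hθ.continuousOn.fun_mul hue.continuousOn_dx) hθ.continuousOn]
    refine ip_congr (fun x hx => ?_) fun _ _ => rfl
    simp only [hu.dx_sub hv hx]
    ring
  have b1 : |ip (fun x => dx u x * θ x) θ| ≤ A * r * r := by
    refine abs_ip_le_mul (hu.continuousOn_dx.fun_mul hθ.continuousOn) hθ.continuousOn ?_ hθr
    refine (normL2_le_mul hA (hu.continuousOn_dx.fun_mul hθ.continuousOn) hθ.continuousOn
      fun x hx => ?_).trans (mul_le_mul_of_nonneg_left hθr hA)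
    rw [abs_mul]
    exact mul_le_mul_of_nonneg_right (hux x hx) (abs_nonneg _)
  have b2 : |ip (fun x => θ x * dx (fun x => u x - v x) x) θ| ≤ A * E * r * r := by
    refine abs_ip_le_mul (hθ.continuousOn.fun_mul hue.continuousOn_dx) hθ.continuousOn ?_ hθr
    refine (normL2_mul_le hθ hue.continuousOn_dx).trans ?_
    calc _ ≤ n1 θ * (E * h) := by
          gcongr
          · exact n1_nonneg _
          · exact (normL2_dx_le_n1 _).trans he
      _ = E * (h * n1 θ) := by ring
      _ ≤ E * (A * normL2 θ) := by gcongr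
      _ ≤ E * (A * r) := by gcongr
      _ = _ := by ring
  rw [ip_dx_mul_self hθ hv h0 h1, e1, abs_mul, abs_of_pos (by norm_num : (0 : ℝ) < 1 / 2)]
  have := abs_sub (ip (fun x => dx u x * θ x) θ) (ip (fun x => θ x * dx (fun x => u x - v x) x) θ)
  have h3 : 0 ≤ (A + A * E) * r ^ 2 := by positivity
  nlinarith

/-- The energy estimate. Here `(P, R)` are the projections of `(η, u)`, and `(P - θ, R - ξ)` is a
perturbation of them by splines of size at most `r ≤ h`, for which the inverse inequality makes `θ`
bounded in `H¹`. -/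
theorem weakForm_sub_le {α β γ A h r : ℝ} {η u P R θ ξ : ℝ → ℝ} (hη : C1 η) (hu : C1 u)
    (hP : C1 P) (hR : C1 R) (hθ : C1 θ) (hξ : C1 ξ) (hR0 : R 0 = 0) (hR1 : R 1 = 0)
    (hξ0 : ξ 0 = 0) (hξ1 : ξ 1 = 0) (hA : 1 ≤ A) (hh : 0 < h) (hh1 : h ≤ 1)
    (hηb : ∀ x ∈ Icc (0 : ℝ) 1, |η x| ≤ A) (hηn : n1 η ≤ 2 * A) (hun : n1 u ≤ 2 * A)
    (hux : ∀ x ∈ Icc (0 : ℝ) 1, |dx u x| ≤ A)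
    (hρ : n1 (fun x => η x - P x) ≤ A * h ^ 3) (hσ : n1 (fun x => u x - R x) ≤ A * h ^ 3)
    (hinv : h * n1 θ ≤ A * normL2 θ) (hθr : normL2 θ ≤ r) (hξr : n1 ξ ≤ 3 * r) (hrh : r ≤ h) :
    weakForm α β γ η u θ ξ - weakForm α β γ (fun x => P x - θ x) (fun x => R x - ξ x) θ ξ ≤
      100 * A ^ 2 * (1 + |α| + |β| + |γ|) * (h ^ 3 * r + r ^ 2) := by
  have hr : 0 ≤ r := (normL2_nonneg _).trans hθr
  have hA0 : 0 ≤ A := zero_le_one.trans hA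
  set ηh : ℝ → ℝ := fun x => P x - θ x with hηh
  set uh : ℝ → ℝ := fun x => R x - ξ x with huh
  set ρ : ℝ → ℝ := fun x => η x - P x with hρ'
  set e₁ : ℝ → ℝ := fun x => η x - ηh x with he₁
  set e₂ : ℝ → ℝ := fun x => u x - uh x with he₂
  have hηhC : C1 ηh := hP.sub hθ
  have huhC : C1 uh := hR.sub hξ
  have hρC : C1 ρ := hη.sub hP
  have he₁C : C1 e₁ := hη.sub hηhC
  have he₂C : C1 e₂ := hu.sub huhC
  have huh0 : uh 0 = 0 := by simp [huh, hR0, hξ0]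
  have huh1 : uh 1 = 0 := by simp [huh, hR1, hξ1]
  set E := h ^ 3 + r with hE
  have hh3 : h ^ 3 ≤ h := by
    calc h ^ 3 ≤ h ^ 1 := pow_le_pow_of_le_one hh.le hh1 (by norm_num)
      _ = h := pow_one h
  have hh3' : 0 < h ^ 3 := by positivity
  have hE0 : 0 ≤ E := by positivity
  have hE2 : E ≤ 2 * h := by linarith
  have hrE : r ≤ E := by linarith
  have hAr : 1 * r ≤ A * r := mul_le_mul_of_nonneg_right hA hr
  have hAh : 0 ≤ A * h ^ 3 := by positivity
  have hAh1 : A * h ^ 3 ≤ A := mul_le_of_le_one_right hA0 (hh3.trans hh1)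
  have hAE : A * E ≤ A * 2 := mul_le_mul_of_nonneg_left (by linarith) hA0
  have hn₂ : n1 e₂ ≤ 3 * A * E := by
    have h1 : e₂ = fun x => (u x - R x) + ξ x := by ext x; simp only [he₂, huh]; ring
    rw [h1]
    refine (n1_add_le (hu.sub hR) hξ).trans ?_
    rw [hE]
    linarith
  have hn₁ : normL2 e₁ ≤ A * E := by
    have h1 : e₁ = fun x => ρ x + θ x := by ext x; simp only [he₁, hηh, hρ']; ring
    rw [h1]
    refine (normL2_add_le hρC.continuousOn hθ.continuousOn).trans ?_
    have := normL2_le_n1 ρ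
    rw [hE]
    linarith
  have hn1θ : n1 θ ≤ A := by
    have : h * n1 θ ≤ h * A := hinv.trans (by
      rw [mul_comm h]
      exact mul_le_mul_of_nonneg_left (hθr.trans hrh) hA0)
    exact le_of_mul_le_mul_left this hh
  have hξL : normL2 ξ ≤ 3 * r := (normL2_le_n1 ξ).trans hξr
  have hξd : normL2 (dx ξ) ≤ 3 * r := (normL2_dx_le_n1 ξ).trans hξr
  have hnP : n1 P ≤ 3 * A := by
    have h1 : P = fun x => η x - ρ x := by ext x; simp only [hρ']; ring
    rw [h1]
    refine (n1_sub_le hη hρC).trans ?_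
    linarith
  have hnuh : n1 uh ≤ 8 * A := by
    have h1 : uh = fun x => u x - e₂ x := by ext x; simp only [he₂]; ring
    rw [h1]
    refine (n1_sub_le hu he₂C).trans ?_
    linarith
  set X := E * r with hX
  have hX0 : 0 ≤ X := mul_nonneg hE0 hr
  have hrX : r ^ 2 ≤ X := by rw [hX, sq]; exact mul_le_mul_of_nonneg_right hrE hr
  have hAA : A ≤ A ^ 2 := by nlinarith
  have hAX' : A * X ≤ A ^ 2 * X := mul_le_mul_of_nonneg_right hAA hX0
  have t1 : |ip (dx uh) θ - ip (dx u) θ| ≤ 3 * A ^ 2 * X := by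
    have e : ip (dx u) θ - ip (dx uh) θ = ip (dx e₂) θ := by
      rw [← ip_sub_left hu.continuousOn_dx huhC.continuousOn_dx hθ.continuousOn]
      exact ip_congr (fun x hx => (hu.dx_sub huhC hx).symm) fun _ _ => rfl
    rw [abs_sub_comm, e]
    refine (abs_ip_le_mul he₂C.continuousOn_dx hθ.continuousOn
      ((normL2_dx_le_n1 _).trans hn₂) hθr).trans ?_
    calc 3 * A * E * r = 3 * (A * X) := by rw [hX]; ring
      _ ≤ _ := by linarith
  -- `ηu - ηh uh = P (u - uh) + (η - P) u + θ uh`: only the last term has a derivative of `θ`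
  have t2 : |ip (dx fun x => ηh x * uh x) θ - ip (dx fun x => η x * u x) θ| ≤ 29 * A ^ 2 * X := by
    have hPe := hP.mul he₂C
    have hρu := hρC.mul hu
    have hθu := hθ.mul huhC
    have e0 : (fun x => η x * u x) =
        fun x => ((P x * e₂ x + ρ x * u x) + θ x * uh x) + ηh x * uh x := by
      ext x; simp only [he₂, hρ', hηh]; ring
    have e : ip (dx fun x => η x * u x) θ = ((ip (dx fun x => P x * e₂ x) θ +
        ip (dx fun x => ρ x * u x) θ) + ip (dx fun x => θ x * uh x) θ) +
        ip (dx fun x => ηh x * uh x) θ := by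
      have hc := hθ.continuousOn
      have hηu := hηhC.mul huhC
      rw [e0, ip_congr (((hPe.add hρu).add hθu).dx_add hηu) (fun _ _ => rfl),
        ip_add_left ((hPe.add hρu).add hθu).continuousOn_dx hηu.continuousOn_dx hc,
        ip_congr ((hPe.add hρu).dx_add hθu) (fun _ _ => rfl),
        ip_add_left (hPe.add hρu).continuousOn_dx hθu.continuousOn_dx hc,
        ip_congr (hPe.dx_add hρu) (fun _ _ => rfl),
        ip_add_left hPe.continuousOn_dx hρu.continuousOn_dx hc]
    have b1 : |ip (dx fun x => P x * e₂ x) θ| ≤ 2 * (3 * A) * (3 * A * E) * r := by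
      refine abs_ip_le_mul hPe.continuousOn_dx hθ.continuousOn ?_ hθr
      refine (normL2_dx_mul_le hP he₂C).trans ?_
      gcongr
      exact n1_nonneg _
    have b2 : |ip (dx fun x => ρ x * u x) θ| ≤ 2 * (A * E) * (2 * A) * r := by
      refine abs_ip_le_mul hρu.continuousOn_dx hθ.continuousOn ?_ hθr
      refine (normL2_dx_mul_le hρC hu).trans ?_
      gcongr
      · exact n1_nonneg _
      · refine hρ.trans ?_
        gcongr
        linarith
    have b3 : |ip (dx fun x => θ x * uh x) θ| ≤ (A + A * (6 * A)) * r ^ 2 := by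
      refine abs_ip_dx_mul_self_le hθ hu huhC huh0 huh1 hA0 hh hθr hinv hux (hn₂.trans ?_)
      calc 3 * A * E ≤ 3 * A * (2 * h) := by gcongr
        _ = _ := by ring
    rw [abs_le] at b1 b2 b3 ⊢
    have h1 : (A + A * (6 * A)) * r ^ 2 ≤ 7 * A ^ 2 * X := by
      calc _ ≤ (7 * A ^ 2) * r ^ 2 := by gcongr; linarith
        _ ≤ _ := by gcongr
    have h2 : 2 * (3 * A) * (3 * A * E) * r = 18 * A ^ 2 * X := by rw [hX]; ring
    have h3 : 2 * (A * E) * (2 * A) * r = 4 * A ^ 2 * X := by rw [hX]; ring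
    rw [h2] at b1
    rw [h3] at b2
    constructor <;> linarith [b1.1, b1.2, b2.1, b2.2, b3.1, b3.2]
  -- `e₁` is small in `L²` only, so its derivative is moved onto `ξ`, which vanishes at the ends
  have t3 : |ip (dx ηh) ξ - ip (dx η) ξ| ≤ 3 * A ^ 2 * X := by
    have e : ip (dx η) ξ - ip (dx ηh) ξ = - ip e₁ (dx ξ) := by
      rw [← ip_sub_left hη.continuousOn_dx hηhC.continuousOn_dx hξ.continuousOn]
      have e' := ip_dx_left he₁C hξ
      rw [hξ0, hξ1, mul_zero, mul_zero, sub_zero, zero_sub] at e'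
      rw [← e']
      exact ip_congr (fun x hx => (hη.dx_sub hηhC hx).symm) fun _ _ => rfl
    rw [abs_sub_comm, e, abs_neg]
    refine (abs_ip_le_mul he₁C.continuousOn hξ.continuousOn_dx hn₁ hξd).trans ?_
    calc A * E * (3 * r) = 3 * (A * X) := by rw [hX]; ring
      _ ≤ _ := by linarith
  have t4 : |ip (fun x => uh x * dx uh x) ξ - ip (fun x => u x * dx u x) ξ| ≤ 90 * A ^ 2 * X := by
    have c1 := hu.continuousOn.fun_mul he₂C.continuousOn_dx
    have c2 := he₂C.continuousOn.fun_mul huhC.continuousOn_dx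
    have c3 := huhC.continuousOn.fun_mul huhC.continuousOn_dx
    have e : ip (fun x => u x * dx u x) ξ - ip (fun x => uh x * dx uh x) ξ =
        ip (fun x => u x * dx e₂ x + e₂ x * dx uh x) ξ := by
      rw [← ip_sub_left (hu.continuousOn.fun_mul hu.continuousOn_dx) c3 hξ.continuousOn]
      refine ip_congr (fun x hx => ?_) fun _ _ => rfl
      have := hu.dx_sub huhC hx
      simp only at this
      simp only [he₂, this]
      ring
    rw [abs_sub_comm, e]
    have b : |ip (fun x => u x * dx e₂ x + e₂ x * dx uh x) ξ| ≤
        (2 * A * (3 * A * E) + 3 * A * E * (8 * A)) * (3 * r) := by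
      refine abs_ip_le_mul (c1.fun_add c2) hξ.continuousOn ?_ hξL
      refine (normL2_add_le c1 c2).trans (add_le_add ?_ ?_)
      · refine (normL2_mul_le hu he₂C.continuousOn_dx).trans ?_
        gcongr
        · exact normL2_nonneg _
        · exact (normL2_dx_le_n1 _).trans hn₂
      · refine (normL2_mul_le he₂C huhC.continuousOn_dx).trans ?_
        gcongr
        · exact normL2_nonneg _
        · exact (normL2_dx_le_n1 _).trans hnuh
    refine b.trans_eq ?_
    rw [hX]; ring
  -- `ηη_x - ηh ηh_x = ((η + ηh) e₁)_x / 2`, and again the derivative is moved onto `ξ`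
  have t5 : |ip (fun x => ηh x * dx ηh x) ξ - ip (fun x => η x * dx η x) ξ| ≤ 6 * A ^ 2 * X := by
    have hS : C1 (fun x => η x + ηh x) := hη.add hηhC
    have hprod := he₁C.mul hS
    have e : ip (fun x => η x * dx η x) ξ - ip (fun x => ηh x * dx ηh x) ξ =
        -(1 / 2) * ip (fun x => (η x + ηh x) * e₁ x) (dx ξ) := by
      have e' := ip_dx_left hprod hξ
      rw [hξ0, hξ1, mul_zero, mul_zero, sub_zero, zero_sub] at e'
      rw [← ip_sub_left (hη.continuousOn.fun_mul hη.continuousOn_dx)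
        (hηhC.continuousOn.fun_mul hηhC.continuousOn_dx) hξ.continuousOn]
      have e'' : ip (fun x => η x * dx η x - ηh x * dx ηh x) ξ =
          ip (fun x => 1 / 2 * dx (fun x => e₁ x * (η x + ηh x)) x) ξ := by
        refine ip_congr (fun x hx => ?_) fun _ _ => rfl
        simp only [he₁C.dx_mul hS hx, hη.dx_add hηhC hx]
        have := hη.dx_sub hηhC hx
        simp only at this
        simp only [he₁, this]
        ring
      rw [e'', ip_const_mul_left, e']
      simp only [mul_comm (e₁ _)]
      ring
    rw [abs_sub_comm, e, abs_mul]
    have b : |ip (fun x => (η x + ηh x) * e₁ x) (dx ξ)| ≤ (4 * A * (A * E)) * (3 * r) := by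
      have hc := hS.continuousOn.fun_mul he₁C.continuousOn
      refine abs_ip_le_mul hc hξ.continuousOn_dx ?_ hξd
      refine (normL2_le_mul (by positivity) hc he₁C.continuousOn (B := 4 * A) fun x hx => ?_).trans
        (by gcongr)
      rw [abs_mul]
      refine mul_le_mul_of_nonneg_right ?_ (abs_nonneg _)
      have h1 := hηb x hx
      have h2 := (abs_le_n1 hρC hx).trans hρ
      have h3 := (abs_le_n1 hθ hx).trans hn1θ
      rw [abs_le] at h1 h2 h3 ⊢
      have h5 : η x + ηh x = 2 * η x - ρ x - θ x := by simp only [hηh, hρ']; ring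
      rw [h5]
      constructor <;> linarith [h1.1, h1.2, h2.1, h2.2, h3.1, h3.2]
    rw [show |(-(1 / 2) : ℝ)| = 1 / 2 by norm_num [abs_of_neg]]
    have h6 : (4 * A * (A * E)) * (3 * r) = 12 * A ^ 2 * X := by rw [hX]; ring
    rw [h6] at b
    linarith
  have hsum : h ^ 3 * r + r ^ 2 = X := by rw [hX, hE]; ring
  rw [hsum]
  have expand : weakForm α β γ η u θ ξ - weakForm α β γ ηh uh θ ξ =
      (ip (dx uh) θ - ip (dx u) θ) +
      α * (ip (dx fun x => ηh x * uh x) θ - ip (dx fun x => η x * u x) θ) +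
      (ip (dx ηh) ξ - ip (dx η) ξ) +
      β * (ip (fun x => uh x * dx uh x) ξ - ip (fun x => u x * dx u x) ξ) +
      γ * (ip (fun x => ηh x * dx ηh x) ξ - ip (fun x => η x * dx η x) ξ) := by
    rw [weakForm, weakForm]; ring
  rw [expand]
  have hmul : ∀ (c : ℝ) {y B : ℝ}, |y| ≤ B → c * y ≤ |c| * B := fun c y B hy =>
    (le_abs_self _).trans (by rw [abs_mul]; exact mul_le_mul_of_nonneg_left hy (abs_nonneg c))
  have s1 := (le_abs_self _).trans t1
  have s2 := hmul α t2
  have s3 := (le_abs_self _).trans t3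
  have s4 := hmul β t4
  have s5 := hmul γ t5
  have hAX : 0 ≤ A ^ 2 * X := mul_nonneg (sq_nonneg A) hX0
  have p1 := mul_nonneg (abs_nonneg α) hAX
  have p2 := mul_nonneg (abs_nonneg β) hAX
  have p3 := mul_nonneg (abs_nonneg γ) hAX
  linarith

/-! ### The semidiscretization in weak form -/

/-- The `C¹` functions on `[0,1]` as a vector space. -/
def c1Submodule : Submodule ℝ (ℝ → ℝ) where
  carrier := {f | C1 f}
  add_mem' hf hg := C1.add hf hg
  zero_mem' := contDiffOn_const
  smul_mem' c _ hf := C1.const_mul hf c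

theorem c1_coe (f : c1Submodule) : C1 f := f.2

theorem cont_coe (f : c1Submodule) : ContinuousOn (f : ℝ → ℝ) (Icc 0 1) :=
  (c1_coe f).continuousOn

theorem cont_dx_coe (f : c1Submodule) : ContinuousOn (dx f) (Icc 0 1) := C1.continuousOn_dx f.2

theorem dx_coe_add (f g : c1Submodule) :
    EqOn (dx (f + g : c1Submodule)) (fun x => dx f x + dx g x) (Icc 0 1) :=
  (c1_coe f).dx_add (c1_coe g)

theorem dx_coe_smul (c : ℝ) (f : c1Submodule) :
    EqOn (dx (c • f : c1Submodule)) (fun x => c * dx f x) (Icc 0 1) :=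
  (c1_coe f).dx_const_mul c

/-- The bilinear form `(f', k)`. -/
noncomputable def dxForm : c1Submodule →ₗ[ℝ] c1Submodule →ₗ[ℝ] ℝ :=
  LinearMap.mk₂ ℝ (fun f k => ip (dx f) k)
    (fun f g k => by
      rw [ip_congr (dx_coe_add f g) (fun _ _ => rfl)]
      exact ip_add_left (cont_dx_coe f) (cont_dx_coe g) (cont_coe k))
    (fun c f k => by
      rw [ip_congr (dx_coe_smul c f) (fun _ _ => rfl)]
      exact ip_const_mul_left c _ _)
    (fun f k k' => ip_add_right (cont_coe k) (cont_coe k') (cont_dx_coe f))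
    (fun c _ k => ip_const_mul_right c k _)

/-- The trilinear form `(f g', k)`. -/
noncomputable def convectionForm :
    c1Submodule →ₗ[ℝ] c1Submodule →ₗ[ℝ] c1Submodule →ₗ[ℝ] ℝ :=
  LinearMap.mk₂ ℝ (fun f g =>
    { toFun := fun k => ip (fun x => (f : ℝ → ℝ) x * dx g x) k
      map_add' := fun k k' => ip_add_right (cont_coe k) (cont_coe k')
        ((cont_coe f).fun_mul (cont_dx_coe g))
      map_smul' := fun c k => ip_const_mul_right c k _ })
    (fun f f' g => LinearMap.ext fun k => by
      change ip (fun x => ((f : ℝ → ℝ) x + (f' : ℝ → ℝ) x) * dx g x) k =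
        ip (fun x => (f : ℝ → ℝ) x * dx g x) k + ip (fun x => (f' : ℝ → ℝ) x * dx g x) k
      rw [← ip_add_left ((cont_coe f).fun_mul (cont_dx_coe g))
        ((cont_coe f').fun_mul (cont_dx_coe g)) (cont_coe k)]
      simp only [add_mul])
    (fun c f g => LinearMap.ext fun k => by
      change ip (fun x => (c * (f : ℝ → ℝ) x) * dx g x) k =
        c * ip (fun x => (f : ℝ → ℝ) x * dx g x) k
      rw [← ip_const_mul_left]
      simp only [mul_assoc])
    (fun f g g' => LinearMap.ext fun k => by
      change ip (fun x => (f : ℝ → ℝ) x * dx (g + g' : c1Submodule) x) k =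
        ip (fun x => (f : ℝ → ℝ) x * dx g x) k + ip (fun x => (f : ℝ → ℝ) x * dx g' x) k
      rw [← ip_add_left ((cont_coe f).fun_mul (cont_dx_coe g))
        ((cont_coe f).fun_mul (cont_dx_coe g')) (cont_coe k)]
      refine ip_congr (fun x hx => ?_) fun _ _ => rfl
      simp only [dx_coe_add g g' hx, mul_add])
    (fun c f g => LinearMap.ext fun k => by
      change ip (fun x => (f : ℝ → ℝ) x * dx (c • g : c1Submodule) x) k =
        c * ip (fun x => (f : ℝ → ℝ) x * dx g x) k
      rw [← ip_const_mul_left]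
      refine ip_congr (fun x hx => ?_) fun _ _ => rfl
      simp only [dx_coe_smul c g hx]
      ring)

namespace Mesh

variable {N : ℕ} (m : Mesh N)

/-- The space of pairs `(η_h, u_h)`. -/
abbrev Pair : Type := m.splines × m.splines0

/-- The first component of a pair, as a `C¹` function. -/
def fstC1 : m.Pair →ₗ[ℝ] c1Submodule :=
  (Submodule.inclusion (show m.splines ≤ c1Submodule from fun _ h => Mesh.c1_of_mem h.1)).comp
    (LinearMap.fst ℝ m.splines m.splines0)

/-- The second component of a pair, as a `C¹` function. -/
def sndC1 : m.Pair →ₗ[ℝ] c1Submodule :=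
  (Submodule.inclusion (show m.splines0 ≤ c1Submodule from fun _ h => Mesh.c1_of_mem h.1.1)).comp
    (LinearMap.snd ℝ m.splines m.splines0)

theorem c1_fst (v : m.Pair) : C1 v.1 := Mesh.c1_of_mem v.1.2.1

theorem c1_snd (v : m.Pair) : C1 v.2 := Mesh.c1_of_mem v.2.2.1.1

/-- The energy inner product `(η, φ) + a(u, χ)` on pairs. -/
noncomputable def energyForm : m.Pair →ₗ[ℝ] m.Pair →ₗ[ℝ] ℝ :=
  LinearMap.mk₂ ℝ (fun v w => ip v.1 w.1 + a v.2 w.2)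
    (fun v v' w => by
      have h1 : ip (v + v').1 w.1 = ip v.1 w.1 + ip v'.1 w.1 :=
        ip_add_left (m.c1_fst v).continuousOn (m.c1_fst v').continuousOn (m.c1_fst w).continuousOn
      have h2 : a (v + v').2 w.2 = a v.2 w.2 + a v'.2 w.2 :=
        a_add_left (m.c1_snd v) (m.c1_snd v') (m.c1_snd w)
      rw [h1, h2]; ring)
    (fun c v w => by
      have h1 : ip (c • v).1 w.1 = c * ip v.1 w.1 := ip_const_mul_left c _ _
      have h2 : a (c • v).2 w.2 = c * a v.2 w.2 := a_const_mul_left (m.c1_snd v) c _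
      rw [h1, h2, smul_eq_mul]; ring)
    (fun w v v' => by
      have h1 : ip w.1 (v + v').1 = ip w.1 v.1 + ip w.1 v'.1 :=
        ip_add_right (m.c1_fst v).continuousOn (m.c1_fst v').continuousOn (m.c1_fst w).continuousOn
      have h2 : a w.2 (v + v').2 = a w.2 v.2 + a w.2 v'.2 :=
        a_add_right (m.c1_snd v) (m.c1_snd v') (m.c1_snd w)
      rw [h1, h2]; ring)
    (fun c w v => by
      have h1 : ip w.1 (c • v).1 = c * ip w.1 v.1 := ip_const_mul_right c _ _
      have h2 : a w.2 (c • v).2 = c * a w.2 v.2 := a_const_mul_right (m.c1_snd v) c _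
      rw [h1, h2, smul_eq_mul]; ring)

theorem energyForm_apply (v w : m.Pair) : m.energyForm v w = ip v.1 w.1 + a v.2 w.2 := rfl

theorem energyForm_symm (v w : m.Pair) : m.energyForm v w = m.energyForm w v := by
  rw [energyForm_apply, energyForm_apply, ip_comm, a_comm]

theorem energyForm_nonneg (v : m.Pair) : 0 ≤ m.energyForm v v :=
  add_nonneg (ip_self_nonneg _) (a_self_nonneg _)

theorem energyForm_definite (v : m.Pair) (h : m.energyForm v v = 0) : v = 0 := by
  rw [energyForm_apply] at h
  have h1 := ip_self_nonneg v.1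
  have h2 := a_self_nonneg v.2
  have e1 : ip v.1 v.1 = 0 := by linarith
  have e2 : a v.2 v.2 = 0 := by linarith
  have e3 : ip v.2 v.2 = 0 := by
    have h3 := ip_self_nonneg v.2
    have h4 := ip_self_nonneg (dx v.2)
    rw [a] at e2
    linarith
  have z1 := eqOn_zero_of_ip_self (m.c1_fst v).continuousOn e1
  have z2 := eqOn_zero_of_ip_self (m.c1_snd v).continuousOn e3
  refine Prod.ext (Mesh.splines_ext z1) (Submodule.inclusion_injective Mesh.splines0_le ?_)
  exact Mesh.splines_ext z2

/-- The linear part of `weakForm` on pairs. -/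
noncomputable def linearPart : m.Pair →ₗ[ℝ] m.Pair →ₗ[ℝ] ℝ :=
  -dxForm.compl₁₂ m.sndC1 m.fstC1 - dxForm.compl₁₂ m.fstC1 m.sndC1

/-- The convection form evaluated at components of pairs. -/
noncomputable def convection (p q r : m.Pair →ₗ[ℝ] c1Submodule) :
    m.Pair →ₗ[ℝ] m.Pair →ₗ[ℝ] m.Pair →ₗ[ℝ] ℝ :=
  (convectionForm.compl₁₂ p q).compr₂ (LinearMap.lcomp ℝ ℝ r)

/-- The quadratic part of `weakForm` on pairs. -/
noncomputable def quadraticPart (α β γ : ℝ) : m.Pair →ₗ[ℝ] m.Pair →ₗ[ℝ] m.Pair →ₗ[ℝ] ℝ :=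
  (-α) • (m.convection m.sndC1 m.fstC1 m.fstC1 + m.convection m.fstC1 m.sndC1 m.fstC1)
    + (-β) • m.convection m.sndC1 m.sndC1 m.sndC1 + (-γ) • m.convection m.fstC1 m.fstC1 m.sndC1

theorem linearPart_add_quadraticPart (α β γ : ℝ) (y w : m.Pair) :
    m.linearPart y w + m.quadraticPart α β γ y y w = weakForm α β γ y.1 y.2 w.1 w.2 := by
  have e : ip (dx fun x => (y.1 : ℝ → ℝ) x * (y.2 : ℝ → ℝ) x) w.1 =
      ip (fun x => (y.2 : ℝ → ℝ) x * dx y.1 x) w.1 + ip (fun x => (y.1 : ℝ → ℝ) x * dx y.2 x) w.1 := by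
    rw [ip_congr ((m.c1_fst y).dx_mul (m.c1_snd y)) (fun _ _ => rfl),
      ip_add_left ((m.c1_fst y).continuousOn_dx.fun_mul (m.c1_snd y).continuousOn)
        ((m.c1_fst y).continuousOn.fun_mul (m.c1_snd y).continuousOn_dx) (m.c1_fst w).continuousOn]
    simp only [mul_comm]
  rw [weakForm, e]
  change -ip (dx y.2) w.1 - ip (dx y.1) w.2 +
    (-α * (ip (fun x => (y.2 : ℝ → ℝ) x * dx y.1 x) w.1 +
      ip (fun x => (y.1 : ℝ → ℝ) x * dx y.2 x) w.1)
      + -β * ip (fun x => (y.2 : ℝ → ℝ) x * dx y.2 x) w.2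
      + -γ * ip (fun x => (y.1 : ℝ → ℝ) x * dx y.1 x) w.2) = _
  ring

variable {m}

/-- A curve of pairs is differentiable if its components are so pointwise on `[0,1]`: the pair is a
linear function of the values of its components at the sample points. -/
theorem hasDerivWithinAt_pair {y : ℝ → m.Pair} {v : m.Pair} {s : Set ℝ} {t : ℝ}
    (h1 : ∀ x ∈ Icc (0 : ℝ) 1,
      HasDerivWithinAt (fun τ => ((y τ).1 : ℝ → ℝ) x) ((v.1 : ℝ → ℝ) x) s t)
    (h2 : ∀ x ∈ Icc (0 : ℝ) 1,
      HasDerivWithinAt (fun τ => ((y τ).2 : ℝ → ℝ) x) ((v.2 : ℝ → ℝ) x) s t)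
    (l : m.Pair →ₗ[ℝ] ℝ) : HasDerivWithinAt (fun τ => l (y τ)) (l v) s t := by
  let S : m.Pair →ₗ[ℝ] (Fin N × Fin 4 → ℝ) × (Fin N × Fin 4 → ℝ) :=
    m.sample.prodMap (m.sample.comp (Submodule.inclusion Mesh.splines0_le))
  have hS : LinearMap.ker S = ⊥ := by
    rw [LinearMap.ker_eq_bot]
    exact Mesh.sample_injective.prodMap
      (Mesh.sample_injective.comp (Submodule.inclusion_injective Mesh.splines0_le))
  obtain ⟨G, hG⟩ := LinearMap.exists_leftInverse_of_injective S hS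
  have hGS : ∀ w, G (S w) = w := fun w => LinearMap.congr_fun hG w
  have hd : HasDerivWithinAt (fun τ => S (y τ)) (S v) s t := by
    refine HasDerivWithinAt.prodMk ?_ ?_
    · exact hasDerivWithinAt_pi.2 fun q => h1 _ (Mesh.samplePoint_mem q)
    · exact hasDerivWithinAt_pi.2 fun q => h2 _ (Mesh.samplePoint_mem q)
  have := hasDerivWithinAt_iff_forall_linear.1 hd (l.comp G)
  simpa only [LinearMap.comp_apply, hGS] using this

end Mesh

theorem weakForm_congr {α β γ : ℝ} {η η' u u' φ φ' χ χ' : ℝ → ℝ} (hη : EqOn η η' (Icc 0 1))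
    (hu : EqOn u u' (Icc 0 1)) (hφ : EqOn φ φ' (Icc 0 1)) (hχ : EqOn χ χ' (Icc 0 1)) :
    weakForm α β γ η u φ χ = weakForm α β γ η' u' φ' χ' := by
  have h1 : EqOn (fun x => η x * u x) (fun x => η' x * u' x) (Icc 0 1) := fun x hx => by
    simp only [hη hx, hu hx]
  have h2 : EqOn (fun x => u x * dx u x) (fun x => u' x * dx u' x) (Icc 0 1) := fun x hx => by
    simp only [hu hx, dx_congr hu hx]
  have h3 : EqOn (fun x => η x * dx η x) (fun x => η' x * dx η' x) (Icc 0 1) := fun x hx => by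
    simp only [hη hx, dx_congr hη hx]
  rw [weakForm, weakForm, ip_congr (dx_congr hu) hφ, ip_congr (dx_congr h1) hφ,
    ip_congr (dx_congr hη) hχ, ip_congr h2 hχ, ip_congr h3 hχ]

theorem ip_zero_right (f : ℝ → ℝ) : ip f 0 = 0 := by simp [ip]

theorem a_zero_right (f : ℝ → ℝ) : a f 0 = 0 := by
  have h : EqOn (dx 0) 0 (Icc 0 1) := fun x hx => dx_eq hx (hasDerivWithinAt_const x _ 0)
  rw [a, ip_zero_right, ip_congr (f := dx f) (fun _ _ => rfl) h, ip_zero_right]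
  ring

/-- `y` solves the semidiscretization as an equation in the space of pairs, with derivative `y'`. -/
def IsWeakSolution {N : ℕ} (α β γ T : ℝ) (m : Mesh N) (y y' : ℝ → m.Pair) : Prop :=
  ∀ t ∈ Icc 0 T, (∀ l : m.Pair →ₗ[ℝ] ℝ,
      HasDerivWithinAt (fun s => l (y s)) (l (y' t)) (Icc 0 T) t) ∧
    ∀ w, m.energyForm (y' t) w = m.linearPart (y t) w + m.quadraticPart α β γ (y t) (y t) w

theorem IsWeakSolution.isGalerkin {N : ℕ} {α β γ T : ℝ} {m : Mesh N} {η₀ u₀ : ℝ → ℝ}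
    {y y' : ℝ → m.Pair} (h : IsWeakSolution α β γ T m y y')
    (h0 : ∀ w, m.energyForm (y 0) w = ip η₀ w.1 + a u₀ w.2) :
    IsGalerkin α β γ T m η₀ u₀ (fun t => (y t).1) (fun t => (y t).2) := by
  have ext1 : ∀ {φ : ℝ → ℝ} (hφ : φ ∈ m.S) (f : ℝ → ℝ),
      ip f ((Icc (0 : ℝ) 1).indicator φ) = ip f φ := fun _ f =>
    ip_congr (fun _ _ => rfl) (Mesh.indicator_eqOn _)
  refine ⟨fun t _ => (y t).1.2.1, fun t _ => Mesh.mem_S0_of_splines0 _, fun t ht => ?_,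
    ⟨(y 0).1.2.1, fun φ hφ => ?_⟩, ⟨Mesh.mem_S0_of_splines0 _, fun χ hχ => ?_⟩⟩
  · obtain ⟨hd, hw⟩ := h t ht
    refine ⟨(y' t).1, (y' t).1.2.1, (y' t).2, Mesh.mem_S0_of_splines0 _, fun x _ => ?_,
      fun x _ => ?_, fun φ hφ => ?_, fun χ hχ => ?_⟩
    · exact hd ((LinearMap.proj x).comp (m.splines.subtype.comp (LinearMap.fst ℝ _ _)))
    · exact hd ((LinearMap.proj x).comp (m.splines0.subtype.comp (LinearMap.snd ℝ _ _)))
    · have := hw (⟨_, Mesh.indicator_mem_splines hφ⟩, 0)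
      rw [Mesh.linearPart_add_quadraticPart, Mesh.energyForm_apply,
        weakForm_congr (fun _ _ => rfl) (fun _ _ => rfl) (Mesh.indicator_eqOn φ)
          (fun _ _ => rfl)] at this
      simp only [ext1 hφ, weakForm, ZeroMemClass.coe_zero, a_zero_right, ip_zero_right] at this
      linarith
    · have := hw (0, ⟨_, Mesh.indicator_mem_splines0 hχ⟩)
      rw [Mesh.linearPart_add_quadraticPart, Mesh.energyForm_apply,
        weakForm_congr (fun _ _ => rfl) (fun _ _ => rfl) (fun _ _ => rfl)
          (Mesh.indicator_eqOn χ), a_congr (fun _ _ => rfl) (Mesh.indicator_eqOn χ)] at this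
      simp only [weakForm, ZeroMemClass.coe_zero, ip_zero_right] at this
      linarith
  · have := h0 (⟨_, Mesh.indicator_mem_splines hφ⟩, 0)
    rw [Mesh.energyForm_apply] at this
    simpa only [ext1 hφ, ZeroMemClass.coe_zero, a_zero_right, add_zero] using this
  · have := h0 (0, ⟨_, Mesh.indicator_mem_splines0 hχ⟩)
    rw [Mesh.energyForm_apply] at this
    simp only [ZeroMemClass.coe_zero, ip_zero_right, zero_add] at this
    rwa [a_congr (fun _ _ => rfl) (Mesh.indicator_eqOn χ),
      a_congr (f := u₀) (fun _ _ => rfl) (Mesh.indicator_eqOn χ)] at this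

/-- Solutions of the semidiscretization are determined on `[0,1]` only; extending them by zero gives
curves in the space of pairs. -/
theorem IsGalerkin.exists_isWeakSolution {N : ℕ} {α β γ T : ℝ} (hT : 0 ≤ T) {m : Mesh N}
    {η₀ u₀ : ℝ → ℝ} {ηh uh : ℝ → ℝ → ℝ} (h : IsGalerkin α β γ T m η₀ u₀ ηh uh) :
    ∃ y y' : ℝ → m.Pair, IsWeakSolution α β γ T m y y' ∧
      (∀ w, m.energyForm (y 0) w = ip η₀ w.1 + a u₀ w.2) ∧
      ∀ t ∈ Icc 0 T, EqOn (ηh t) (y t).1 (Icc 0 1) ∧ EqOn (uh t) (y t).2 (Icc 0 1) := by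
  classical
  let y : ℝ → m.Pair := fun t => if ht : t ∈ Icc 0 T then
    (⟨_, Mesh.indicator_mem_splines (h.mem_η t ht)⟩,
      ⟨_, Mesh.indicator_mem_splines0 (h.mem_u t ht)⟩) else 0
  have hy1 : ∀ t ∈ Icc 0 T, EqOn ((y t).1 : ℝ → ℝ) (ηh t) (Icc 0 1) := fun t ht => by
    simp only [y, dif_pos ht]
    exact Mesh.indicator_eqOn _
  have hy2 : ∀ t ∈ Icc 0 T, EqOn ((y t).2 : ℝ → ℝ) (uh t) (Icc 0 1) := fun t ht => by
    simp only [y, dif_pos ht]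
    exact Mesh.indicator_eqOn _
  have hder : ∀ t, ∃ v : m.Pair, t ∈ Icc 0 T → (∀ l : m.Pair →ₗ[ℝ] ℝ,
      HasDerivWithinAt (fun s => l (y s)) (l v) (Icc 0 T) t) ∧
      ∀ w, m.energyForm v w = m.linearPart (y t) w + m.quadraticPart α β γ (y t) (y t) w := by
    intro t
    by_cases ht : t ∈ Icc 0 T
    · obtain ⟨ηt, hηt, ut, hut, d1, d2, w1, w2⟩ := h.ode t ht
      refine ⟨(⟨_, Mesh.indicator_mem_splines hηt⟩, ⟨_, Mesh.indicator_mem_splines0 hut⟩),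
        fun _ => ⟨Mesh.hasDerivWithinAt_pair (fun x hx => ?_) fun x hx => ?_, fun w => ?_⟩⟩
      · simp only [Mesh.indicator_eqOn ηt hx]
        exact (d1 x hx).congr (fun s hs => hy1 s hs hx) (hy1 t ht hx)
      · simp only [Mesh.indicator_eqOn ut hx]
        exact (d2 x hx).congr (fun s hs => hy2 s hs hx) (hy2 t ht hx)
      · rw [Mesh.linearPart_add_quadraticPart, Mesh.energyForm_apply,
          weakForm_congr (hy1 t ht) (hy2 t ht) (fun _ _ => rfl) (fun _ _ => rfl),
          ip_congr (Mesh.indicator_eqOn ηt) (fun _ _ => rfl),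
          a_congr (Mesh.indicator_eqOn ut) (fun _ _ => rfl), weakForm]
        have := w1 _ w.1.2.1
        have := w2 _ (Mesh.mem_S0_of_splines0 w.2)
        linarith
    · exact ⟨0, fun h => absurd h ht⟩
  choose y' hy' using hder
  have h0 : (0 : ℝ) ∈ Icc 0 T := left_mem_Icc.2 hT
  refine ⟨y, y', fun t ht => hy' t ht, fun w => ?_, fun t ht => ⟨(hy1 t ht).symm, (hy2 t ht).symm⟩⟩
  rw [Mesh.energyForm_apply, ip_congr (hy1 0 h0) (fun _ _ => rfl),
    a_congr (hy2 0 h0) (fun _ _ => rfl), h.initial_η.2 _ w.1.2.1,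
    h.initial_u.2 _ (Mesh.mem_S0_of_splines0 w.2)]

/-! ### Time derivatives of moments of the exact solution -/

/-- Differentiation under the integral sign, from pointwise derivatives that are bounded. -/
theorem hasDerivWithinAt_ip {f f' : ℝ → ℝ → ℝ} {g : ℝ → ℝ} {T M : ℝ}
    (hf : ∀ t ∈ Icc 0 T, ContinuousOn (f t) (Icc 0 1))
    (hd : ∀ t ∈ Icc 0 T, ∀ x ∈ Icc (0 : ℝ) 1,
      HasDerivWithinAt (fun s => f s x) (f' t x) (Icc 0 T) t)
    (hb : ∀ t ∈ Icc 0 T, ∀ x ∈ Icc (0 : ℝ) 1, |f' t x| ≤ M) (hg : ContinuousOn g (Icc 0 1))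
    {t : ℝ} (ht : t ∈ Icc 0 T) :
    HasDerivWithinAt (fun s => ip (f s) g) (ip (f' t) g) (Icc 0 T) t := by
  rw [hasDerivWithinAt_iff_tendsto_slope]
  have hmem : ∀ᶠ s in 𝓝[Icc 0 T \ {t}] t, s ∈ Icc 0 T :=
    Filter.mem_of_superset self_mem_nhdsWithin sdiff_subset
  have hsub : Ioc (0 : ℝ) 1 ⊆ Icc 0 1 := Ioc_subset_Icc_self
  have hslope : ∀ᶠ s in 𝓝[Icc 0 T \ {t}] t,
      ∫ x in (0 : ℝ)..1, slope (fun s => f s x) t s * g x = slope (fun s => ip (f s) g) t s := by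
    filter_upwards [hmem] with s hs
    have h1 : ip (fun x => f s x - f t x) g = ip (f s) g - ip (f t) g :=
      ip_sub_left (hf s hs) (hf t ht) hg
    rw [slope_def_field, ← h1, ip, ← intervalIntegral.integral_div]
    congr 1
    ext x
    rw [slope_def_field]
    ring
  refine Filter.Tendsto.congr' hslope ?_
  refine intervalIntegral.tendsto_integral_filter_of_dominated_convergence
    (fun x => M * |g x|) ?_ ?_ ?_ ?_
  · filter_upwards [hmem] with s hs
    have hc : ContinuousOn (fun x => slope (fun s => f s x) t s * g x) (Icc 0 1) := by
      simp only [slope_def_field]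
      exact (((hf s hs).sub (hf t ht)).div_const _).mul hg
    rw [uIoc_of_le zero_le_one]
    exact (hc.mono hsub).aestronglyMeasurable measurableSet_Ioc
  · filter_upwards [self_mem_nhdsWithin] with s hs
    refine Filter.Eventually.of_forall fun x hx => ?_
    rw [uIoc_of_le zero_le_one] at hx
    have hlip := Convex.norm_image_sub_le_of_norm_hasDerivWithin_le
      (f := fun s => f s x) (f' := fun s => f' s x) (fun τ hτ => hd τ hτ x (hsub hx))
      (fun τ hτ => hb τ hτ x (hsub hx)) (convex_Icc 0 T) ht hs.1
    rw [Real.norm_eq_abs, Real.norm_eq_abs] at hlip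
    have hne : 0 < |s - t| := abs_pos.2 (sub_ne_zero.2 hs.2)
    rw [Real.norm_eq_abs, abs_mul, slope_def_field, abs_div]
    exact mul_le_mul_of_nonneg_right ((div_le_iff₀ hne).2 hlip) (abs_nonneg _)
  · exact (hg.abs.intervalIntegrable_of_mem zero_mem01 one_mem01).const_mul M
  · refine Filter.Eventually.of_forall fun x hx => ?_
    rw [uIoc_of_le zero_le_one] at hx
    exact (hasDerivWithinAt_iff_tendsto_slope.1 (hd t ht x (hsub hx))).mul_const _

/-- For `χ` vanishing at the end points, `a(u, χ) = (u - u''/3, χ)`: it is this combination of `u`,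
and not `u` itself, whose time derivative the second equation bounds. -/
theorem a_eq_ip {u χ : ℝ → ℝ} (hu : ContDiffOn ℝ 2 u (Icc 0 1)) (hχ : C1 χ) (h0 : χ 0 = 0)
    (h1 : χ 1 = 0) : a u χ = ip (fun x => u x - 1 / 3 * dx (dx u) x) χ := by
  have hdu := c1_dx_of_contDiffOn_two hu
  have e := ip_dx_left hdu hχ
  rw [h0, h1, mul_zero, mul_zero, sub_zero, zero_sub] at e
  rw [ip_sub_left hu.continuousOn (continuousOn_const.fun_mul hdu.continuousOn_dx) hχ.continuousOn,
    ip_const_mul_left, e, a]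
  ring

/-- The weak form of the equations satisfied by the exact solution. The bounds make the time
derivatives of `η` and of `u - u''/3` bounded, through the equations. -/
theorem IsSolution.hasDerivWithinAt {α β γ T M : ℝ} {η₀ u₀ : ℝ → ℝ} {η u : ℝ → ℝ → ℝ}
    (h : IsSolution α β γ T η₀ u₀ η u)
    (hη : ∀ t ∈ Icc 0 T, ∀ x ∈ Icc (0 : ℝ) 1, |η t x| ≤ M ∧ |dx (η t) x| ≤ M)
    (hu : ∀ t ∈ Icc 0 T, ∀ x ∈ Icc (0 : ℝ) 1, |u t x| ≤ M ∧ |dx (u t) x| ≤ M)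
    {φ χ : ℝ → ℝ} (hφ : C1 φ) (hχ : C1 χ) (hχ0 : χ 0 = 0) (hχ1 : χ 1 = 0) {t : ℝ}
    (ht : t ∈ Icc 0 T) :
    HasDerivWithinAt (fun s => ip (η s) φ + a (u s) χ) (weakForm α β γ (η t) (u t) φ χ)
      (Icc 0 T) t := by
  have hM : 0 ≤ M := (abs_nonneg _).trans (hη t ht 0 zero_mem01).1
  have hηC : ∀ s ∈ Icc 0 T, C1 (η s) := h.contDiff_η
  have huC : ∀ s ∈ Icc 0 T, C1 (u s) := fun s hs => c1_of_contDiffOn_two (h.contDiff_u s hs)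
  have hprod : ∀ {p q : ℝ}, |p| ≤ M → |q| ≤ M → |p * q| ≤ M ^ 2 := fun hp hq => by
    rw [abs_mul, sq]
    exact mul_le_mul hp hq (abs_nonneg _) hM
  have hmul : ∀ (c : ℝ) {y B : ℝ}, |y| ≤ B → |c * y| ≤ |c| * B := fun c y B hy => by
    rw [abs_mul]
    exact mul_le_mul_of_nonneg_left hy (abs_nonneg c)
  have d1 : HasDerivWithinAt (fun s => ip (η s) φ)
      (ip (fun x => -1 * (dx (u t) x + α * dx (fun y => η t y * u t y) x)) φ) (Icc 0 T) t := by
    refine hasDerivWithinAt_ip (f' := fun t x => -1 * (dx (u t) x +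
      α * dx (fun y => η t y * u t y) x)) (M := M + |α| * (M ^ 2 + M ^ 2))
      (fun s hs => (hηC s hs).continuousOn) (fun s hs x hx => ?_) (fun s hs x hx => ?_)
      hφ.continuousOn ht
    · obtain ⟨ηt, ut, uxxt, hηt, -, -, e, -⟩ := h.pde s hs x hx
      exact hηt.congr_deriv (by linarith)
    · have e := (hηC s hs).dx_mul (huC s hs) hx
      simp only at e
      rw [abs_mul, e, abs_neg, abs_one, one_mul]
      refine (abs_add_le _ _).trans (add_le_add (hu s hs x hx).2 (hmul α ?_))
      exact (abs_add_le _ _).trans (add_le_add (hprod (hη s hs x hx).2 (hu s hs x hx).1)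
        (hprod (hη s hs x hx).1 (hu s hs x hx).2))
  have d2 : HasDerivWithinAt (fun s => ip (fun x => u s x - 1 / 3 * dx (dx (u s)) x) χ)
      (ip (fun x => -1 * ((dx (η t) x + β * (u t x * dx (u t) x)) +
        γ * (η t x * dx (η t) x))) χ) (Icc 0 T) t := by
    refine hasDerivWithinAt_ip (f' := fun t x => -1 * ((dx (η t) x + β * (u t x * dx (u t) x)) +
        γ * (η t x * dx (η t) x))) (M := (M + |β| * M ^ 2) + |γ| * M ^ 2)
      (fun s hs => (huC s hs).continuousOn.sub (continuousOn_const.fun_mul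
        (c1_dx_of_contDiffOn_two (h.contDiff_u s hs)).continuousOn_dx))
      (fun s hs x hx => ?_) (fun s hs x hx => ?_) hχ.continuousOn ht
    · obtain ⟨ηt, ut, uxxt, -, hut, huxxt, -, e⟩ := h.pde s hs x hx
      exact (hut.sub (huxxt.const_mul (1 / 3))).congr_deriv (by linarith)
    · rw [abs_mul, abs_neg, abs_one, one_mul]
      refine (abs_add_le _ _).trans (add_le_add ((abs_add_le _ _).trans
        (add_le_add (hη s hs x hx).2 (hmul β ?_))) (hmul γ ?_))
      · exact hprod (hu s hs x hx).1 (hu s hs x hx).2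
      · exact hprod (hη s hs x hx).1 (hη s hs x hx).2
  have hc1 := (huC t ht).continuousOn_dx
  have hc2 := ((hηC t ht).mul (huC t ht)).continuousOn_dx
  have hc3 := (hηC t ht).continuousOn_dx
  have hc4 := (huC t ht).continuousOn.fun_mul (huC t ht).continuousOn_dx
  have hc5 := (hηC t ht).continuousOn.fun_mul (hηC t ht).continuousOn_dx
  rw [ip_const_mul_left, ip_add_left hc1 (continuousOn_const.fun_mul hc2) hφ.continuousOn,
    ip_const_mul_left] at d1
  rw [ip_const_mul_left, ip_add_left (hc3.fun_add (continuousOn_const.fun_mul hc4))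
    (continuousOn_const.fun_mul hc5) hχ.continuousOn,
    ip_add_left hc3 (continuousOn_const.fun_mul hc4) hχ.continuousOn,
    ip_const_mul_left, ip_const_mul_left] at d2
  have d3 := (d1.add d2).congr_deriv (g' := weakForm α β γ (η t) (u t) φ χ)
    (by rw [weakForm]; ring)
  refine d3.congr (fun s hs => ?_) ?_
  · simp only [Pi.add_apply, a_eq_ip (h.contDiff_u s hs) hχ hχ0 hχ1]
  · simp only [Pi.add_apply, a_eq_ip (h.contDiff_u t ht) hχ hχ0 hχ1]

/-! ### Convergence of the semidiscretization -/

theorem MemCWInfty.exists_bound {T : ℝ} {k : ℕ} (hT : 0 ≤ T) {f : ℝ → ℝ → ℝ}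
    (h : MemCWInfty T k f) :
    ∃ M, 0 ≤ M ∧ ∀ t ∈ Icc 0 T, normWInfty k (f t) ≤ ENNReal.ofReal M := by
  obtain ⟨t₀, ht₀, hmax⟩ := isCompact_Icc.exists_isMaxOn ⟨0, left_mem_Icc.2 hT⟩ h.2
  refine ⟨(normWInfty k (f t₀)).toReal, ENNReal.toReal_nonneg, fun t ht => ?_⟩
  rw [ENNReal.ofReal_toReal (normWInfty_lt_top (h.1 t₀ ht₀)).ne]
  exact hmax ht

theorem n1_le_of_a_self_le {f : ℝ → ℝ} {r : ℝ} (hr : 0 ≤ r) (h : a f f ≤ r ^ 2) :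
    n1 f ≤ 3 * r := by
  rw [a_self] at h
  have h1 : normL2 f ≤ r :=
    (abs_le_of_sq_le_sq' (by nlinarith [sq_nonneg (normL2 (dx f))]) hr).2
  have h2 : normL2 (dx f) ≤ 2 * r :=
    (abs_le_of_sq_le_sq' (by nlinarith [sq_nonneg (normL2 f)]) (by linarith)).2
  rw [n1]
  linarith

theorem normH1_le_n1 (f : ℝ → ℝ) : normH1 f ≤ n1 f := by
  rw [normH1]
  refine Real.sqrt_le_iff.2 ⟨n1_nonneg f, ?_⟩
  rw [n1]
  nlinarith [normL2_nonneg f, normL2_nonneg (dx f),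
    mul_nonneg (normL2_nonneg f) (normL2_nonneg (dx f)), sq_nonneg (normL2 (dx f))]

/-- Existence, uniqueness and the error estimate for the family of problems that contains the
classical (`α, β, γ = 1, 1, 0`) and the symmetric (`α, β, γ = 1/2, 3/2, 1/2`) Boussinesq system. -/
theorem exists_galerkin_error_le {α β γ T : ℝ} (hT : 0 < T) (κ : ℝ) {η₀ u₀ : ℝ → ℝ}
    {η u : ℝ → ℝ → ℝ} (hη : MemCWInfty T 4 η) (hu : MemCWInfty T 4 u)
    (h : IsSolution α β γ T η₀ u₀ η u) :
    ∃ h₀ > 0, ∃ C > 0, ∀ (N : ℕ) (m : Mesh N), m.Quasiuniform κ → m.h ≤ h₀ →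
      ∃ ηh uh : ℝ → ℝ → ℝ, IsGalerkin α β γ T m η₀ u₀ ηh uh ∧
        (∀ ηh' uh' : ℝ → ℝ → ℝ, IsGalerkin α β γ T m η₀ u₀ ηh' uh' →
          ∀ t ∈ Icc 0 T, EqOn (ηh' t) (ηh t) (Icc 0 1) ∧ EqOn (uh' t) (uh t) (Icc 0 1)) ∧
        (∀ t ∈ Icc 0 T, normL2 (fun x => η t x - ηh t x) ≤ C * m.h ^ 3 ∧
          normH1 (fun x => u t x - uh t x) ≤ C * m.h ^ 3) := by
  have h0T : (0 : ℝ) ∈ Icc 0 T := left_mem_Icc.2 hT.le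
  have hηC : ∀ s ∈ Icc 0 T, C1 (η s) := h.contDiff_η
  have huC : ∀ s ∈ Icc 0 T, C1 (u s) := fun s hs => c1_of_contDiffOn_two (h.contDiff_u s hs)
  obtain ⟨M₁, hM₁, hM₁'⟩ := hη.exists_bound hT.le
  obtain ⟨M₂, hM₂, hM₂'⟩ := hu.exists_bound hT.le
  set M := max M₁ M₂ with hM
  have hM0 : 0 ≤ M := hM₁.trans (le_max_left _ _)
  have regη : ∀ t ∈ Icc 0 T, ∃ w w₁ w₂ w₃, EqOn (η t) w (Icc 0 1) ∧ IsRegular M w w₁ w₂ w₃ :=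
    fun t ht => exists_isRegular hM0 (hηC t ht).continuousOn (hη.1 t ht)
      ((hM₁' t ht).trans (ENNReal.ofReal_le_ofReal (le_max_left _ _)))
  have regu : ∀ t ∈ Icc 0 T, ∃ w w₁ w₂ w₃, EqOn (u t) w (Icc 0 1) ∧ IsRegular M w w₁ w₂ w₃ :=
    fun t ht => exists_isRegular hM0 (huC t ht).continuousOn (hu.1 t ht)
      ((hM₂' t ht).trans (ENNReal.ofReal_le_ofReal (le_max_right _ _)))
  have bound : ∀ {f w w₁ w₂ w₃ : ℝ → ℝ}, EqOn f w (Icc 0 1) → IsRegular M w w₁ w₂ w₃ →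
      ∀ x ∈ Icc (0 : ℝ) 1, |f x| ≤ M ∧ |dx f x| ≤ M := by
    intro f w w₁ w₂ w₃ he hw x hx
    rw [he hx, dx_congr he hx, dx_of_hasDerivAt hw.deriv0 hx]
    exact ⟨hw.bound0 x hx, hw.bound1 x hx⟩
  have hηb : ∀ t ∈ Icc 0 T, ∀ x ∈ Icc (0 : ℝ) 1, |η t x| ≤ M ∧ |dx (η t) x| ≤ M := fun t ht => by
    obtain ⟨w, w₁, w₂, w₃, he, hw⟩ := regη t ht
    exact bound he hw
  have hub : ∀ t ∈ Icc 0 T, ∀ x ∈ Icc (0 : ℝ) 1, |u t x| ≤ M ∧ |dx (u t) x| ≤ M := fun t ht => by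
    obtain ⟨w, w₁, w₂, w₃, he, hw⟩ := regu t ht
    exact bound he hw
  -- `A` bounds the exact solution and the constants of the projections and the inverse inequality
  set k := |κ| with hk
  have hk0 : 0 ≤ k := abs_nonneg κ
  set A := 1 + 15 * k + (6 + 15 * k) * M with hA
  have hkM : 0 ≤ k * M := mul_nonneg hk0 hM0
  have hA1 : 1 ≤ A := by rw [hA]; nlinarith
  have hAM : M ≤ A := by rw [hA]; nlinarith
  have n1_bound : ∀ {f : ℝ → ℝ}, C1 f → (∀ x ∈ Icc (0 : ℝ) 1, |f x| ≤ M ∧ |dx f x| ≤ M) →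
      n1 f ≤ 2 * A := fun {f} hf hb => by
    have h1 := normL2_le_of_bound hf.continuousOn fun x hx => (hb x hx).1
    have h2 := normL2_le_of_bound hf.continuousOn_dx fun x hx => (hb x hx).2
    rw [n1]
    linarith
  set C₀ := 100 * A ^ 2 * (1 + |α| + |β| + |γ|) with hC₀
  have hC₀0 : 0 ≤ C₀ := by positivity
  set G := Real.exp (2 * C₀ * T) with hG
  have hG1 : 1 ≤ G := Real.one_le_exp (by positivity)
  have hG0 : 0 < G := zero_lt_one.trans_le hG1
  -- `h ≤ 1 / G` keeps the error bound `h³ G` below `h`, the size of the perturbations that the energy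
  -- estimate admits
  refine ⟨G⁻¹, inv_pos.2 hG0, A + 3 * G, by linarith, fun N m hq hmh => ?_⟩
  have hh := m.h_pos
  have hh1 : m.h ≤ 1 := hmh.trans (inv_le_one_of_one_le₀ hG1)
  have hhG : m.h * G ≤ 1 := by
    calc m.h * G ≤ G⁻¹ * G := by gcongr
      _ = 1 := inv_mul_cancel₀ hG0.ne'
  have hεδ : m.h ^ 3 * G ≤ m.h := by
    calc m.h ^ 3 * G = m.h * m.h * (m.h * G) := by ring
      _ ≤ m.h * 1 * 1 := by gcongr
      _ = m.h := by ring
  have hqk : m.Quasiuniform k := fun i j =>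
    (hq i j).trans (mul_le_mul_of_nonneg_right (le_abs_self κ) (m.width_pos j).le)
  have hh34 : m.h ^ 4 ≤ m.h ^ 3 := pow_le_pow_of_le_one hh.le hh1 (by norm_num)
  have hh3 : 0 < m.h ^ 3 := by positivity
  -- the pair of projections, as a Riesz representative
  have hYex : ∀ t, ∃ Y : m.Pair, t ∈ Icc 0 T →
      ∀ w, m.energyForm Y w = ip (η t) w.1 + a (u t) w.2 := by
    intro t
    by_cases ht : t ∈ Icc 0 T
    · let l : m.Pair →ₗ[ℝ] ℝ :=
        { toFun := fun w => ip (η t) w.1 + a (u t) w.2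
          map_add' := fun w w' => by
            have h1 : ip (η t) (w + w').1 = ip (η t) w.1 + ip (η t) w'.1 :=
              ip_add_right (m.c1_fst w).continuousOn (m.c1_fst w').continuousOn
                (hηC t ht).continuousOn
            have h2 : a (u t) (w + w').2 = a (u t) w.2 + a (u t) w'.2 :=
              a_add_right (m.c1_snd w) (m.c1_snd w') (huC t ht)
            rw [h1, h2]; ring
          map_smul' := fun c w => by
            have h1 : ip (η t) (c • w).1 = c * ip (η t) w.1 := ip_const_mul_right c _ _
            have h2 : a (u t) (c • w).2 = c * a (u t) w.2 := a_const_mul_right (m.c1_snd w) c _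
            rw [h1, h2, RingHom.id_apply, smul_eq_mul]; ring }
      obtain ⟨Y, hY⟩ := exists_riesz m.energyForm m.energyForm_definite l
      exact ⟨Y, fun _ => hY⟩
    · exact ⟨0, fun ht' => absurd ht' ht⟩
  choose Y hY using hYex
  have hproj1 : ∀ t ∈ Icc 0 T, m.IsL2Proj (η t) (Y t).1 := fun t ht =>
    ⟨(Y t).1.2.1, fun φ hφ => by
      have := hY t ht (⟨_, Mesh.indicator_mem_splines hφ⟩, 0)
      rw [Mesh.energyForm_apply] at this
      simp only [ZeroMemClass.coe_zero, a_zero_right, add_zero] at this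
      rwa [ip_congr (fun _ _ => rfl) (Mesh.indicator_eqOn φ),
        ip_congr (f := η t) (fun _ _ => rfl) (Mesh.indicator_eqOn φ)] at this⟩
  have hproj2 : ∀ t ∈ Icc 0 T, m.IsEllipticProj (u t) (Y t).2 := fun t ht =>
    ⟨Mesh.mem_S0_of_splines0 _, fun χ hχ => by
      have := hY t ht (0, ⟨_, Mesh.indicator_mem_splines0 hχ⟩)
      rw [Mesh.energyForm_apply] at this
      simp only [ZeroMemClass.coe_zero, ip_zero_right, zero_add] at this
      rwa [a_congr (fun _ _ => rfl) (Mesh.indicator_eqOn χ),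
        a_congr (f := u t) (fun _ _ => rfl) (Mesh.indicator_eqOn χ)] at this⟩
  have hρ : ∀ t ∈ Icc 0 T, n1 (fun x => η t x - ((Y t).1 : ℝ → ℝ) x) ≤ A * m.h ^ 3 := by
    intro t ht
    obtain ⟨w, w₁, w₂, w₃, he, hw⟩ := regη t ht
    obtain ⟨b1, b2⟩ := (hproj1 t ht).error_le hqk hM0 (hηC t ht) he hw
    rw [n1]
    calc _ ≤ M * m.h ^ 3 + (1 + 15 * k) * M * m.h ^ 3 :=
          add_le_add (b1.trans (mul_le_mul_of_nonneg_left hh34 hM0)) b2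
      _ = (M + (1 + 15 * k) * M) * m.h ^ 3 := by ring
      _ ≤ A * m.h ^ 3 := by gcongr; rw [hA]; nlinarith
  have hσ : ∀ t ∈ Icc 0 T, n1 (fun x => u t x - ((Y t).2 : ℝ → ℝ) x) ≤ A * m.h ^ 3 := by
    intro t ht
    obtain ⟨w, w₁, w₂, w₃, he, hw⟩ := regu t ht
    obtain ⟨b1, b2⟩ := (hproj2 t ht).error_le hM0 hh1 (huC t ht) (h.boundary t ht).1
      (h.boundary t ht).2 he hw
    rw [n1]
    calc _ ≤ 2 * M * m.h ^ 3 + 2 * M * m.h ^ 3 := add_le_add b1 b2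
      _ = 4 * M * m.h ^ 3 := by ring
      _ ≤ A * m.h ^ 3 := by gcongr; rw [hA]; nlinarith
  obtain ⟨⟨y, y', hy0, hy, hyerr⟩, huniq⟩ := exists_weak_solution_near m.energyForm
    m.energyForm_symm m.energyForm_nonneg m.energyForm_definite m.linearPart
    (m.quadraticPart α β γ) hT hh hC₀0 hh3.le (Y := Y)
    (D := fun t w => weakForm α β γ (η t) (u t) w.1 w.2)
    (fun t ht w => (h.hasDerivWithinAt hηb hub (m.c1_fst w) (m.c1_snd w) w.2.2.2.1 w.2.2.2.2
      ht).congr (fun s hs => hY s hs w) (hY t ht w))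
    (fun t ht z r hr hrz hrh => by
      rw [Mesh.linearPart_add_quadraticPart]
      rw [Mesh.energyForm_apply] at hrz
      have hz1 : normL2 z.1 ≤ r := by
        refine (abs_le_of_sq_le_sq' ?_ hr).2
        rw [normL2_sq, hrz]
        linarith [a_self_nonneg z.2]
      have hz2 : n1 z.2 ≤ 3 * r := n1_le_of_a_self_le hr (by
        rw [hrz]
        linarith [ip_self_nonneg z.1])
      refine weakForm_sub_le (hηC t ht) (huC t ht) (m.c1_fst _) (m.c1_snd _) (m.c1_fst z)
        (m.c1_snd z) (Y t).2.2.2.1 (Y t).2.2.2.2 z.2.2.2.1 z.2.2.2.2 hA1 hh hh1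
        (fun x hx => (hηb t ht x hx).1.trans hAM) (n1_bound (hηC t ht) (hηb t ht))
        (n1_bound (huC t ht) (hub t ht)) (fun x hx => (hub t ht x hx).2.trans hAM)
        (hρ t ht) (hσ t ht) ?_ hz1 hz2 hrh
      have hinv := Mesh.inverse_le hqk z.1.2.1
      have hn := normL2_nonneg z.1
      calc m.h * n1 z.1 = m.h * normL2 z.1 + m.h * normL2 (dx z.1) := by rw [n1]; ring
        _ ≤ 1 * normL2 z.1 + 15 * k * normL2 z.1 := by gcongr
        _ = (1 + 15 * k) * normL2 z.1 := by ring
        _ ≤ A * normL2 z.1 := by gcongr; rw [hA]; nlinarith)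
    hεδ
  have hinit : ∀ w, m.energyForm (Y 0) w = ip η₀ w.1 + a u₀ w.2 := fun w => by
    rw [hY 0 h0T, ip_congr h.initial_η (fun _ _ => rfl), a_congr h.initial_u (fun _ _ => rfl)]
  refine ⟨fun t => (y t).1, fun t => (y t).2,
    IsWeakSolution.isGalerkin (y' := y') hy (by rw [hy0]; exact hinit), fun ηh' uh' h' => ?_,
    fun t ht => ?_⟩
  · obtain ⟨z, z', hz, hz0, hze⟩ := h'.exists_isWeakSolution hT.le
    have heq : z 0 = y 0 := by
      have e : m.energyForm (z 0) = m.energyForm (y 0) :=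
        LinearMap.ext fun w => by rw [hz0, hy0, hinit]
      refine sub_eq_zero.1 (m.energyForm_definite _ ?_)
      rw [map_sub m.energyForm, e, sub_self, LinearMap.zero_apply]
    intro t ht
    have e := huniq z y z' y' heq hz hy ht
    simp only [← e]
    exact hze t ht
  · have herr := hyerr t ht
    have hGh : 0 ≤ m.h ^ 3 * G := by positivity
    rw [Mesh.energyForm_apply] at herr
    have e1 : normL2 (Y t - y t).1 ≤ m.h ^ 3 * G := by
      refine (abs_le_of_sq_le_sq' ?_ hGh).2
      rw [normL2_sq]
      linarith [a_self_nonneg (Y t - y t).2]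
    have e2 : n1 (Y t - y t).2 ≤ 3 * (m.h ^ 3 * G) :=
      n1_le_of_a_self_le hGh (by linarith [ip_self_nonneg (Y t - y t).1])
    constructor
    · have hs : (fun x => η t x - ((y t).1 : ℝ → ℝ) x) =
          fun x => (η t x - ((Y t).1 : ℝ → ℝ) x) + ((Y t - y t).1 : ℝ → ℝ) x := by
        ext x
        change _ = _ + (((Y t).1 : ℝ → ℝ) x - ((y t).1 : ℝ → ℝ) x)
        ring
      rw [hs]
      refine (normL2_add_le ((hηC t ht).sub (m.c1_fst _)).continuousOn
        (m.c1_fst _).continuousOn).trans ?_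
      have := (normL2_le_n1 _).trans (hρ t ht)
      linarith
    · have hs : (fun x => u t x - ((y t).2 : ℝ → ℝ) x) =
          fun x => (u t x - ((Y t).2 : ℝ → ℝ) x) + ((Y t - y t).2 : ℝ → ℝ) x := by
        ext x
        change _ = _ + (((Y t).2 : ℝ → ℝ) x - ((y t).2 : ℝ → ℝ) x)
        ring
      rw [hs]
      refine (normH1_le_n1 _).trans ((n1_add_le ((huC t ht).sub (m.c1_snd _))
        (m.c1_snd _)).trans ?_)
      have := hσ t ht
      linarith

end Boussinesq

theorem proposition3p1 (T : ℝ) (hT : 0 < T) (κ : ℝ) (η₀ u₀ : ℝ → ℝ) (η u : ℝ → ℝ → ℝ)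
    (hη : Boussinesq.MemCWInfty T 4 η) (hu : Boussinesq.MemCWInfty T 4 u) :
    (Boussinesq.IsSolutionCB T η₀ u₀ η u →
      ∃ h₀ > 0, ∃ C > 0, ∀ (N : ℕ) (m : Boussinesq.Mesh N), m.Quasiuniform κ → m.h ≤ h₀ →
        ∃ ηh uh : ℝ → ℝ → ℝ, Boussinesq.IsGalerkinCB T m η₀ u₀ ηh uh ∧
          (∀ ηh' uh' : ℝ → ℝ → ℝ, Boussinesq.IsGalerkinCB T m η₀ u₀ ηh' uh' →
            ∀ t ∈ Set.Icc 0 T, Set.EqOn (ηh' t) (ηh t) (Set.Icc 0 1) ∧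
              Set.EqOn (uh' t) (uh t) (Set.Icc 0 1)) ∧
          (∀ t ∈ Set.Icc 0 T,
            Boussinesq.normL2 (fun x => η t x - ηh t x) ≤ C * m.h ^ 3 ∧
            Boussinesq.normH1 (fun x => u t x - uh t x) ≤ C * m.h ^ 3)) ∧
    (Boussinesq.IsSolutionSCB T η₀ u₀ η u →
      ∃ h₀ > 0, ∃ C > 0, ∀ (N : ℕ) (m : Boussinesq.Mesh N), m.Quasiuniform κ → m.h ≤ h₀ →
        ∃ ηh uh : ℝ → ℝ → ℝ, Boussinesq.IsGalerkinSCB T m η₀ u₀ ηh uh ∧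
          (∀ ηh' uh' : ℝ → ℝ → ℝ, Boussinesq.IsGalerkinSCB T m η₀ u₀ ηh' uh' →
            ∀ t ∈ Set.Icc 0 T, Set.EqOn (ηh' t) (ηh t) (Set.Icc 0 1) ∧
              Set.EqOn (uh' t) (uh t) (Set.Icc 0 1)) ∧
          (∀ t ∈ Set.Icc 0 T,
            Boussinesq.normL2 (fun x => η t x - ηh t x) ≤ C * m.h ^ 3 ∧
            Boussinesq.normH1 (fun x => u t x - uh t x) ≤ C * m.h ^ 3)) :=
  ⟨fun h => Boussinesq.exists_galerkin_error_le hT κ hη hu h,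
    fun h => Boussinesq.exists_galerkin_error_le hT κ hη hu h⟩
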